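/- Let $H,U$ be Hilbert spaces (real or complex), $\theta>0$, and let $A(\cdot),B(\cdot),C(\cdot),Q(\cdot),y_d(\cdot)$ be $\theta$-periodic on $\mathbb R$, where $B(t)\in L(U,H)$, $C(t)\in L(H)$ and $Q(t)\in L(U)$ are bounded and strongly continuous in $t$, $C(t)=C(t)^*\ge 0$, $Q(t)=Q(t)^*\ge\varepsilon I$ for some $\varepsilon>0$ independent of $t$, and $y_d\in C(\mathbb R;H)$. The operators $A(t)$ are unbounded linear operators in $H$ which generate an evolution system: there is a strongly continuous family $U_A(t,s)\in L(H)$, $0\le s\le t$, with $U_A(s,s)=I$, $U_A(t,r)U_A(r,s)=U_A(t,s)$ for $0\le s\le r\le t$, and $\partial_tU_A(t,s)x=A(t)U_A(t,s)x$ (derivative from the right) whenever $U_A(t,s)x\in D(A(t))$; and for $n$ large the Yosida approximations $A_n(t)=n^2(n-A(t))^{-1}-nI$ exist for all $t\ge 0$, are bounded in norm on bounded time intervals, and generate evolution operators $U_{A_n}$ (that is, $U_{A_n}(t,s)x=x+\int_s^tA_n(r)U_{A_n}(r,s)x\,dr$) such that $U_{A_n}(t,s)x\to U_A(t,s)x$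 for every $x\in H$, uniformly on $\{0\le s\le t\le b\}$ for every $b>0$. Solutions of all equations are mild solutions; in particular, on $[0,T]$, $y'=A(t)y+B(t)u$ means $y(t)=U_A(t,0)y(0)+\int_0^tU_A(t,s)B(s)u(s)\,ds$, and $$\lambda'=-C^*(t)C(t)y-A^*(t)\lambda+C^*(t)C(t)y_d \tag{1}$$ means $\lambda(t)=U_A(T,t)^*\lambda(T)+\int_t^TU_A(\tau,t)^*C^*(\tau)C(\tau)(y(\tau)-y_d(\tau))\,d\tau$ for every $t\in[0,T]$. For $T>0$ put $J_T(y,u)=\frac12\int_0^T\big(\|C(t)(y(t)-y_d(t))\|^2+\|Q^{1/2}(t)u(t)\|^2\big)dt$, where $(y,u)\in C([0,T];H)\times L^2(0,T;U)$ satisfies $y'=A(t)y+B(t)u$ on $[0,T]$. For a given $y_0\in H$, problem $(LQ)^T$ is to minimize $J_T$ over such pairs with $y(0)=y_0$; problem $(Per)_\theta$ is to minimize $J_\theta$ over such pairs on $[0,\theta]$ with $y(0)=y(\theta)$. A solution $(y,u,\lambda)$ of $(LQ)^T$ is an optimal pair $(y,u)$ together with an adjoint state $\lambda$, i.e. a solution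 of (1) on $[0,T]$ with $\lambda(T)=0$ and $u(t)=-Q^{-1}(t)B^*(t)\lambda(t)$ for a.e. $t$; a solution of $(Per)_\theta$ is defined in the same way on $[0,\theta]$, with $\lambda(0)=\lambda(\theta)$ instead of $\lambda(T)=0$. Assume that $(A(\cdot),B(\cdot))$ is exponentially $\theta$-periodic stabilizable and that $(A(\cdot),C(\cdot))$ is exponentially $\theta$-periodic detectable, i.e. there are $\theta$-periodic, strongly continuous $K_1(t)\in L(H,U)$ and $K_2(t)\in L(H)$ such that the evolution operators $V(t,s)$ of $y'=(A(t)+B(t)K_1(t))y$ and of $y'=(A(t)+K_2(t)C(t))y$ are exponentially stable: $\|V(t,s)\|\le Me^{-\rho(t-s)}$ for $0\le s\le t$, with some $M,\rho>0$. Then $(Per)_\theta$ has a unique solution $(y_\theta,u_\theta,\lambda_\theta)$ (extended by $\theta$-periodicity to $\mathbb R$). Moreover, there exist constants $C,\nu>0$ such that, for every $T>0$ large enough, $(LQ)^T$ has a unique solution $(y^T,u^T,\lambda^T)$, and $$\|y^T(t)-y_\theta(t)\|+\|u^T(t)-u_\theta(t)\|+\|\lambda^T(t)-\lambda_\theta(t)\|\le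 C\big(e^{-\nu t}+e^{-\nu(T-t)}\big)\qquad\text{for every }t\in[0,T],$$ where the controls (which are unique up to null sets) are represented by $u_\theta=-Q^{-1}B^*\lambda_\theta$ and $u^T=-Q^{-1}B^*\lambda^T$ for every $t$. If in addition $(t,s)\mapsto U_A(t,s)^*$ is strongly continuous on $\{0\le s\le t\}$, then $\lambda_\theta$ and $\lambda^T$ are (norm) continuous. -/

import Mathlib

open MeasureTheory Set Filter Topology
open scoped InnerProductSpace

noncomputable section

namespace PeriodicTurnpike

variable {𝕜 : Type*} [RCLike 𝕜]
variable {H : Type*} [NormedAddCommGroup H] [InnerProductSpace 𝕜 H] [NormedSpace ℝ H]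
  [CompleteSpace H]
variable {U : Type*} [NormedAddCommGroup U] [InnerProductSpace 𝕜 U]
  [CompleteSpace U]

/-- A strongly continuous evolution family `E t s`, `0 ≤ s ≤ t`, of bounded operators
(the values of `E` for other times are irrelevant). -/
structure IsEvolutionFamily (E : ℝ → ℝ → H →L[𝕜] H) : Prop where
  refl : ∀ s, 0 ≤ s → E s s = ContinuousLinearMap.id 𝕜 H
  comp : ∀ s r t, 0 ≤ s → s ≤ r → r ≤ t → (E t r).comp (E r s) = E t s
  cont : ∀ x, ContinuousOn (fun q : ℝ × ℝ => E q.1 q.2 x) {q | 0 ≤ q.2 ∧ q.2 ≤ q.1}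

/-- `R = (z - A)⁻¹` as a bounded everywhere defined operator: `z` is in the resolvent set of the
unbounded operator `A` and `R` is the resolvent. -/
def IsResolvent (A : H →ₗ.[𝕜] H) (z : 𝕜) (R : H →L[𝕜] H) : Prop :=
  (∀ x, ∃ h : R x ∈ A.domain, z • R x - A ⟨R x, h⟩ = x) ∧
    ∀ x : A.domain, R (z • (x : H) - A x) = x

/-- `Y` is the Yosida approximation `n² (n - A)⁻¹ - n I` of `A`. -/
def IsYosidaApprox (A : H →ₗ.[𝕜] H) (n : ℕ) (Y : H →L[𝕜] H) : Prop :=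
  ∃ R : H →L[𝕜] H, IsResolvent A (n : 𝕜) R ∧
    Y = ((n : 𝕜) ^ 2) • R - (n : 𝕜) • ContinuousLinearMap.id 𝕜 H

/-- `E` is the evolution operator of a family `Y t`, `t ≥ 0`, of bounded operators:
`E t s x = x + ∫_s^t Y(r) E(r,s) x dr`, where `Y` is bounded in norm on bounded intervals
(which is the case when `Y` is strongly continuous). -/
structure IsBoundedEvolution (Y : ℝ → H →L[𝕜] H) (E : ℝ → ℝ → H →L[𝕜] H) : Prop
    extends IsEvolutionFamily E where
  bdd : ∀ b : ℝ, ∃ M : ℝ, ∀ t, 0 ≤ t → t ≤ b → ‖Y t‖ ≤ M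
  integrable : ∀ x s t, 0 ≤ s → s ≤ t → IntervalIntegrable (fun r => Y r (E r s x)) volume s t
  eq : ∀ x s t, 0 ≤ s → s ≤ t → E t s x = x + ∫ r in s..t, Y r (E r s x)

/-- The family `A t`, `t ≥ 0`, of unbounded operators generates the evolution system `E`.

`hasDeriv` is `∂E(t,s)/∂t = A(t) E(t,s)`: it is asked for at the vectors at which the right-hand
side makes sense, with the derivative from the right.

`yosida`: for large `n` the Yosida approximations `Aₙ t` exist for all `t ≥ 0`, they have an
evolution operator, and these evolution operators converge strongly to `E`, uniformly
for `0 ≤ s ≤ t ≤ b`. In particular `E` is determined by `A`. -/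
structure GeneratesEvolution (A : ℝ → H →ₗ.[𝕜] H) (E : ℝ → ℝ → H →L[𝕜] H) : Prop
    extends IsEvolutionFamily E where
  hasDeriv : ∀ s t, 0 ≤ s → s ≤ t → ∀ x, ∀ h : E t s x ∈ (A t).domain,
    HasDerivWithinAt (fun r => E r s x) (A t ⟨E t s x, h⟩) (Ici t) t
  yosida : ∃ (An : ℕ → ℝ → H →L[𝕜] H) (En : ℕ → ℝ → ℝ → H →L[𝕜] H),
    (∀ᶠ n in atTop, (∀ t, 0 ≤ t → IsYosidaApprox (A t) n (An n t)) ∧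
      IsBoundedEvolution (An n) (En n)) ∧
    ∀ b : ℝ, 0 < b → ∀ x, TendstoUniformlyOn (fun n (q : ℝ × ℝ) => En n q.1 q.2 x)
      (fun q => E q.1 q.2 x) atTop {q | 0 ≤ q.2 ∧ q.2 ≤ q.1 ∧ q.1 ≤ b}

/-- `V` is the evolution operator of the system `y' = (A(t) + F(t)) y`, in the mild sense, where
`E` is the evolution operator of `A` and `F t` are bounded operators. -/
def IsPerturbedEvolution (E : ℝ → ℝ → H →L[𝕜] H) (F : ℝ → H →L[𝕜] H)
    (V : ℝ → ℝ → H →L[𝕜] H) : Prop :=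
  IsEvolutionFamily V ∧
    ∀ x s t, 0 ≤ s → s ≤ t → V t s x = E t s x + ∫ r in s..t, E t r (F r (V r s x))

/-- Exponential stability of an evolution operator. -/
def IsExpStable (V : ℝ → ℝ → H →L[𝕜] H) : Prop :=
  ∃ M ρ : ℝ, 0 < M ∧ 0 < ρ ∧ ∀ s t, 0 ≤ s → s ≤ t → ‖V t s‖ ≤ M * Real.exp (-ρ * (t - s))

/-- The system `y' = (A(t) + F(t)) y` is exponentially stable. -/
def IsExpStablePerturbation (E : ℝ → ℝ → H →L[𝕜] H) (F : ℝ → H →L[𝕜] H) : Prop :=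
  ∃ V, IsPerturbedEvolution E F V ∧ IsExpStable V

variable (𝕜 H U) in
/-- The data of the time-periodic linear quadratic problem, with the standing assumptions.
Operator-valued functions are continuous in the strong operator topology. -/
structure PeriodicLQ where
  /-- the period -/
  θ : ℝ
  /-- the unbounded operators `A(t)` -/
  A : ℝ → H →ₗ.[𝕜] H
  /-- the evolution operator generated by `A(·)` -/
  E : ℝ → ℝ → H →L[𝕜] H
  /-- the control operators -/
  B : ℝ → U →L[𝕜] H
  /-- the observation operators -/
  C : ℝ → H →L[𝕜] H
  /-- the weights of the control -/
  Q : ℝ → U →L[𝕜] U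
  /-- the tracking trajectory -/
  yd : ℝ → H
  θ_pos : 0 < θ
  A_periodic : Function.Periodic A θ
  B_periodic : Function.Periodic B θ
  C_periodic : Function.Periodic C θ
  Q_periodic : Function.Periodic Q θ
  yd_periodic : Function.Periodic yd θ
  generates : GeneratesEvolution A E
  B_cont : ∀ v, Continuous fun t => B t v
  C_cont : ∀ x, Continuous fun t => C t x
  Q_cont : ∀ v, Continuous fun t => Q t v
  yd_cont : Continuous yd
  C_pos : ∀ t, (C t).IsPositive
  Q_pos : ∀ t, (Q t).IsPositive
  Q_coercive : ∃ ε : ℝ, 0 < ε ∧ ∀ t v, ε * ‖v‖ ^ 2 ≤ RCLike.re ⟪Q t v, v⟫_𝕜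

namespace PeriodicLQ

variable (S : PeriodicLQ 𝕜 H U)

/-- `(A(·), B(·))` is exponentially `θ`-periodic stabilizable. -/
def IsStabilizable : Prop :=
  ∃ K : ℝ → H →L[𝕜] U, Function.Periodic K S.θ ∧ (∀ x, Continuous fun t => K t x) ∧
    IsExpStablePerturbation S.E fun t => (S.B t).comp (K t)

/-- `(A(·), C(·))` is exponentially `θ`-periodic detectable. -/
def IsDetectable : Prop :=
  ∃ K : ℝ → H →L[𝕜] H, Function.Periodic K S.θ ∧ (∀ x, Continuous fun t => K t x) ∧
    IsExpStablePerturbation S.E fun t => (K t).comp (S.C t)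

/-- The adjoint evolution `(t, s) ↦ E(t,s)*` is strongly continuous. -/
def HasContinuousAdjoint : Prop :=
  ∀ x, ContinuousOn (fun q : ℝ × ℝ => ContinuousLinearMap.adjoint (S.E q.1 q.2) x)
    {q | 0 ≤ q.2 ∧ q.2 ≤ q.1}

/-- The cost on `[0, T]`; the term `⟪Q u, u⟫` is `‖Q^{1/2} u‖ ^ 2`. -/
def cost (T : ℝ) (y : ℝ → H) (u : ℝ → U) : ℝ :=
  (1 / 2) * ∫ t in (0 : ℝ)..T,
    (‖S.C t (y t - S.yd t)‖ ^ 2 + RCLike.re ⟪S.Q t (u t), u t⟫_𝕜)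

/-- `(y, u) ∈ C([0,T]; H) × L²(0,T; U)` and `y' = A(t) y + B(t) u` on `[0, T]`
in the mild sense. -/
def IsTrajectory (T : ℝ) (y : ℝ → H) (u : ℝ → U) : Prop :=
  ContinuousOn y (Icc 0 T) ∧ MemLp u 2 (volume.restrict (Icc 0 T)) ∧
    ∀ t ∈ Icc (0 : ℝ) T, y t = S.E t 0 (y 0) + ∫ s in (0 : ℝ)..t, S.E t s (S.B s (u s))

/-- `p' = -C* C y - A* p + C* C y_d` on `[0, T]` in the mild sense. -/
def IsAdjointState (T : ℝ) (y p : ℝ → H) : Prop :=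
  ∀ t ∈ Icc (0 : ℝ) T, p t = ContinuousLinearMap.adjoint (S.E T t) (p T) +
    ∫ τ in t..T, ContinuousLinearMap.adjoint (S.E τ t)
      (ContinuousLinearMap.adjoint (S.C τ) (S.C τ (y τ - S.yd τ)))

/-- The control `-Q(t)⁻¹ B(t)* p(t)` associated with an adjoint state `p`. -/
def adjointControl (p : ℝ → H) (t : ℝ) : U :=
  -((S.Q t).inverse (ContinuousLinearMap.adjoint (S.B t) (p t)))

/-- `(y, u)` is an optimal pair of the problem on `[0, T]` with initial state `y₀`. -/
def IsOptimalLQ (T : ℝ) (y₀ : H) (y : ℝ → H) (u : ℝ → U) : Prop :=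
  (S.IsTrajectory T y u ∧ y 0 = y₀) ∧
    ∀ z v, S.IsTrajectory T z v → z 0 = y₀ → S.cost T y u ≤ S.cost T z v

/-- `(y, u, p)` is an optimal solution, with its adjoint state, of the problem on `[0, T]`
with initial state `y₀`. -/
def IsSolutionLQ (T : ℝ) (y₀ : H) (y : ℝ → H) (u : ℝ → U) (p : ℝ → H) : Prop :=
  S.IsOptimalLQ T y₀ y u ∧ S.IsAdjointState T y p ∧ p T = 0 ∧
    ∀ᵐ t ∂(volume.restrict (Icc 0 T)), u t = S.adjointControl p t

/-- `(y, u)` is an optimal pair of the `θ`-periodic problem. -/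
def IsOptimalPer (y : ℝ → H) (u : ℝ → U) : Prop :=
  (S.IsTrajectory S.θ y u ∧ y 0 = y S.θ) ∧
    ∀ z v, S.IsTrajectory S.θ z v → z 0 = z S.θ → S.cost S.θ y u ≤ S.cost S.θ z v

/-- `(y, u, p)` is an optimal solution, with its adjoint state, of the `θ`-periodic problem. -/
def IsSolutionPer (y : ℝ → H) (u : ℝ → U) (p : ℝ → H) : Prop :=
  S.IsOptimalPer y u ∧ S.IsAdjointState S.θ y p ∧ p 0 = p S.θ ∧
    ∀ᵐ t ∂(volume.restrict (Icc 0 S.θ)), u t = S.adjointControl p t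

end PeriodicLQ

end PeriodicTurnpike

end

/-!
The proof avoids Riccati equations: it rests on the duality between trajectories and adjoint states
and on a priori estimates that hold on every subinterval.

**Extremals.** Call `(y, p)` an extremal on `[0, T]` (`IsExtremal`) if `y` is the trajectory of the
control `u = -Q⁻¹ B* p` and `p` is an adjoint state of `y`. Both problems are boundary value
problems for extremals, `y(0) = κ y(T) + a`, `p(T) = κ p(0)`, with `κ = 1`, `a = 0`, `T = θ` for the
periodic one and `κ = 0`, `a = y₀` for the other. Adjoint states are handled through their weak form
`IsWeakAdjoint`, as `τ ↦ E(τ,t)* x` need not be norm continuous; Pettis' theorem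
(`stronglyMeasurable_of_weak`) gives the measurability needed to return to Bochner integrals.

**Existence** (`exists_extremal`). With the feedback `K₁` of stabilizability, the trajectories with
`y(0) = κ y(T) + a` are parametrized by `w = u - K₁ y ∈ L²`. With the feedback `K₂` of
detectability, `w` is recovered from the control and the output, so the cost is coercive in `w`.
The normal equation of the minimization problem produces the adjoint state. The only property of the
closed-loop operators that is used here is that `1 - κ V(T,0)` is invertible. For `κ = 1` and
`T = θ` this is where exponential stability and periodicity enter (`IsExpStable.isUnit_one_sub`);
the evolution operator `E` is periodic because it is determined by the Yosida approximations of the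
periodic family `A` (`GeneratesEvolution.periodic`).

**Optimality and uniqueness.** The cost of a competitor exceeds that of an extremal exactly by the
quadratic part of the cost of the difference (`IsExtremal.cost_eq`), which gives optimality. If that
part vanishes then the controls and the outputs agree, hence so do the states, by detectability
(`IsExtremal.eq_of_cost_le`); the adjoint states agree by stabilizability
(`IsExtremal.adjoint_unique`).

**Turnpike estimate** (`exists_turnpike_bound`). The periodic extremal is an extremal on every
interval `[0, T]`, and the difference `(y, p)` of two extremals solves the homogeneous equations.
Duality on `[s, t]` bounds `∫ ‖C y‖² + ‖u‖²`, up to a constant, by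
`‖p(s)‖ ‖y(s)‖ + ‖p(t)‖ ‖y(t)‖`. Detectability bounds `y` by `y(s)` and a convolution of
`‖C y‖ + ‖u‖` with a decaying exponential, stabilizability bounds `p` in the same way by `p(t)`.
Hence, for `W = ‖y‖² + ‖p‖²`, both `∫ W` over `[s, t]` and the
supremum of `W` on `[s, t]` are at most `K (W(s) + W(t))`, and this alone forces exponential decay
away from `0` and `T` (`exists_exp_decay`). Finally the boundary values `p(0)` and `y(T)`, which are
not prescribed, are bounded by `y(0)` and `p(T)`.
-/

noncomputable section

set_option linter.unusedSectionVars false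

namespace PeriodicTurnpike

/-! ### Strongly continuous families of operators -/

section StrongContinuity

variable {𝕜 : Type*} [RCLike 𝕜]
  {G : Type*} [NormedAddCommGroup G] [NormedSpace 𝕜 G] [CompleteSpace G]
  {G' : Type*} [NormedAddCommGroup G'] [NormedSpace 𝕜 G']
  {X : Type*} [TopologicalSpace X]

/-- The uniform boundedness principle for a strongly continuous family on a compact set. -/
theorem exists_norm_le_of_isCompact {F : X → G →L[𝕜] G'} {K : Set X} (hK : IsCompact K)
    (hF : ∀ v, ContinuousOn (fun x => F x v) K) : ∃ M, 0 < M ∧ ∀ x ∈ K, ‖F x‖ ≤ M := by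
  obtain ⟨M, hM⟩ := banach_steinhaus (g := fun x : K => F x) fun v => by
    obtain ⟨c, hc⟩ := (hK.image_of_continuousOn (hF v).norm).bddAbove
    exact ⟨c, fun x => hc ⟨x, x.2, rfl⟩⟩
  exact ⟨max M 1, by positivity, fun x hx => (hM ⟨x, hx⟩).trans (le_max_left _ _)⟩

/-- Strong continuity implies joint continuity, by local boundedness of the norms. -/
theorem continuous_apply_of_strong [WeaklyLocallyCompactSpace X] {F : X → G →L[𝕜] G'}
    (hF : ∀ v, Continuous fun x => F x v) : Continuous fun q : X × G => F q.1 q.2 := by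
  rw [continuous_iff_continuousAt]
  rintro ⟨x₀, v₀⟩
  obtain ⟨K, hK, hx₀⟩ := exists_compact_mem_nhds x₀
  obtain ⟨M, hM0, hM⟩ := exists_norm_le_of_isCompact hK fun v => (hF v).continuousOn
  have h1 : Tendsto (fun q : X × G => M * ‖q.2 - v₀‖ + ‖F q.1 v₀ - F x₀ v₀‖)
      (𝓝 (x₀, v₀)) (𝓝 0) := by
    have : Continuous fun q : X × G => M * ‖q.2 - v₀‖ + ‖F q.1 v₀ - F x₀ v₀‖ :=
      (continuous_const.mul (continuous_snd.sub continuous_const).norm).add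
        (((hF v₀).comp continuous_fst).sub continuous_const).norm
    simpa using this.tendsto (x₀, v₀)
  refine tendsto_iff_norm_sub_tendsto_zero.2
    (squeeze_zero' (Eventually.of_forall fun _ => norm_nonneg _) ?_ h1)
  have : ∀ᶠ q : X × G in 𝓝 (x₀, v₀), q.1 ∈ K := continuousAt_fst.eventually hx₀
  filter_upwards [this] with q hq
  calc ‖F q.1 q.2 - F x₀ v₀‖ = ‖F q.1 (q.2 - v₀) + (F q.1 v₀ - F x₀ v₀)‖ := by
        rw [map_sub]; congr 1; abel
    _ ≤ _ := (norm_add_le _ _).trans (by gcongr; exact (F q.1).le_of_opNorm_le (hM _ hq) _)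

end StrongContinuity

/-! ### Weakly continuous functions -/

section Weak

variable {𝕜 : Type*} [RCLike 𝕜]
  {G : Type*} [NormedAddCommGroup G] [InnerProductSpace 𝕜 G] [CompleteSpace G]

/-- A case of Pettis' theorem: the range of a weakly continuous function lies in a separable
subspace, and its projections to finite-dimensional subspaces are norm continuous. -/
theorem stronglyMeasurable_of_weak {g : ℝ → G}
    (hg : ∀ x, Continuous fun t => ⟪g t, x⟫_𝕜) : StronglyMeasurable g := by
  have hg' : ∀ x, Continuous fun t => ⟪x, g t⟫_𝕜 := fun x =>
    (RCLike.continuous_conj.comp (hg x)).congr fun t => inner_conj_symm _ _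
  let d : ℕ → ℝ := TopologicalSpace.denseSeq ℝ
  let P : ℕ → Submodule 𝕜 G := fun n => Submodule.span 𝕜 ((fun i => g (d i)) '' (Iio n))
  have hfin : ∀ n, FiniteDimensional 𝕜 (P n) := fun n =>
    FiniteDimensional.span_of_finite 𝕜 ((finite_Iio n).image _)
  have hmono : Monotone P := fun m n h => Submodule.span_mono (by gcongr)
  have hmem : ∀ t, g t ∈ (⨆ n, P n).topologicalClosure := by
    intro t
    rw [← Submodule.orthogonal_orthogonal_eq_closure, Submodule.mem_orthogonal]
    intro v hv
    rw [Submodule.mem_orthogonal] at hv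
    have h0 : (fun t => ⟪v, g t⟫_𝕜) = fun _ => 0 := by
      refine (hg' v).ext_on (TopologicalSpace.denseRange_denseSeq ℝ) continuous_const ?_
      rintro _ ⟨n, rfl⟩
      rw [inner_eq_zero_symm]
      exact hv _ ((le_iSup P (n + 1)) (Submodule.subset_span ⟨n, by simp, rfl⟩))
    exact congrFun h0 t
  refine stronglyMeasurable_of_tendsto atTop
    (f := fun n t => (P n).starProjection (g t)) (fun n => ?_) ?_
  · have h := (stdOrthonormalBasis 𝕜 (P n)).starProjection_eq_sum_rankOne
    refine Continuous.stronglyMeasurable ?_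
    rw [h]
    simp only [sum_apply, InnerProductSpace.rankOne_apply]
    exact continuous_finsetSum _ fun i _ => (hg' _).smul continuous_const
  · rw [tendsto_pi_nhds]
    intro t
    have := Submodule.starProjection_tendsto_closure_iSup P hmono (g t)
    rwa [Submodule.starProjection_eq_self_iff.2 (hmem t)] at this

theorem aestronglyMeasurable_of_weakOn {a b : ℝ} (hab : a ≤ b) {g : ℝ → G}
    (hg : ∀ x, ContinuousOn (fun t => ⟪g t, x⟫_𝕜) (Icc a b)) :
    AEStronglyMeasurable g (volume.restrict (Icc a b)) := by
  have h := stronglyMeasurable_of_weak (𝕜 := 𝕜) (g := fun t => g (projIcc a b hab t)) fun x =>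
    (hg x).comp_continuous (by fun_prop) fun t => (projIcc a b hab t).2
  refine h.aestronglyMeasurable.congr ?_
  filter_upwards [ae_restrict_mem measurableSet_Icc] with t ht
  simp [projIcc_of_mem hab ht]

theorem exists_norm_le_of_weakOn {a b : ℝ} {g : ℝ → G}
    (hg : ∀ x, ContinuousOn (fun t => ⟪g t, x⟫_𝕜) (Icc a b)) :
    ∃ M, 0 < M ∧ ∀ t ∈ Icc a b, ‖g t‖ ≤ M := by
  obtain ⟨M, hM0, hM⟩ := exists_norm_le_of_isCompact (𝕜 := 𝕜) (isCompact_Icc (a := a) (b := b))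
    (F := fun t => innerSL 𝕜 (g t)) (by simpa using hg)
  exact ⟨M, hM0, fun t ht => by simpa using hM t ht⟩

end Weak

/-! ### Integral inequalities -/

section Integral

variable {G : Type*} [NormedAddCommGroup G] [NormedSpace ℝ G]

/-- Fubini's theorem on the triangle `a ≤ r ≤ τ ≤ b`. -/
theorem integral_triangle_swap {f : ℝ → ℝ → G} {a b : ℝ} (hab : a ≤ b)
    (hf : Integrable (Function.uncurry f)
      ((volume.restrict (Ioc a b)).prod (volume.restrict (Ioc a b)))) :
    ∫ τ in a..b, ∫ r in a..τ, f τ r = ∫ r in a..b, ∫ τ in r..b, f τ r := by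
  let D : Set (ℝ × ℝ) := {q | q.2 ≤ q.1}
  have hD : MeasurableSet D := measurableSet_le measurable_snd measurable_fst
  have key := integral_integral_swap (f := fun τ r => D.indicator (Function.uncurry f) (τ, r))
    (hf.indicator hD)
  rw [intervalIntegral.integral_of_le hab, intervalIntegral.integral_of_le hab]
  convert key using 1
  · refine setIntegral_congr_fun measurableSet_Ioc fun τ hτ => ?_
    have : (fun r => D.indicator (Function.uncurry f) (τ, r)) = (Iic τ).indicator (f τ) := by
      ext r; simp [D, indicator, Function.uncurry]
    simp only [this]
    rw [setIntegral_indicator measurableSet_Iic, intervalIntegral.integral_of_le hτ.1.le,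
      Ioc_inter_Iic, min_eq_right hτ.2]
  · refine setIntegral_congr_fun measurableSet_Ioc fun r hr => ?_
    have : (fun τ => D.indicator (Function.uncurry f) (τ, r)) =
        (Ici r).indicator (fun τ => f τ r) := by
      ext τ; simp [D, indicator, Function.uncurry]
    simp only [this]
    rw [setIntegral_indicator measurableSet_Ici, intervalIntegral.integral_of_le hr.2,
      ← integral_Icc_eq_integral_Ioc]
    congr 2
    ext x
    simp only [mem_Icc, mem_inter_iff, mem_Ioc, mem_Ici]
    exact ⟨fun h => ⟨⟨hr.1.trans_le h.1, h.2⟩, h.1⟩, fun h => ⟨h.2, h.1.2⟩⟩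

/-- Gronwall's lemma for a function that is merely bounded: if every continuous upper bound of `f`
can be improved to `c ∫ φ`, then `f ≤ 0`. -/
theorem nonpos_of_forall_le_integral {f : ℝ → ℝ} {a b c : ℝ} (hbdd : ∃ M, ∀ t ∈ Icc a b, f t ≤ M)
    (h : ∀ φ : ℝ → ℝ, Continuous φ → (∀ t ∈ Icc a b, f t ≤ φ t) →
      ∀ t ∈ Icc a b, f t ≤ c * ∫ τ in a..t, φ τ) : ∀ t ∈ Icc a b, f t ≤ 0 := by
  obtain ⟨M, hM⟩ := hbdd
  -- iterating the hypothesis from the constant bound `M` gives the terms of the exponential series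
  have iter : ∀ n : ℕ, ∀ t ∈ Icc a b, f t ≤ M * ((c * (t - a)) ^ n / n.factorial) := by
    intro n
    induction n with
    | zero => simpa using hM
    | succ n ih =>
      intro t ht
      refine (h _ (by fun_prop) ih t ht).trans_eq ?_
      have h1 : ∀ τ, M * ((c * (τ - a)) ^ n / n.factorial) =
          M * c ^ n / n.factorial * (τ - a) ^ n := fun τ => by rw [mul_pow]; ring
      simp only [h1]
      rw [intervalIntegral.integral_const_mul,
        intervalIntegral.integral_comp_sub_right (fun x => x ^ n) a, integral_pow,
        Nat.factorial_succ, mul_pow]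
      push_cast
      have : (n.factorial : ℝ) ≠ 0 := by positivity
      field_simp
      simp
      ring
  intro t ht
  have hlim := (FloorSemiring.tendsto_pow_div_factorial_atTop (c * (t - a))).const_mul M
  rw [mul_zero] at hlim
  exact ge_of_tendsto' hlim fun n => iter n t ht

/-- Continuity of `t ↦ ∫ r in a..t, g t r` when `g` is dominated by an integrable function. -/
theorem continuousOn_integral_left {g : ℝ → ℝ → G} {β : ℝ → ℝ} {a b : ℝ}
    (hm : ∀ t ∈ Icc a b, AEStronglyMeasurable (g t) (volume.restrict (Ioc a b)))
    (hβ : IntegrableOn β (Ioc a b)) (hle : ∀ t ∈ Icc a b, ∀ r ∈ Ioc a b, ‖g t r‖ ≤ β r)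
    (hc : ∀ r ∈ Ioc a b, ContinuousOn (fun t => g t r) (Icc a b)) :
    ContinuousOn (fun t => ∫ r in a..t, g t r) (Icc a b) := by
  have heq : EqOn (fun t => ∫ r in a..t, g t r)
      (fun t => ∫ r in Ioc a b, (Iic t).indicator (g t) r) (Icc a b) := by
    intro t ht
    simp only
    rw [setIntegral_indicator measurableSet_Iic, intervalIntegral.integral_of_le ht.1,
      Ioc_inter_Iic, min_eq_right ht.2]
  refine ContinuousOn.congr (fun t₀ ht₀ => ?_) heq
  refine continuousWithinAt_of_dominated (bound := β) ?_ ?_ hβ ?_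
  · filter_upwards [self_mem_nhdsWithin] with t ht
    exact (hm t ht).indicator measurableSet_Iic
  · filter_upwards [self_mem_nhdsWithin] with t ht
    filter_upwards [ae_restrict_mem measurableSet_Ioc] with r hr
    exact (norm_indicator_le_norm_self _ _).trans (hle t ht r hr)
  · have hne : ∀ᵐ r ∂(volume.restrict (Ioc a b)), r ≠ t₀ :=
      ae_restrict_of_ae (Measure.ae_ne volume t₀)
    filter_upwards [ae_restrict_mem measurableSet_Ioc, hne] with r hr hr0
    rcases lt_or_gt_of_ne hr0 with h | h
    · refine ((hc r hr) t₀ ht₀).congr_of_eventuallyEq ?_ ?_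
      · filter_upwards [mem_nhdsWithin_of_mem_nhds (Ioi_mem_nhds h)] with t ht
        exact indicator_of_mem (show r ∈ Iic t from (mem_Ioi.1 ht).le) _
      · exact indicator_of_mem (show r ∈ Iic t₀ from h.le) _
    · refine (continuousWithinAt_const (b := (0 : G))).congr_of_eventuallyEq ?_ ?_
      · filter_upwards [mem_nhdsWithin_of_mem_nhds (Iio_mem_nhds h)] with t ht
        exact indicator_of_notMem (show r ∉ Iic t from fun h' => not_le.2 (mem_Iio.1 ht) h') _
      · exact indicator_of_notMem (show r ∉ Iic t₀ from fun h' => not_le.2 h h') _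

theorem continuousOn_integral_right {g : ℝ → ℝ → G} {β : ℝ → ℝ} {a b : ℝ}
    (hm : ∀ t ∈ Icc a b, AEStronglyMeasurable (g t) (volume.restrict (Ioc a b)))
    (hβ : IntegrableOn β (Ioc a b)) (hle : ∀ t ∈ Icc a b, ∀ r ∈ Ioc a b, ‖g t r‖ ≤ β r)
    (hc : ∀ r ∈ Ioc a b, ContinuousOn (fun t => g t r) (Icc a b)) :
    ContinuousOn (fun t => ∫ r in t..b, g t r) (Icc a b) := by
  have hfull : ContinuousOn (fun t => ∫ r in Ioc a b, g t r) (Icc a b) := by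
    intro t₀ ht₀
    refine continuousWithinAt_of_dominated (bound := β) ?_ ?_ hβ ?_
    · filter_upwards [self_mem_nhdsWithin] with t ht using hm t ht
    · filter_upwards [self_mem_nhdsWithin] with t ht
      filter_upwards [ae_restrict_mem measurableSet_Ioc] with r hr using hle t ht r hr
    · filter_upwards [ae_restrict_mem measurableSet_Ioc] with r hr using hc r hr t₀ ht₀
  refine (hfull.sub (continuousOn_integral_left hm hβ hle hc)).congr fun t ht => ?_
  have hint : IntegrableOn (g t) (Ioc a b) := hβ.mono' (hm t ht) <| by
    filter_upwards [ae_restrict_mem measurableSet_Ioc] with r hr using hle t ht r hr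
  have hab : a ≤ b := ht.1.trans ht.2
  have h1 : IntervalIntegrable (g t) volume a t :=
    (intervalIntegrable_iff_integrableOn_Ioc_of_le ht.1).2
      (hint.mono_set (Ioc_subset_Ioc_right ht.2))
  have h2 : IntervalIntegrable (g t) volume t b :=
    (intervalIntegrable_iff_integrableOn_Ioc_of_le ht.2).2
      (hint.mono_set (Ioc_subset_Ioc_left ht.1))
  simp only [Pi.sub_apply]
  rw [eq_sub_iff_add_eq, add_comm, intervalIntegral.integral_add_adjacent_intervals h1 h2,
    intervalIntegral.integral_of_le hab]

end Integral

section Products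

variable {𝕜 : Type*} [RCLike 𝕜] {α : Type*} [MeasurableSpace α] {μ : Measure α}
  {G : Type*} [NormedAddCommGroup G] [InnerProductSpace 𝕜 G]

theorem integrable_inner_of_bound_right {f g : α → G} {M : ℝ} (hf : Integrable f μ)
    (hg : AEStronglyMeasurable g μ) (hM : ∀ᵐ t ∂μ, ‖g t‖ ≤ M) :
    Integrable (fun t => ⟪f t, g t⟫_𝕜) μ :=
  (hf.norm.mul_const M).mono' (hf.1.inner hg) <| by
    filter_upwards [hM] with t ht
    exact (norm_inner_le_norm _ _).trans (by gcongr)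

theorem integrable_inner_of_bound_left {f g : α → G} {M : ℝ} (hf : Integrable f μ)
    (hg : AEStronglyMeasurable g μ) (hM : ∀ᵐ t ∂μ, ‖g t‖ ≤ M) :
    Integrable (fun t => ⟪g t, f t⟫_𝕜) μ :=
  (hf.norm.mul_const M).mono' (hg.inner hf.1) <| by
    filter_upwards [hM] with t ht
    rw [mul_comm]
    exact (norm_inner_le_norm _ _).trans (by gcongr)

end Products

/-! ### Evolution families and mild solutions -/

section Evolution

variable {𝕜 : Type*} [RCLike 𝕜]
  {H : Type*} [NormedAddCommGroup H] [InnerProductSpace 𝕜 H] [NormedSpace ℝ H] [CompleteSpace H]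
  {E V : ℝ → ℝ → H →L[𝕜] H} {F : ℝ → H →L[𝕜] H} {a b : ℝ} {y f p h : ℝ → H}

/-- The extension of an evolution family to all pairs of times, obtained by retracting the plane
onto `{0 ≤ s ≤ t}`. -/
def extendEvolution (E : ℝ → ℝ → H →L[𝕜] H) (q : ℝ × ℝ) : H →L[𝕜] H :=
  E (max q.1 (max q.2 0)) (max q.2 0)

theorem extendEvolution_eq {s t : ℝ} (hs : 0 ≤ s) (hst : s ≤ t) :
    extendEvolution E (t, s) = E t s := by
  simp [extendEvolution, hs, hst]

/-- `y' = A(t) y + f(t)` on `[a, b]` in the mild sense, `E` being the evolution operator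
of `A`. -/
def IsMild (E : ℝ → ℝ → H →L[𝕜] H) (a b : ℝ) (y f : ℝ → H) : Prop :=
  ∀ s t, a ≤ s → s ≤ t → t ≤ b → y t = E t s (y s) + ∫ r in s..t, E t r (f r)

/-- `p' = -A(t)* p - h(t)` on `[a, b]` in the mild sense, tested with the vectors of `H`. The weak
form is used because `τ ↦ E(τ,s)* h(τ)` is in general not norm continuous. -/
def IsWeakAdjoint (E : ℝ → ℝ → H →L[𝕜] H) (a b : ℝ) (p h : ℝ → H) : Prop :=
  ∀ s t, a ≤ s → s ≤ t → t ≤ b → ∀ x,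
    ⟪p s, x⟫_𝕜 = ⟪p t, E t s x⟫_𝕜 + ∫ τ in s..t, ⟪h τ, E τ s x⟫_𝕜

namespace IsEvolutionFamily

theorem continuous_extend (hE : IsEvolutionFamily E) (x : H) :
    Continuous fun q => extendEvolution E q x :=
  (hE.cont x).comp_continuous (f := fun q : ℝ × ℝ => (max q.1 (max q.2 0), max q.2 0))
    (by fun_prop) fun q => ⟨le_max_right _ _, le_max_right _ _⟩

theorem continuous_extend_apply (hE : IsEvolutionFamily E) :
    Continuous fun q : (ℝ × ℝ) × H => extendEvolution E q.1 q.2 :=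
  continuous_apply_of_strong hE.continuous_extend

theorem exists_norm_le (hE : IsEvolutionFamily E) (b : ℝ) :
    ∃ M, 0 < M ∧ ∀ s t, 0 ≤ s → s ≤ t → t ≤ b → ‖E t s‖ ≤ M := by
  obtain ⟨M, hM0, hM⟩ := exists_norm_le_of_isCompact
    ((isCompact_Icc (a := (0 : ℝ)) (b := b)).prod (isCompact_Icc (a := (0 : ℝ)) (b := b)))
    fun x => (hE.continuous_extend x).continuousOn
  refine ⟨M, hM0, fun s t hs hst ht => ?_⟩
  rw [← extendEvolution_eq (E := E) hs hst]
  exact hM _ ⟨⟨hs.trans hst, ht⟩, ⟨hs, hst.trans ht⟩⟩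

theorem aestronglyMeasurable_apply (hE : IsEvolutionFamily E) {s t : ℝ} (hs : 0 ≤ s)
    (hf : AEStronglyMeasurable f (volume.restrict (Ioc s t))) :
    AEStronglyMeasurable (fun r => E t r (f r)) (volume.restrict (Ioc s t)) := by
  have h1 : AEStronglyMeasurable (fun r => extendEvolution E (t, r) (f r))
      (volume.restrict (Ioc s t)) :=
    hE.continuous_extend_apply.comp_aestronglyMeasurable
      (((continuous_const.prodMk continuous_id).aestronglyMeasurable).prodMk hf)
  refine h1.congr ?_
  filter_upwards [ae_restrict_mem measurableSet_Ioc] with r hr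
  rw [extendEvolution_eq (hs.trans hr.1.le) hr.2]

theorem integrableOn_apply (hE : IsEvolutionFamily E) {s t : ℝ} (hs : 0 ≤ s)
    (hf : IntegrableOn f (Ioc s t)) : IntegrableOn (fun r => E t r (f r)) (Ioc s t) := by
  obtain ⟨M, hM0, hM⟩ := hE.exists_norm_le t
  refine (hf.norm.const_mul M).mono' (hE.aestronglyMeasurable_apply hs hf.1) ?_
  filter_upwards [ae_restrict_mem measurableSet_Ioc] with r hr
  exact (E t r).le_of_opNorm_le (hM _ _ (hs.trans hr.1.le) hr.2 le_rfl) _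

theorem intervalIntegrable_apply (hE : IsEvolutionFamily E) {s t : ℝ} (hs : 0 ≤ s) (hst : s ≤ t)
    (hf : IntegrableOn f (Ioc s t)) : IntervalIntegrable (fun r => E t r (f r)) volume s t :=
  (intervalIntegrable_iff_integrableOn_Ioc_of_le hst).2 (hE.integrableOn_apply hs hf)

theorem continuousOn_left (hE : IsEvolutionFamily E) {s : ℝ} (hs : 0 ≤ s) (x : H) :
    ContinuousOn (fun t => E t s x) (Ici s) :=
  ((hE.continuous_extend x).comp
    (continuous_id.prodMk (continuous_const (y := s)))).continuousOn.congr
    fun t ht => by simp only [Function.comp, id, extendEvolution_eq hs ht]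

theorem continuousOn_right (hE : IsEvolutionFamily E) (t : ℝ) (x : H) :
    ContinuousOn (fun s => E t s x) (Icc 0 t) :=
  ((hE.continuous_extend x).comp
    ((continuous_const (y := t)).prodMk continuous_id)).continuousOn.congr
    fun s hs => by simp only [Function.comp, id, extendEvolution_eq hs.1 hs.2]

theorem integrableOn_inner (hE : IsEvolutionFamily E) {s t : ℝ} (hs : 0 ≤ s)
    (hh : IntegrableOn h (Ioc s t)) (x : H) :
    IntegrableOn (fun τ => ⟪h τ, E τ s x⟫_𝕜) (Ioc s t) := by
  obtain ⟨M, hM0, hM⟩ := hE.exists_norm_le t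
  refine integrable_inner_of_bound_right (M := M * ‖x‖) hh
    (((hE.continuousOn_left hs x).mono fun r hr => hr.1.le).aestronglyMeasurable
      measurableSet_Ioc) ?_
  filter_upwards [ae_restrict_mem measurableSet_Ioc] with τ hτ
  exact (E τ s).le_of_opNorm_le (hM _ _ hs hτ.1.le hτ.2) _

theorem continuousOn_integral_apply (hE : IsEvolutionFamily E) (ha : 0 ≤ a)
    (hf : IntegrableOn f (Ioc a b)) :
    ContinuousOn (fun t => ∫ r in a..t, E t r (f r)) (Icc a b) := by
  obtain ⟨M, hM0, hM⟩ := exists_norm_le_of_isCompact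
    ((isCompact_Icc (a := a) (b := b)).prod (isCompact_Icc (a := a) (b := b)))
    fun x => (hE.continuous_extend x).continuousOn
  have key := continuousOn_integral_left (g := fun t r => extendEvolution E (t, r) (f r))
    (β := fun r => M * ‖f r‖) (a := a) (b := b)
    (fun t _ => hE.continuous_extend_apply.comp_aestronglyMeasurable
      (((continuous_const.prodMk continuous_id).aestronglyMeasurable).prodMk hf.1))
    (hf.norm.const_mul M)
    (fun t ht r hr => (extendEvolution E (t, r)).le_of_opNorm_le
      (hM (t, r) ⟨ht, Ioc_subset_Icc_self hr⟩) _)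
    (fun r _ => ((hE.continuous_extend (f r)).comp
      (continuous_id.prodMk continuous_const)).continuousOn)
  refine key.congr fun t ht => intervalIntegral.integral_congr fun r hr => ?_
  rw [uIcc_of_le ht.1] at hr
  simp only [extendEvolution_eq (ha.trans hr.1) hr.2]

theorem continuousOn_integral_inner (hE : IsEvolutionFamily E) (ha : 0 ≤ a)
    (hh : IntegrableOn h (Ioc a b)) (x : H) :
    ContinuousOn (fun s => ∫ τ in s..b, ⟪h τ, E τ s x⟫_𝕜) (Icc a b) := by
  obtain ⟨M, hM0, hM⟩ := exists_norm_le_of_isCompact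
    ((isCompact_Icc (a := a) (b := b)).prod (isCompact_Icc (a := a) (b := b)))
    fun x => (hE.continuous_extend x).continuousOn
  have key := continuousOn_integral_right (g := fun s τ => ⟪h τ, extendEvolution E (τ, s) x⟫_𝕜)
    (β := fun r => ‖h r‖ * (M * ‖x‖)) (a := a) (b := b)
    (fun s _ => hh.1.inner ((hE.continuous_extend x).comp
      (continuous_id.prodMk continuous_const)).aestronglyMeasurable)
    (hh.norm.mul_const _)
    (fun t ht r hr => (norm_inner_le_norm _ _).trans (by
      gcongr
      exact (extendEvolution E (r, t)).le_of_opNorm_le (hM (r, t) ⟨Ioc_subset_Icc_self hr, ht⟩) _))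
    (fun r _ => (continuous_const.inner ((hE.continuous_extend x).comp
      (continuous_const.prodMk continuous_id))).continuousOn)
  refine key.congr fun s hs => intervalIntegral.integral_congr fun τ hτ => ?_
  rw [uIcc_of_le hs.2] at hτ
  simp only [extendEvolution_eq (ha.trans hs.1) hτ.1]

/-- The contribution of the source on `[s, r]`, propagated from `r` to `t`. -/
theorem apply_integral (hE : IsEvolutionFamily E) {s r t : ℝ} (hs : 0 ≤ s) (hsr : s ≤ r)
    (hrt : r ≤ t) (hf : IntegrableOn f (Ioc s r)) :
    E t r (∫ τ in s..r, E r τ (f τ)) = ∫ τ in s..r, E t τ (f τ) := by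
  rw [← ContinuousLinearMap.intervalIntegral_comp_comm _ (hE.intervalIntegrable_apply hs hsr hf)]
  refine intervalIntegral.integral_congr fun τ hτ => ?_
  rw [uIcc_of_le hsr] at hτ
  rw [← hE.comp τ r t (hs.trans hτ.1) hτ.2 hrt]
  rfl

end IsEvolutionFamily

theorem IsMild.mono {c d : ℝ} (hy : IsMild E a b y f) (hac : a ≤ c) (hdb : d ≤ b) :
    IsMild E c d y f :=
  fun s t hs hst ht => hy s t (hac.trans hs) hst (ht.trans hdb)

theorem IsWeakAdjoint.mono {c d : ℝ} (hp : IsWeakAdjoint E a b p h) (hac : a ≤ c) (hdb : d ≤ b) :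
    IsWeakAdjoint E c d p h :=
  fun s t hs hst ht => hp s t (hac.trans hs) hst (ht.trans hdb)

/-- It suffices to have the mild equation with initial time `a`. -/
theorem IsMild.of_initial (hE : IsEvolutionFamily E) (ha : 0 ≤ a) (hf : IntegrableOn f (Ioc a b))
    (hy : ∀ t ∈ Icc a b, y t = E t a (y a) + ∫ r in a..t, E t r (f r)) : IsMild E a b y f := by
  intro s t has hst htb
  have hfs : IntegrableOn f (Ioc a s) := hf.mono_set (Ioc_subset_Ioc_right (hst.trans htb))
  have hft : IntegrableOn f (Ioc a t) := hf.mono_set (Ioc_subset_Ioc_right htb)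
  rw [hy t ⟨has.trans hst, htb⟩, hy s ⟨has, hst.trans htb⟩, map_add,
    hE.apply_integral ha has hst hfs, ← hE.comp a s t ha has hst, add_assoc]
  congr 1
  have hi := hE.intervalIntegrable_apply ha (has.trans hst) hft
  rw [intervalIntegral.integral_add_adjacent_intervals]
  · exact hi.mono_set (by
      rw [uIcc_of_le has, uIcc_of_le (has.trans hst)]; exact Icc_subset_Icc_right hst)
  · exact hi.mono_set (by
      rw [uIcc_of_le hst, uIcc_of_le (has.trans hst)]; exact Icc_subset_Icc_left has)

/-- It suffices to have the weak adjoint equation with terminal time `b`. -/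
theorem IsWeakAdjoint.of_terminal (hE : IsEvolutionFamily E) (ha : 0 ≤ a)
    (hh : IntegrableOn h (Ioc a b))
    (hp : ∀ s ∈ Icc a b, ∀ x,
      ⟪p s, x⟫_𝕜 = ⟪p b, E b s x⟫_𝕜 + ∫ τ in s..b, ⟪h τ, E τ s x⟫_𝕜) :
    IsWeakAdjoint E a b p h := by
  intro s t has hst htb x
  have hs : 0 ≤ s := ha.trans has
  have hi : IntervalIntegrable (fun τ => ⟪h τ, E τ s x⟫_𝕜) volume s b :=
    (intervalIntegrable_iff_integrableOn_Ioc_of_le (hst.trans htb)).2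
      (hE.integrableOn_inner hs (hh.mono_set (Ioc_subset_Ioc_left has)) x)
  have h1 : ∫ τ in t..b, ⟪h τ, E τ t (E t s x)⟫_𝕜 = ∫ τ in t..b, ⟪h τ, E τ s x⟫_𝕜 := by
    refine intervalIntegral.integral_congr fun τ hτ => ?_
    rw [uIcc_of_le htb] at hτ
    rw [← hE.comp s t τ hs hst hτ.1]
    rfl
  have h2 : E b t (E t s x) = E b s x := by rw [← hE.comp s t b hs hst htb]; rfl
  rw [hp s ⟨has, hst.trans htb⟩, hp t ⟨has.trans hst, htb⟩, h1, h2, add_assoc,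
    add_comm (∫ τ in t..b, _),
    intervalIntegral.integral_add_adjacent_intervals]
  · exact hi.mono_set (by
      rw [uIcc_of_le hst, uIcc_of_le (hst.trans htb)]; exact Icc_subset_Icc_right htb)
  · exact hi.mono_set (by
      rw [uIcc_of_le htb, uIcc_of_le (hst.trans htb)]; exact Icc_subset_Icc_left hst)

theorem IsMild.continuousOn (hE : IsEvolutionFamily E) (ha : 0 ≤ a)
    (hf : IntegrableOn f (Ioc a b)) (hy : IsMild E a b y f) : ContinuousOn y (Icc a b) :=
  (((hE.continuousOn_left ha (y a)).mono fun _ ht => ht.1).add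
    (hE.continuousOn_integral_apply ha hf)).congr fun t ht => hy a t le_rfl ht.1 ht.2

theorem IsWeakAdjoint.continuousOn_inner (hE : IsEvolutionFamily E) (ha : 0 ≤ a)
    (hh : IntegrableOn h (Ioc a b)) (hp : IsWeakAdjoint E a b p h) (x : H) :
    ContinuousOn (fun s => ⟪p s, x⟫_𝕜) (Icc a b) :=
  ((continuousOn_const.inner ((hE.continuousOn_right b x).mono (Icc_subset_Icc_left ha))).add
    (hE.continuousOn_integral_inner ha hh x)).congr fun s hs => hp s b hs.1 hs.2 le_rfl x

theorem intervalIntegrable_sub {G : Type*} [NormedAddCommGroup G] {f : ℝ → G} {a b s t : ℝ}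
    (hf : IntegrableOn f (Ioc a b)) (has : a ≤ s) (hst : s ≤ t) (htb : t ≤ b) :
    IntervalIntegrable f volume s t :=
  (intervalIntegrable_iff_integrableOn_Ioc_of_le hst).2 (hf.mono_set (Ioc_subset_Ioc has htb))

/-- Integration by parts for a trajectory and an adjoint state: formally, the derivative of
`⟪p, y⟫` is `⟪p, f⟫ - ⟪h, y⟫`. For mild solutions both sides are expanded into the same double
integral `∫∫ ⟪h(τ), E(τ,r) f(r)⟫` over `r ≤ τ`. -/
theorem IsMild.duality (hE : IsEvolutionFamily E) (ha : 0 ≤ a) (hab : a ≤ b)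
    (hf : IntegrableOn f (Ioc a b)) (hh : IntegrableOn h (Ioc a b))
    (hy : IsMild E a b y f) (hp : IsWeakAdjoint E a b p h) :
    IntegrableOn (fun τ => ⟪h τ, y τ⟫_𝕜) (Ioc a b) ∧
    IntegrableOn (fun τ => ⟪p τ, f τ⟫_𝕜) (Ioc a b) ∧
    ⟪p b, y b⟫_𝕜 + ∫ τ in a..b, ⟪h τ, y τ⟫_𝕜 = ⟪p a, y a⟫_𝕜 + ∫ τ in a..b, ⟪p τ, f τ⟫_𝕜 := by
  obtain ⟨M, hM0, hM⟩ := exists_norm_le_of_isCompact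
    ((isCompact_Icc (a := a) (b := b)).prod (isCompact_Icc (a := a) (b := b)))
    fun x => (hE.continuous_extend x).continuousOn
  have hyc := hy.continuousOn hE ha hf
  have hpc := fun x => hp.continuousOn_inner hE ha hh x
  obtain ⟨Mp, -, hMp⟩ := exists_norm_le_of_weakOn hpc
  obtain ⟨My, hMy⟩ := (isCompact_Icc.image_of_continuousOn hyc.norm).bddAbove
  have hI1 : IntegrableOn (fun τ => ⟪h τ, y τ⟫_𝕜) (Ioc a b) := by
    refine integrable_inner_of_bound_right (M := My) hh
      ((hyc.mono Ioc_subset_Icc_self).aestronglyMeasurable measurableSet_Ioc) ?_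
    filter_upwards [ae_restrict_mem measurableSet_Ioc] with τ hτ
    exact hMy ⟨τ, Ioc_subset_Icc_self hτ, rfl⟩
  have hI2 : IntegrableOn (fun τ => ⟪p τ, f τ⟫_𝕜) (Ioc a b) := by
    refine integrable_inner_of_bound_left (M := Mp) hf
      ((aestronglyMeasurable_of_weakOn hab hpc).mono_measure
        (Measure.restrict_mono Ioc_subset_Icc_self le_rfl)) ?_
    filter_upwards [ae_restrict_mem measurableSet_Ioc] with τ hτ
    exact hMp _ (Ioc_subset_Icc_self hτ)
  refine ⟨hI1, hI2, ?_⟩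
  -- the double integral that appears on both sides
  have hI : Integrable (Function.uncurry fun τ r => ⟪h τ, extendEvolution E (τ, r) (f r)⟫_𝕜)
      ((volume.restrict (Ioc a b)).prod (volume.restrict (Ioc a b))) := by
    refine ((hh.norm.mul_prod (hf.norm)).const_mul M).mono'
      (hh.1.comp_fst.inner (hE.continuous_extend_apply.comp_aestronglyMeasurable
        (continuous_id.aestronglyMeasurable.prodMk hf.1.comp_snd))) ?_
    rw [Measure.prod_restrict]
    filter_upwards [ae_restrict_mem (measurableSet_Ioc.prod measurableSet_Ioc)] with q hq
    refine (norm_inner_le_norm _ _).trans ?_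
    calc _ ≤ ‖h q.1‖ * (M * ‖f q.2‖) := by
          gcongr
          exact ContinuousLinearMap.le_of_opNorm_le _
            (hM q ⟨Ioc_subset_Icc_self hq.1, Ioc_subset_Icc_self hq.2⟩) _
      _ = _ := by ring
  have swap := integral_triangle_swap hab hI
  have e1 : ∫ τ in a..b, ∫ r in a..τ, ⟪h τ, extendEvolution E (τ, r) (f r)⟫_𝕜 =
      ∫ τ in a..b, (⟪h τ, y τ⟫_𝕜 - ⟪h τ, E τ a (y a)⟫_𝕜) := by
    refine intervalIntegral.integral_congr fun τ hτ => ?_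
    rw [uIcc_of_le hab] at hτ
    have hfτ : IntegrableOn f (Ioc a τ) := hf.mono_set (Ioc_subset_Ioc_right hτ.2)
    have : ∫ r in a..τ, ⟪h τ, extendEvolution E (τ, r) (f r)⟫_𝕜 =
        ⟪h τ, ∫ r in a..τ, E τ r (f r)⟫_𝕜 := by
      rw [intervalIntegral.integral_of_le hτ.1, intervalIntegral.integral_of_le hτ.1,
        ← integral_inner (hE.integrableOn_apply ha hfτ)]
      refine setIntegral_congr_fun measurableSet_Ioc fun r hr => ?_
      simp only [extendEvolution_eq (ha.trans hr.1.le) hr.2]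
    simp only [this]
    rw [← inner_sub_right, hy a τ le_rfl hτ.1 hτ.2]
    simp
  have e2 : ∫ r in a..b, ∫ τ in r..b, ⟪h τ, extendEvolution E (τ, r) (f r)⟫_𝕜 =
      ∫ r in a..b, (⟪p r, f r⟫_𝕜 - ⟪p b, E b r (f r)⟫_𝕜) := by
    refine intervalIntegral.integral_congr fun r hr => ?_
    rw [uIcc_of_le hab] at hr
    rw [hp r b hr.1 hr.2 le_rfl, add_sub_cancel_left]
    refine intervalIntegral.integral_congr fun τ hτ => ?_
    rw [uIcc_of_le hr.2] at hτ
    simp only [extendEvolution_eq (ha.trans hr.1) hτ.1]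
  have hI3 := hE.integrableOn_inner ha hh (y a)
  have hI4 : IntegrableOn (fun r => ⟪p b, E b r (f r)⟫_𝕜) (Ioc a b) :=
    (hE.integrableOn_apply ha hf).const_inner _
  rw [e1, e2, intervalIntegral.integral_sub (intervalIntegrable_sub hI1 le_rfl hab le_rfl)
      (intervalIntegrable_sub hI3 le_rfl hab le_rfl),
    intervalIntegral.integral_sub (intervalIntegrable_sub hI2 le_rfl hab le_rfl)
      (intervalIntegrable_sub hI4 le_rfl hab le_rfl)] at swap
  have e3 : ⟪p b, y b⟫_𝕜 = ⟪p b, E b a (y a)⟫_𝕜 + ∫ r in a..b, ⟪p b, E b r (f r)⟫_𝕜 := by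
    rw [hy a b le_rfl hab le_rfl, inner_add_right, intervalIntegral.integral_of_le hab,
      intervalIntegral.integral_of_le hab, integral_inner (hE.integrableOn_apply ha hf)]
  rw [e3, hp a b le_rfl hab le_rfl (y a)]
  linear_combination swap

end Evolution

/-! ### Bounded perturbations: variation of constants and uniqueness -/

section Perturbation

variable {𝕜 : Type*} [RCLike 𝕜]
  {H : Type*} [NormedAddCommGroup H] [InnerProductSpace 𝕜 H] [NormedSpace ℝ H] [CompleteSpace H]
  {E V : ℝ → ℝ → H →L[𝕜] H} {F : ℝ → H →L[𝕜] H} {a b : ℝ} {y f g : ℝ → H}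

theorem integrableOn_strong_apply {G : Type*} [NormedAddCommGroup G] [NormedSpace 𝕜 G]
    [CompleteSpace G] {G' : Type*} [NormedAddCommGroup G'] [NormedSpace 𝕜 G']
    {P : ℝ → G →L[𝕜] G'} (hP : ∀ x, Continuous fun t => P t x) {v : ℝ → G}
    (hv : IntegrableOn v (Ioc a b)) : IntegrableOn (fun t => P t (v t)) (Ioc a b) := by
  obtain ⟨M, hM0, hM⟩ := exists_norm_le_of_isCompact (isCompact_Icc (a := a) (b := b))
    fun x => (hP x).continuousOn
  refine (hv.norm.const_mul M).mono' ((continuous_apply_of_strong hP).comp_aestronglyMeasurable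
    (continuous_id.aestronglyMeasurable.prodMk hv.1)) ?_
  filter_upwards [ae_restrict_mem measurableSet_Ioc] with t ht
  exact (P t).le_of_opNorm_le (hM t (Ioc_subset_Icc_self ht)) _

theorem continuousOn_strong_apply {G : Type*} [NormedAddCommGroup G] [NormedSpace 𝕜 G]
    [CompleteSpace G] {G' : Type*} [NormedAddCommGroup G'] [NormedSpace 𝕜 G']
    {P : ℝ → G →L[𝕜] G'} (hP : ∀ x, Continuous fun t => P t x) {v : ℝ → G} {s : Set ℝ}
    (hv : ContinuousOn v s) : ContinuousOn (fun t => P t (v t)) s :=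
  (continuous_apply_of_strong hP).comp_continuousOn (continuousOn_id.prodMk hv)

theorem IsMild.sub {y₁ y₂ f₁ f₂ : ℝ → H} (hE : IsEvolutionFamily E) (ha : 0 ≤ a)
    (hf₁ : IntegrableOn f₁ (Ioc a b)) (hf₂ : IntegrableOn f₂ (Ioc a b))
    (h₁ : IsMild E a b y₁ f₁) (h₂ : IsMild E a b y₂ f₂) :
    IsMild E a b (fun t => y₁ t - y₂ t) (fun t => f₁ t - f₂ t) := by
  intro s t hs hst ht
  have hsub : Ioc s t ⊆ Ioc a b := Ioc_subset_Ioc hs ht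
  simp only [map_sub]
  rw [intervalIntegral.integral_sub
    (hE.intervalIntegrable_apply (ha.trans hs) hst (hf₁.mono_set hsub))
    (hE.intervalIntegrable_apply (ha.trans hs) hst (hf₂.mono_set hsub)),
    h₁ s t hs hst ht, h₂ s t hs hst ht]
  abel

theorem IsMild.congr_right {f₁ f₂ : ℝ → H} (h₁ : IsMild E a b y f₁)
    (h : ∀ᵐ t ∂(volume.restrict (Ioc a b)), f₁ t = f₂ t) : IsMild E a b y f₂ := by
  intro s t hs hst ht
  rw [h₁ s t hs hst ht]
  congr 1
  refine intervalIntegral.integral_congr_ae_restrict ?_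
  rw [uIoc_of_le hst]
  filter_upwards [ae_restrict_of_ae_restrict_of_subset (Ioc_subset_Ioc hs ht) h] with r hr
  rw [hr]

/-- Uniqueness for `d' = (A(t) + F(t)) d`, `d(a) = 0`. -/
theorem IsMild.eq_zero (hE : IsEvolutionFamily E) (hF : ∀ x, Continuous fun t => F t x)
    (ha : 0 ≤ a) (hyc : ContinuousOn y (Icc a b)) (hy : IsMild E a b y fun r => F r (y r))
    (h0 : y a = 0) : ∀ t ∈ Icc a b, y t = 0 := by
  obtain ⟨M, hM0, hM⟩ := hE.exists_norm_le b
  obtain ⟨N, hN0, hN⟩ := exists_norm_le_of_isCompact (isCompact_Icc (a := a) (b := b))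
    fun x => (hF x).continuousOn
  obtain ⟨C, hC⟩ := (isCompact_Icc.image_of_continuousOn hyc.norm).bddAbove
  have key := nonpos_of_forall_le_integral (f := fun t => ‖y t‖) (c := M * N)
    ⟨C, fun t ht => hC ⟨t, ht, rfl⟩⟩ fun φ hφ hle t ht => by
      rw [hy a t le_rfl ht.1 ht.2, h0, map_zero, zero_add, ← intervalIntegral.integral_const_mul]
      refine intervalIntegral.norm_integral_le_of_norm_le ht.1 ?_
        ((hφ.const_mul _).intervalIntegrable _ _)
      refine Eventually.of_forall fun r hr => ?_
      calc ‖E t r (F r (y r))‖ ≤ M * (N * ‖y r‖) :=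
            ((E t r).le_of_opNorm_le (hM _ _ (ha.trans hr.1.le) hr.2 ht.2) _).trans
              (by gcongr; exact (F r).le_of_opNorm_le (hN r ⟨hr.1.le, hr.2.trans ht.2⟩) _)
        _ ≤ M * (N * φ r) := by gcongr; exact hle r ⟨hr.1.le, hr.2.trans ht.2⟩
        _ = M * N * φ r := by ring
  exact fun t ht => norm_le_zero_iff.1 (key t ht)

namespace IsPerturbedEvolution

/-- A mild solution of the perturbed system is one of the original system with the perturbation
as a source term. -/
theorem isMild_of_isMild (hV : IsPerturbedEvolution E F V) (hE : IsEvolutionFamily E)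
    (hF : ∀ x, Continuous fun t => F t x) (ha : 0 ≤ a) (hg : IntegrableOn g (Ioc a b))
    (hy : IsMild V a b y g) : IsMild E a b y fun r => F r (y r) + g r := by
  have hVE := hV.1
  have hyc := hy.continuousOn hVE ha hg
  have hFy : IntegrableOn (fun r => F r (y r)) (Ioc a b) :=
    ((continuousOn_strong_apply hF hyc).integrableOn_Icc).mono_set Ioc_subset_Icc_self
  refine IsMild.of_initial hE ha (hFy.add hg) fun t ht => ?_
  have hat : a ≤ t := ht.1
  have hg' : IntegrableOn g (Ioc a t) := hg.mono_set (Ioc_subset_Ioc_right ht.2)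
  have hFy' : IntegrableOn (fun r => F r (y r)) (Ioc a t) :=
    hFy.mono_set (Ioc_subset_Ioc_right ht.2)
  obtain ⟨M, hM0, hM⟩ := hE.exists_norm_le t
  obtain ⟨M', hM'0, hM'⟩ := exists_norm_le_of_isCompact
    ((isCompact_Icc (a := a) (b := t)).prod (isCompact_Icc (a := a) (b := t)))
    fun x => (hVE.continuous_extend x).continuousOn
  obtain ⟨N, hN0, hN⟩ := exists_norm_le_of_isCompact (isCompact_Icc (a := a) (b := t))
    fun x => (hF x).continuousOn
  have hFc := continuous_apply_of_strong hF
  -- the integrand of the double integral over `a ≤ r ≤ τ ≤ t`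
  have hI : Integrable (Function.uncurry fun τ r =>
      extendEvolution E (t, τ) (F τ (extendEvolution V (τ, r) (g r))))
      ((volume.restrict (Ioc a t)).prod (volume.restrict (Ioc a t))) := by
    have hmeas : AEStronglyMeasurable (Function.uncurry fun τ r =>
        extendEvolution E (t, τ) (F τ (extendEvolution V (τ, r) (g r))))
        ((volume.restrict (Ioc a t)).prod (volume.restrict (Ioc a t))) := by
      have h1 : AEStronglyMeasurable (fun q : ℝ × ℝ => extendEvolution V q (g q.2))
          ((volume.restrict (Ioc a t)).prod (volume.restrict (Ioc a t))) :=
        hVE.continuous_extend_apply.comp_aestronglyMeasurable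
          (continuous_id.aestronglyMeasurable.prodMk hg'.1.comp_snd)
      have h2 : AEStronglyMeasurable (fun q : ℝ × ℝ => F q.1 (extendEvolution V q (g q.2)))
          ((volume.restrict (Ioc a t)).prod (volume.restrict (Ioc a t))) :=
        hFc.comp_aestronglyMeasurable (continuous_fst.aestronglyMeasurable.prodMk h1)
      exact hE.continuous_extend_apply.comp_aestronglyMeasurable
        ((((continuous_const (y := t)).prodMk continuous_fst).aestronglyMeasurable).prodMk h2)
    have hdom : Integrable (fun q : ℝ × ℝ => M * N * M' * (1 * ‖g q.2‖))
        ((volume.restrict (Ioc a t)).prod (volume.restrict (Ioc a t))) :=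
      ((integrable_const (1 : ℝ)).mul_prod hg'.norm).const_mul _
    refine hdom.mono' hmeas ?_
    rw [Measure.prod_restrict]
    filter_upwards [ae_restrict_mem (measurableSet_Ioc.prod measurableSet_Ioc)] with q hq
    have h1 : ‖extendEvolution E (t, q.1)‖ ≤ M := by
      rw [extendEvolution_eq (ha.trans hq.1.1.le) hq.1.2]
      exact hM _ _ (ha.trans hq.1.1.le) hq.1.2 le_rfl
    calc _ ≤ M * (N * (M' * ‖g q.2‖)) := by
          refine (ContinuousLinearMap.le_of_opNorm_le _ h1 _).trans ?_
          gcongr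
          refine (ContinuousLinearMap.le_of_opNorm_le _
            (hN _ (Ioc_subset_Icc_self hq.1)) _).trans ?_
          gcongr
          exact ContinuousLinearMap.le_of_opNorm_le _
            (hM' q ⟨Ioc_subset_Icc_self hq.1, Ioc_subset_Icc_self hq.2⟩) _
      _ = _ := by ring
  have swap := integral_triangle_swap hat hI
  have hc := hVE.continuousOn_left ha (y a)
  have hFV : IntegrableOn (fun τ => F τ (V τ a (y a))) (Ioc a t) :=
    ((continuousOn_strong_apply hF 
      (hc.mono (fun _ h => h.1 : Icc a t ⊆ Ici a))).integrableOn_Icc).mono_set Ioc_subset_Icc_self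
  have e1 : ∫ τ in a..t, ∫ r in a..τ,
      extendEvolution E (t, τ) (F τ (extendEvolution V (τ, r) (g r))) =
      ∫ τ in a..t, (E t τ (F τ (y τ)) - E t τ (F τ (V τ a (y a)))) := by
    refine intervalIntegral.integral_congr fun τ hτ => ?_
    rw [uIcc_of_le hat] at hτ
    have hgτ : IntegrableOn g (Ioc a τ) := hg'.mono_set (Ioc_subset_Ioc_right hτ.2)
    have h1 : ∫ r in a..τ, extendEvolution E (t, τ) (F τ (extendEvolution V (τ, r) (g r))) =
        ∫ r in a..τ, ((E t τ).comp (F τ)) (V τ r (g r)) := by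
      refine intervalIntegral.integral_congr fun r hr => ?_
      rw [uIcc_of_le hτ.1] at hr
      simp only [extendEvolution_eq (ha.trans hτ.1) hτ.2, extendEvolution_eq (ha.trans hr.1) hr.2,
        ContinuousLinearMap.comp_apply]
    simp only [h1]
    rw [ContinuousLinearMap.intervalIntegral_comp_comm _
      (hVE.intervalIntegrable_apply ha hτ.1 hgτ), hy a τ le_rfl hτ.1 (hτ.2.trans ht.2)]
    simp
  have e2 : ∫ r in a..t, ∫ τ in r..t,
      extendEvolution E (t, τ) (F τ (extendEvolution V (τ, r) (g r))) =
      ∫ r in a..t, (V t r (g r) - E t r (g r)) := by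
    refine intervalIntegral.integral_congr fun r hr => ?_
    rw [uIcc_of_le hat] at hr
    rw [hV.2 (g r) r t (ha.trans hr.1) hr.2, add_sub_cancel_left]
    refine intervalIntegral.integral_congr fun τ hτ => ?_
    rw [uIcc_of_le hr.2] at hτ
    simp only [extendEvolution_eq (ha.trans hr.1) hτ.1,
      extendEvolution_eq (ha.trans (hr.1.trans hτ.1)) hτ.2]
  rw [e1, e2, intervalIntegral.integral_sub (hE.intervalIntegrable_apply ha hat hFy')
      (hE.intervalIntegrable_apply ha hat hFV),
    intervalIntegral.integral_sub (hVE.intervalIntegrable_apply ha hat hg')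
      (hE.intervalIntegrable_apply ha hat hg')] at swap
  simp only [map_add]
  rw [intervalIntegral.integral_add (hE.intervalIntegrable_apply ha hat hFy')
    (hE.intervalIntegrable_apply ha hat hg'), hy a t le_rfl hat ht.2, hV.2 (y a) a t ha hat,
    ← sub_eq_zero]
  rw [← sub_eq_zero] at swap
  rw [← neg_eq_zero, ← swap]
  abel

theorem isMild_homogeneous (hV : IsPerturbedEvolution E F V) (ha : 0 ≤ a) (x : H) :
    IsMild V a b (fun t => V t a x) fun _ => 0 := by
  intro s t hs hst ht
  simp only [map_zero, intervalIntegral.integral_zero, add_zero]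
  rw [← hV.1.comp a s t ha hs hst]
  rfl

theorem isMild_duhamel (hV : IsPerturbedEvolution E F V) (ha : 0 ≤ a) (x : H)
    (hg : IntegrableOn g (Ioc a b)) :
    IsMild V a b (fun t => V t a x + ∫ r in a..t, V t r (g r)) g := by
  refine IsMild.of_initial hV.1 ha hg fun t _ => ?_
  simp [hV.1.refl a ha]

/-- Variation of constants: a mild solution of the original system is one of the perturbed
system. -/
theorem isMild_perturbed (hV : IsPerturbedEvolution E F V) (hE : IsEvolutionFamily E)
    (hF : ∀ x, Continuous fun t => F t x) (ha : 0 ≤ a) (hf : IntegrableOn f (Ioc a b))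
    (hy : IsMild E a b y f) : IsMild V a b y fun r => f r - F r (y r) := by
  have hyc := hy.continuousOn hE ha hf
  have hFy : IntegrableOn (fun r => F r (y r)) (Ioc a b) :=
    ((continuousOn_strong_apply hF hyc).integrableOn_Icc).mono_set Ioc_subset_Icc_self
  have hg : IntegrableOn (fun r => f r - F r (y r)) (Ioc a b) := hf.sub hFy
  have hz := hV.isMild_duhamel ha (y a) hg
  set z := fun t => V t a (y a) + ∫ r in a..t, V t r (f r - F r (y r)) with hzdef
  have hzc := hz.continuousOn hV.1 ha hg
  have hFz : IntegrableOn (fun r => F r (z r)) (Ioc a b) :=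
    ((continuousOn_strong_apply hF hzc).integrableOn_Icc).mono_set Ioc_subset_Icc_self
  have hzE := hV.isMild_of_isMild hE hF ha hg hz
  have hd := IsMild.sub hE ha (hFz.add hg) hf hzE hy
  have hd' : IsMild E a b (fun t => z t - y t) fun r => F r (z r - y r) := by
    refine hd.congr_right (Eventually.of_forall fun t => ?_)
    simp only [Pi.add_apply, map_sub]
    abel
  have hzero := hd'.eq_zero hE hF ha (hzc.sub hyc) (by simp [hzdef, hV.1.refl a ha])
  intro s t hs hst ht
  have e1 : z s = y s := sub_eq_zero.1 (hzero s ⟨hs, hst.trans ht⟩)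
  have e2 : z t = y t := sub_eq_zero.1 (hzero t ⟨hs.trans hst, ht⟩)
  rw [← e1, ← e2]
  exact hz s t hs hst ht

end IsPerturbedEvolution

end Perturbation

/-! ### Periodicity of evolution operators -/

section Periodicity

variable {𝕜 : Type*} [RCLike 𝕜]
  {H : Type*} [NormedAddCommGroup H] [InnerProductSpace 𝕜 H] [NormedSpace ℝ H] [CompleteSpace H]
  {E V : ℝ → ℝ → H →L[𝕜] H} {F : ℝ → H →L[𝕜] H} {θ : ℝ}

/-- `E(t + θ, s + θ) = E(t, s)` for `0 ≤ s ≤ t`. -/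
def IsPeriodicEvolution (θ : ℝ) (E : ℝ → ℝ → H →L[𝕜] H) : Prop :=
  ∀ s t, 0 ≤ s → s ≤ t → E (t + θ) (s + θ) = E t s

theorem IsResolvent.unique {A : H →ₗ.[𝕜] H} {z : 𝕜} {R R' : H →L[𝕜] H}
    (h : IsResolvent A z R) (h' : IsResolvent A z R') : R = R' := by
  ext x
  obtain ⟨hx, he⟩ := h.1 x
  have := h'.2 ⟨R x, hx⟩
  simp only [he] at this
  exact this.symm

theorem IsYosidaApprox.unique {A : H →ₗ.[𝕜] H} {n : ℕ} {Y Y' : H →L[𝕜] H}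
    (h : IsYosidaApprox A n Y) (h' : IsYosidaApprox A n Y') : Y = Y' := by
  obtain ⟨R, hR, rfl⟩ := h
  obtain ⟨R', hR', rfl⟩ := h'
  rw [hR.unique hR']

/-- By uniqueness: `E(t + θ, s + θ)` solves the integral equation that determines `E(t, s)`. -/
theorem IsBoundedEvolution.periodic {Y : ℝ → H →L[𝕜] H} (hE : IsBoundedEvolution Y E)
    (hθ : 0 ≤ θ) (hY : ∀ t, 0 ≤ t → Y (t + θ) = Y t) : IsPeriodicEvolution θ E := by
  intro s t hs hst
  ext x
  obtain ⟨M, hM⟩ := hE.bdd t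
  have hM0 : 0 ≤ M := (norm_nonneg _).trans (hM t (hs.trans hst) le_rfl)
  have hc1 : ContinuousOn (fun r => E (r + θ) (s + θ) x) (Icc s t) :=
    (hE.toIsEvolutionFamily.continuousOn_left (add_nonneg hs hθ) x).comp (by fun_prop)
      fun r hr => add_le_add_left hr.1 θ
  have hc2 : ContinuousOn (fun r => E r s x) (Icc s t) :=
    (hE.toIsEvolutionFamily.continuousOn_left hs x).mono fun r hr => hr.1
  obtain ⟨C, hC⟩ := (isCompact_Icc.image_of_continuousOn (hc1.sub hc2).norm).bddAbove
  have key := nonpos_of_forall_le_integral (f := fun r => ‖E (r + θ) (s + θ) x - E r s x‖)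
    (a := s) (b := t) (c := M) ⟨C, fun r hr => hC ⟨r, hr, rfl⟩⟩ fun φ hφ hle r hr => by
      have hi1 : IntervalIntegrable (fun τ => Y τ (E (τ + θ) (s + θ) x)) volume s r := by
        have := (hE.integrable x (s + θ) (r + θ) (add_nonneg hs hθ)
          (add_le_add_left hr.1 θ)).comp_add_right θ
        simp only [add_sub_cancel_right] at this
        refine this.congr fun τ hτ => ?_
        rw [uIoc_of_le hr.1] at hτ
        simp only [hY τ (hs.trans hτ.1.le)]
      have e1 : E (r + θ) (s + θ) x = x + ∫ τ in s..r, Y τ (E (τ + θ) (s + θ) x) := by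
        rw [hE.eq x (s + θ) (r + θ) (add_nonneg hs hθ) (add_le_add_left hr.1 θ),
          ← intervalIntegral.integral_comp_add_right (fun τ => Y τ (E τ (s + θ) x))]
        congr 1
        refine intervalIntegral.integral_congr fun τ hτ => ?_
        rw [uIcc_of_le hr.1] at hτ
        simp only [hY τ (hs.trans hτ.1)]
      rw [e1, hE.eq x s r hs hr.1, add_sub_add_left_eq_sub,
        ← intervalIntegral.integral_sub hi1 (hE.integrable x s r hs hr.1),
        ← intervalIntegral.integral_const_mul]
      refine intervalIntegral.norm_integral_le_of_norm_le hr.1 ?_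
        ((hφ.const_mul _).intervalIntegrable _ _)
      refine Eventually.of_forall fun τ hτ => ?_
      rw [← map_sub]
      refine ((Y τ).le_of_opNorm_le (hM τ (hs.trans hτ.1.le) (hτ.2.trans hr.2)) _).trans ?_
      gcongr
      exact hle τ ⟨hτ.1.le, hτ.2.trans hr.2⟩
  exact sub_eq_zero.1 (norm_le_zero_iff.1 (key t ⟨hst, le_rfl⟩))

/-- The evolution operator inherits the period of the generators, because it is the limit of the
evolution operators of their Yosida approximations, which are determined by the generators. -/
theorem GeneratesEvolution.periodic {A : ℝ → H →ₗ.[𝕜] H} (hE : GeneratesEvolution A E)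
    (hθ : 0 < θ) (hA : Function.Periodic A θ) : IsPeriodicEvolution θ E := by
  intro s t hs hst
  ext x
  obtain ⟨An, En, hev, hlim⟩ := hE.yosida
  have hb : 0 < t + θ := by linarith
  have h := hlim (t + θ) hb x
  have h1 := h.tendsto_at (x := (t + θ, s + θ))
    ⟨by simp only; linarith, by simp only; linarith, le_rfl⟩
  have h2 := h.tendsto_at (x := (t, s)) ⟨hs, hst, by simp only; linarith⟩
  refine tendsto_nhds_unique h1 (h2.congr' ?_)
  filter_upwards [hev] with n hn
  have hp := hn.2.periodic hθ.le fun t ht => by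
    have h1 := hn.1 (t + θ) (by linarith)
    rw [hA t] at h1
    exact h1.unique (hn.1 t ht)
  rw [hp s t hs hst]

/-- By uniqueness for the perturbed equation. -/
theorem IsPerturbedEvolution.periodic (hV : IsPerturbedEvolution E F V)
    (hE : IsEvolutionFamily E) (hF : ∀ x, Continuous fun t => F t x) (hθ : 0 ≤ θ)
    (hEp : IsPeriodicEvolution θ E) (hFp : Function.Periodic F θ) : IsPeriodicEvolution θ V := by
  intro s t hs hst
  ext x
  have hsθ : 0 ≤ s + θ := add_nonneg hs hθ
  have hc1 : ContinuousOn (fun r => V (r + θ) (s + θ) x) (Icc s t) :=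
    (hV.1.continuousOn_left hsθ x).comp (by fun_prop) fun r hr => add_le_add_left hr.1 θ
  have hc2 : ContinuousOn (fun r => V r s x) (Icc s t) :=
    (hV.1.continuousOn_left hs x).mono fun r hr => hr.1
  have hi : ∀ z : ℝ → H, ContinuousOn z (Icc s t) → IntegrableOn (fun r => F r (z r)) (Ioc s t) :=
    fun z hz => ((continuousOn_strong_apply hF hz).integrableOn_Icc).mono_set Ioc_subset_Icc_self
  have m1 : IsMild E s t (fun r => V (r + θ) (s + θ) x) fun r => F r (V (r + θ) (s + θ) x) := by
    refine IsMild.of_initial hE hs (hi _ hc1) fun r hr => ?_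
    rw [hV.2 x (s + θ) (r + θ) hsθ (add_le_add_left hr.1 θ), hV.1.refl _ hsθ, hEp s r hs hr.1,
      ← intervalIntegral.integral_comp_add_right
        (fun τ => E (r + θ) τ (F τ (V τ (s + θ) x)))]
    congr 1
    refine intervalIntegral.integral_congr fun τ hτ => ?_
    rw [uIcc_of_le hr.1] at hτ
    rw [hEp τ r (hs.trans hτ.1) hτ.2, hFp τ]
  have m2 : IsMild E s t (fun r => V r s x) fun r => F r (V r s x) := by
    refine IsMild.of_initial hE hs (hi _ hc2) fun r hr => ?_
    rw [hV.2 x s r hs hr.1, hV.1.refl _ hs]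
    rfl
  have hd := (m1.sub hE hs (hi _ hc1) (hi _ hc2) m2).congr_right
    (f₂ := fun r => F r (V (r + θ) (s + θ) x - V r s x)) (Eventually.of_forall fun r => by simp)
  exact sub_eq_zero.1 (hd.eq_zero hE hF hs (hc1.sub hc2)
    (by simp [hV.1.refl _ hs, hV.1.refl _ hsθ]) t ⟨hst, le_rfl⟩)

/-- The shift by `n` periods. -/
theorem IsPeriodicEvolution.nat_mul (hV : IsPeriodicEvolution θ V) (hθ : 0 ≤ θ) (n : ℕ) :
    ∀ s t, 0 ≤ s → s ≤ t → V (t + n * θ) (s + n * θ) = V t s := by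
  induction n with
  | zero => simp
  | succ n ih =>
    intro s t hs hst
    have h1 : ∀ r : ℝ, r + ((n + 1 : ℕ) : ℝ) * θ = (r + n * θ) + θ := fun r => by push_cast; ring
    rw [h1, h1, hV _ _ (by positivity) (by linarith), ih s t hs hst]

/-- For an exponentially stable periodic system the monodromy operator `V(θ,0)` has powers of norm
less than one, so that `1` is not in its spectrum. -/
theorem IsExpStable.isUnit_one_sub (hs : IsExpStable V) (hV : IsEvolutionFamily V) (hθ : 0 < θ)
    (hp : IsPeriodicEvolution θ V) : IsUnit (1 - V θ 0) := by
  obtain ⟨M, ρ, hM, hρ, hle⟩ := hs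
  have hpow : ∀ n : ℕ, V (n * θ) 0 = V θ 0 ^ n := by
    intro n
    induction n with
    | zero =>
      rw [Nat.cast_zero, zero_mul, pow_zero]
      exact hV.refl 0 le_rfl
    | succ n ih =>
      have hn : (0 : ℝ) ≤ n * θ := by positivity
      have h1 := hp.nat_mul hθ.le n 0 θ le_rfl hθ.le
      rw [pow_succ', ← ih, ← h1, zero_add, Nat.cast_succ,
        show θ + (n : ℝ) * θ = ((n : ℝ) + 1) * θ by ring]
      exact (hV.comp 0 (n * θ) ((n + 1) * θ) le_rfl hn (by linarith)).symm
  have hlim : Tendsto (fun n : ℕ => M * Real.exp (-ρ * (n * θ - 0))) atTop (𝓝 0) := by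
    have : Tendsto (fun n : ℕ => (n : ℝ) * (ρ * θ)) atTop atTop :=
      tendsto_natCast_atTop_atTop.atTop_mul_const (by positivity)
    have h2 := (Real.tendsto_exp_neg_atTop_nhds_zero.comp this).const_mul M
    rw [mul_zero] at h2
    refine h2.congr fun n => ?_
    simp only [Function.comp]
    congr 2
    ring
  obtain ⟨n, hn⟩ := (hlim.eventually (gt_mem_nhds one_pos)).exists
  have hlt : ‖V θ 0 ^ n‖ < 1 := by
    rw [← hpow]
    exact (hle 0 (n * θ) le_rfl (by positivity)).trans_lt hn
  -- `1 - W ^ n = (1 - W) * ∑ i < n, W ^ i` with commuting factors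
  have hu : IsUnit (1 - V θ 0 ^ n) := isUnit_one_sub_of_norm_lt_one hlt
  have hc : Commute (1 - V θ 0) (∑ i ∈ Finset.range n, V θ 0 ^ i) :=
    (Commute.one_left _).sub_left (Commute.sum_right _ _ _ fun i _ => (Commute.refl _).pow_right i)
  rw [← mul_neg_geom_sum, hc.isUnit_mul_iff] at hu
  exact hu.1

end Periodicity

/-! ### Operators between spaces of square integrable functions -/

section LTwo

variable {𝕜 : Type*} [RCLike 𝕜]
  {H : Type*} [NormedAddCommGroup H] [InnerProductSpace 𝕜 H] [NormedSpace ℝ H] [CompleteSpace H]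
  {E V : ℝ → ℝ → H →L[𝕜] H} {F : ℝ → H →L[𝕜] H} {T : ℝ} {κ : 𝕜} {a : H} {y g : ℝ → H}

/-- A map into square integrable functions that is linear up to null sets and bounded defines a
continuous linear map into `L²`. -/
theorem exists_clm_toLp {X : Type*} [NormedAddCommGroup X] [NormedSpace 𝕜 X]
    {G : Type*} [NormedAddCommGroup G] [InnerProductSpace 𝕜 G] {μ : Measure ℝ}
    {m : X → ℝ → G} (hmem : ∀ x, MemLp (m x) 2 μ)
    (hadd : ∀ x x', m (x + x') =ᵐ[μ] fun t => m x t + m x' t)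
    (hsmul : ∀ (k : 𝕜) x, m (k • x) =ᵐ[μ] fun t => k • m x t)
    {c : ℝ} (hb : ∀ x, ‖(hmem x).toLp‖ ≤ c * ‖x‖) :
    ∃ Φ : X →L[𝕜] Lp G 2 μ, ∀ x, Φ x =ᵐ[μ] m x := by
  let L : X →ₗ[𝕜] Lp G 2 μ :=
    { toFun := fun x => (hmem x).toLp
      map_add' := fun x x' => by
        rw [← MemLp.toLp_add]
        exact MemLp.toLp_congr _ _ (hadd x x')
      map_smul' := fun k x => by
        rw [RingHom.id_apply, ← MemLp.toLp_const_smul]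
        exact MemLp.toLp_congr _ _ (hsmul k x) }
  exact ⟨L.mkContinuous c hb, fun x => MemLp.coeFn_toLp (hmem x)⟩

theorem memLp_strong_apply {G G' : Type*} [NormedAddCommGroup G] [InnerProductSpace 𝕜 G]
    [CompleteSpace G] [NormedAddCommGroup G'] [InnerProductSpace 𝕜 G']
    {P : ℝ → G →L[𝕜] G'} (hP : ∀ x, Continuous fun t => P t x) {v : ℝ → G}
    (hv : MemLp v 2 (volume.restrict (Ioc 0 T))) :
    MemLp (fun t => P t (v t)) 2 (volume.restrict (Ioc 0 T)) := by
  obtain ⟨M, hM0, hM⟩ := exists_norm_le_of_isCompact (isCompact_Icc (a := (0 : ℝ)) (b := T))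
    fun x => (hP x).continuousOn
  refine hv.of_le_mul (c := M) ((continuous_apply_of_strong hP).comp_aestronglyMeasurable
    (continuous_id.aestronglyMeasurable.prodMk hv.1)) ?_
  filter_upwards [ae_restrict_mem measurableSet_Ioc] with t ht
  exact (P t).le_of_opNorm_le (hM t (Ioc_subset_Icc_self ht)) _

theorem memLp_of_continuousOn {G : Type*} [NormedAddCommGroup G] {y : ℝ → G}
    (hy : ContinuousOn y (Icc 0 T)) : MemLp y 2 (volume.restrict (Ioc 0 T)) := by
  obtain ⟨M, hM⟩ := (isCompact_Icc.image_of_continuousOn hy.norm).bddAbove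
  refine MemLp.of_bound ((hy.mono Ioc_subset_Icc_self).aestronglyMeasurable measurableSet_Ioc) M ?_
  filter_upwards [ae_restrict_mem measurableSet_Ioc] with t ht
  exact hM ⟨t, Ioc_subset_Icc_self ht, rfl⟩

/-- Multiplication by a strongly continuous operator-valued function on `L²(0, T)`. -/
theorem exists_clm_strong {G G' : Type*} [NormedAddCommGroup G] [InnerProductSpace 𝕜 G]
    [CompleteSpace G] [NormedAddCommGroup G'] [InnerProductSpace 𝕜 G']
    {P : ℝ → G →L[𝕜] G'} (hP : ∀ x, Continuous fun t => P t x) (T : ℝ) :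
    ∃ Φ : Lp G 2 (volume.restrict (Ioc 0 T)) →L[𝕜] Lp G' 2 (volume.restrict (Ioc 0 T)),
      ∀ v, Φ v =ᵐ[volume.restrict (Ioc 0 T)] fun t => P t (v t) := by
  obtain ⟨M, hM0, hM⟩ := exists_norm_le_of_isCompact (isCompact_Icc (a := (0 : ℝ)) (b := T))
    fun x => (hP x).continuousOn
  refine exists_clm_toLp (c := M) (fun v => memLp_strong_apply hP (Lp.memLp v)) ?_ ?_ ?_
  · intro v w
    filter_upwards [Lp.coeFn_add v w] with t ht
    rw [ht, Pi.add_apply, map_add]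
  · intro k v
    filter_upwards [Lp.coeFn_smul k v] with t ht
    rw [ht, Pi.smul_apply, map_smul]
  · intro v
    refine Lp.norm_le_mul_norm_of_ae_le_mul ?_
    filter_upwards [MemLp.coeFn_toLp (memLp_strong_apply hP (Lp.memLp v)),
      ae_restrict_mem measurableSet_Ioc] with t ht ht'
    rw [ht]
    exact (P t).le_of_opNorm_le (hM t (Ioc_subset_Icc_self ht')) _

/-- The mild solution of `y' = A(t) y + g(t)` on `[0, T]` with `y(0) = κ y(T) + a`, where `V` is the
evolution operator of `A`. It has this property only if `1 - κ V(T,0)` is invertible: otherwise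
`Ring.inverse` is zero. -/
def bvpSolution (V : ℝ → ℝ → H →L[𝕜] H) (T : ℝ) (κ : 𝕜) (a : H) (g : ℝ → H) (t : ℝ) : H :=
  V t 0 (Ring.inverse (1 - κ • V T 0) (κ • (∫ r in (0 : ℝ)..T, V T r (g r)) + a)) +
    ∫ r in (0 : ℝ)..t, V t r (g r)

theorem bvpSolution_zero (hV : IsEvolutionFamily V) :
    bvpSolution V T κ a g 0 =
      Ring.inverse (1 - κ • V T 0) (κ • (∫ r in (0 : ℝ)..T, V T r (g r)) + a) := by
  simp [bvpSolution, hV.refl 0 le_rfl]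

theorem isMild_bvpSolution (hV : IsEvolutionFamily V) (hg : IntegrableOn g (Ioc 0 T)) :
    IsMild V 0 T (bvpSolution V T κ a g) g := by
  refine IsMild.of_initial hV le_rfl hg fun t _ => ?_
  rw [bvpSolution_zero hV]
  rfl

theorem bvpSolution_boundary (hV : IsEvolutionFamily V) (hκ : IsUnit (1 - κ • V T 0)) :
    bvpSolution V T κ a g 0 = κ • bvpSolution V T κ a g T + a := by
  rw [bvpSolution_zero hV]
  set x := κ • (∫ r in (0 : ℝ)..T, V T r (g r)) + a with hx
  have h : (1 - κ • V T 0) (Ring.inverse (1 - κ • V T 0) x) = x := by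
    rw [← mul_apply_eq_comp, Ring.mul_inverse_cancel _ hκ]; rfl
  rw [sub_apply, smul_apply, sub_eq_iff_eq_add] at h
  rw [bvpSolution, ← hx, smul_add]
  conv_lhs => rw [show Ring.inverse (1 - κ • V T 0) x = _ from h]
  rw [hx]
  abel

theorem IsMild.eq_bvpSolution (hT : 0 ≤ T) (hκ : IsUnit (1 - κ • V T 0))
    (hy : IsMild V 0 T y g) (hb : y 0 = κ • y T + a) :
    ∀ t ∈ Icc 0 T, y t = bvpSolution V T κ a g t := by
  intro t ht
  have h0 : y 0 = Ring.inverse (1 - κ • V T 0) (κ • (∫ r in (0 : ℝ)..T, V T r (g r)) + a) := by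
    have h : (1 - κ • V T 0) (y 0) = κ • (∫ r in (0 : ℝ)..T, V T r (g r)) + a := by
      rw [sub_apply, smul_apply,
        one_apply_eq_self]
      nth_rw 1 [hb]
      rw [hy 0 T le_rfl hT le_rfl, smul_add]
      abel
    rw [← h, ← mul_apply_eq_comp, Ring.inverse_mul_cancel _ hκ]; rfl
  rw [bvpSolution, ← h0]
  exact hy 0 t le_rfl ht.1 ht.2

theorem integral_norm_le_lp {G : Type*} [NormedAddCommGroup G] (T : ℝ) :
    ∃ c, 0 ≤ c ∧ ∀ v : Lp G 2 (volume.restrict (Ioc 0 T)), ∫ t in Ioc 0 T, ‖v t‖ ≤ c * ‖v‖ := by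
  refine ⟨((volume.restrict (Ioc 0 T)) univ ^ (1 / (1 : ENNReal).toReal -
    1 / (2 : ENNReal).toReal)).toReal, ENNReal.toReal_nonneg, fun v => ?_⟩
  have h := eLpNorm_le_eLpNorm_mul_rpow_measure_univ (μ := volume.restrict (Ioc 0 T))
    (p := 1) (q := 2) one_le_two (Lp.aestronglyMeasurable v)
  rw [integral_norm_eq_lintegral_enorm (Lp.aestronglyMeasurable v),
    ← eLpNorm_one_eq_lintegral_enorm,
    Lp.norm_def, mul_comm, ← ENNReal.toReal_mul]
  refine ENNReal.toReal_mono (ENNReal.mul_ne_top (Lp.eLpNorm_ne_top v) ?_) h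
  exact ENNReal.rpow_ne_top_of_nonneg (by norm_num) (measure_ne_top _ _)

theorem bvpSolution_congr {g' : ℝ → H} (h : g =ᵐ[volume.restrict (Ioc 0 T)] g') :
    ∀ t ∈ Icc 0 T, bvpSolution V T κ a g t = bvpSolution V T κ a g' t := by
  have h1 : ∀ s ∈ Icc 0 T, ∀ t,
      ∫ r in (0 : ℝ)..s, V t r (g r) = ∫ r in (0 : ℝ)..s, V t r (g' r) := by
    intro s hs t
    refine intervalIntegral.integral_congr_ae_restrict ?_
    rw [uIoc_of_le hs.1]
    filter_upwards [ae_restrict_of_ae_restrict_of_subset (Ioc_subset_Ioc_right hs.2) h] with r hr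
    rw [hr]
  intro t ht
  rw [bvpSolution, bvpSolution, h1 t ht, h1 T ⟨ht.1.trans ht.2, le_rfl⟩]

/-- The solution operator `g ↦ y` of the boundary value problem with `a = 0`, on `L²(0, T; H)`. -/
theorem exists_clm_bvp (hV : IsEvolutionFamily V) (hT : 0 ≤ T) (κ : 𝕜) :
    ∃ Φ : Lp H 2 (volume.restrict (Ioc 0 T)) →L[𝕜] Lp H 2 (volume.restrict (Ioc 0 T)),
      ∀ g, Φ g =ᵐ[volume.restrict (Ioc 0 T)] bvpSolution V T κ 0 g := by
  obtain ⟨M, hM0, hM⟩ := hV.exists_norm_le T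
  obtain ⟨c, hc0, hc⟩ := integral_norm_le_lp (G := H) T
  have hint : ∀ g : Lp H 2 (volume.restrict (Ioc 0 T)), IntegrableOn g (Ioc 0 T) :=
    fun g => (Lp.memLp g).integrable one_le_two
  have hi : ∀ (g : Lp H 2 (volume.restrict (Ioc 0 T))), ∀ t ∈ Icc 0 T,
      IntervalIntegrable (fun r => V t r (g r)) volume 0 t := fun g t ht =>
    hV.intervalIntegrable_apply le_rfl ht.1 ((hint g).mono_set (Ioc_subset_Ioc_right ht.2))
  have hTT : T ∈ Icc 0 T := ⟨hT, le_rfl⟩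
  have hmem : ∀ g : Lp H 2 (volume.restrict (Ioc 0 T)),
      MemLp (bvpSolution V T κ 0 g) 2 (volume.restrict (Ioc 0 T)) := fun g =>
    memLp_of_continuousOn ((isMild_bvpSolution hV (hint g)).continuousOn hV le_rfl (hint g))
  have hbd : ∀ (g : Lp H 2 (volume.restrict (Ioc 0 T))), ∀ t ∈ Icc 0 T,
      ‖∫ r in (0 : ℝ)..t, V t r (g r)‖ ≤ M * (c * ‖g‖) := by
    intro g t ht
    have h1 : ‖∫ r in (0 : ℝ)..t, V t r (g r)‖ ≤ ∫ r in (0 : ℝ)..t, M * ‖g r‖ := by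
      refine intervalIntegral.norm_integral_le_of_norm_le ht.1
        (Eventually.of_forall fun r hr => ?_) ?_
      · exact (V t r).le_of_opNorm_le (hM _ _ hr.1.le hr.2 ht.2) _
      · exact intervalIntegrable_sub ((hint g).norm.const_mul M) le_rfl ht.1 ht.2
    refine h1.trans ?_
    rw [intervalIntegral.integral_const_mul, intervalIntegral.integral_of_le ht.1]
    gcongr
    refine le_trans ?_ (hc g)
    exact setIntegral_mono_set (hint g).norm (Eventually.of_forall fun _ => norm_nonneg _)
      (Ioc_subset_Ioc_right ht.2).eventuallyLE
  refine exists_clm_toLp (c := (measureUnivNNReal (volume.restrict (Ioc 0 T)) : ℝ) ^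
      ((2 : ENNReal).toReal)⁻¹ *
      (M * ‖Ring.inverse (1 - κ • V T 0)‖ * ‖κ‖ * (M * c) + M * c)) hmem ?_ ?_ ?_
  · intro g g'
    filter_upwards [ae_restrict_mem measurableSet_Ioc] with t ht
    have ht' := Ioc_subset_Icc_self ht
    rw [bvpSolution_congr (Lp.coeFn_add g g') t ht']
    simp only [bvpSolution, Pi.add_apply, map_add, add_zero]
    rw [intervalIntegral.integral_add (hi g t ht') (hi g' t ht'),
      intervalIntegral.integral_add (hi g T hTT) (hi g' T hTT), smul_add, map_add, map_add]
    abel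
  · intro k g
    filter_upwards [ae_restrict_mem measurableSet_Ioc] with t ht
    have ht' := Ioc_subset_Icc_self ht
    rw [bvpSolution_congr (Lp.coeFn_smul k g) t ht']
    simp only [bvpSolution, Pi.smul_apply, map_smul, add_zero]
    rw [intervalIntegral.integral_smul, intervalIntegral.integral_smul, smul_add, map_smul,
      map_smul, smul_comm κ k]
  · intro g
    rw [mul_assoc]
    refine Lp.norm_le_of_ae_bound (by positivity) ?_
    filter_upwards [MemLp.coeFn_toLp (hmem g), ae_restrict_mem measurableSet_Ioc] with t ht ht'
    have ht'' := Ioc_subset_Icc_self ht'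
    rw [ht, bvpSolution, add_zero, add_mul]
    refine (norm_add_le _ _).trans (add_le_add ?_ (by rw [mul_assoc]; exact hbd g t ht''))
    calc _ ≤ M * (‖Ring.inverse (1 - κ • V T 0)‖ * (‖κ‖ * (M * (c * ‖g‖)))) := by
          refine ((V t 0).le_of_opNorm_le (hM _ _ le_rfl ht''.1 ht''.2) _).trans ?_
          gcongr
          refine (ContinuousLinearMap.le_opNorm _ _).trans ?_
          gcongr
          rw [norm_smul]
          gcongr
          exact hbd g T hTT
      _ = _ := by ring

/-- The operator that maps an initial state to its free trajectory in `L²(0, T; H)`. -/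
theorem exists_clm_initial (hV : IsEvolutionFamily V) (T : ℝ) :
    ∃ Φ : H →L[𝕜] Lp H 2 (volume.restrict (Ioc 0 T)),
      ∀ x, Φ x =ᵐ[volume.restrict (Ioc 0 T)] fun t => V t 0 x := by
  obtain ⟨M, hM0, hM⟩ := hV.exists_norm_le T
  have hmem : ∀ x, MemLp (fun t => V t 0 x) 2 (volume.restrict (Ioc 0 T)) := fun x =>
    memLp_of_continuousOn ((hV.continuousOn_left le_rfl x).mono fun t ht => ht.1)
  refine exists_clm_toLp (c := (measureUnivNNReal (volume.restrict (Ioc 0 T)) : ℝ) ^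
      ((2 : ENNReal).toReal)⁻¹ * M) hmem (fun x x' => by simp) (fun k x => by simp) fun x => ?_
  rw [mul_assoc]
  refine Lp.norm_le_of_ae_bound (by positivity) ?_
  filter_upwards [MemLp.coeFn_toLp (hmem x), ae_restrict_mem measurableSet_Ioc] with t ht ht'
  rw [ht]
  exact (V t 0).le_of_opNorm_le (hM _ _ le_rfl ht'.1.le ht'.2) _

end LTwo

/-! ### A coercive normal equation -/

/-- The normal equation of a quadratic functional `‖D w + f‖² + ⟪Q (N w + g), N w + g⟫` whose
quadratic part is coercive because `w` can be recovered from `N w` and `D w`. -/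
theorem exists_normal_equation {𝕜 : Type*} [RCLike 𝕜]
    {X Z : Type*} [NormedAddCommGroup X] [InnerProductSpace 𝕜 X] [CompleteSpace X]
    [NormedAddCommGroup Z] [InnerProductSpace 𝕜 Z] [CompleteSpace Z]
    {D : X →L[𝕜] Z} {N Q P₁ : X →L[𝕜] X} {P₂ : Z →L[𝕜] X}
    (hP : ∀ w, w = P₁ (N w) + P₂ (D w)) {ε : ℝ} (hε : 0 < ε)
    (hQ : ∀ v, ε * ‖v‖ ^ 2 ≤ RCLike.re ⟪Q v, v⟫_𝕜) (f : Z) (g : X) :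
    ∃ w, ∀ w', ⟪D w + f, D w'⟫_𝕜 + ⟪Q (N w + g), N w'⟫_𝕜 = 0 := by
  let R : X →L[𝕜] X := (ContinuousLinearMap.adjoint D).comp D +
    (ContinuousLinearMap.adjoint N).comp (Q.comp N)
  have hR : ∀ w w', ⟪R w, w'⟫_𝕜 = ⟪D w, D w'⟫_𝕜 + ⟪Q (N w), N w'⟫_𝕜 := by
    intro w w'
    simp [R, inner_add_left, ContinuousLinearMap.adjoint_inner_left]
  set c := ‖P₁‖ + ‖P₂‖ + 1 with hc
  have hc0 : 0 < c := by positivity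
  let δ : NNReal := ⟨min 1 ε / (2 * c ^ 2), by positivity⟩
  have hδ : 0 < δ := by
    change 0 < min 1 ε / (2 * c ^ 2)
    positivity
  have hu : IsUnit R := by
    refine ContinuousLinearMap.isUnit_of_forall_le_norm_inner_map R hδ fun w => ?_
    have h1 : ‖w‖ ≤ c * (‖N w‖ + ‖D w‖) := by
      have h2 : ‖w‖ ≤ ‖P₁‖ * ‖N w‖ + ‖P₂‖ * ‖D w‖ := by
        conv_lhs => rw [hP w]
        exact (norm_add_le _ _).trans (add_le_add (P₁.le_opNorm _) (P₂.le_opNorm _))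
      nlinarith [norm_nonneg (N w), norm_nonneg (D w), norm_nonneg P₁, norm_nonneg P₂]
    have h2 : ‖w‖ ^ 2 ≤ 2 * c ^ 2 * (‖N w‖ ^ 2 + ‖D w‖ ^ 2) := by
      calc ‖w‖ ^ 2 ≤ (c * (‖N w‖ + ‖D w‖)) ^ 2 := by gcongr
        _ ≤ _ := by nlinarith [mul_nonneg (sq_nonneg c) (sq_nonneg (‖N w‖ - ‖D w‖))]
    have h3 : min 1 ε * (‖N w‖ ^ 2 + ‖D w‖ ^ 2) ≤ RCLike.re ⟪R w, w⟫_𝕜 := by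
      rw [hR, map_add, inner_self_eq_norm_sq]
      have := hQ (N w)
      nlinarith [min_le_left 1 ε, min_le_right 1 ε, sq_nonneg ‖N w‖, sq_nonneg ‖D w‖]
    refine le_trans ?_ (h3.trans (RCLike.re_le_norm _))
    change ‖w‖ ^ 2 * (min 1 ε / (2 * c ^ 2)) ≤ _
    rw [mul_div_assoc', div_le_iff₀ (by positivity)]
    have : 0 ≤ min 1 ε := by positivity
    nlinarith
  obtain ⟨w, hw⟩ := (ContinuousLinearMap.isUnit_iff_bijective.1 hu).2
    (-(ContinuousLinearMap.adjoint D f + ContinuousLinearMap.adjoint N (Q g)))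
  refine ⟨w, fun w' => ?_⟩
  have := hR w w'
  rw [hw, inner_neg_left, inner_add_left, ContinuousLinearMap.adjoint_inner_left,
    ContinuousLinearMap.adjoint_inner_left] at this
  rw [map_add, inner_add_left, inner_add_left]
  linear_combination -this

/-! ### Adjoint states -/

section Adjoint

variable {𝕜 : Type*} [RCLike 𝕜]
  {H : Type*} [NormedAddCommGroup H] [InnerProductSpace 𝕜 H] [NormedSpace ℝ H] [CompleteSpace H]
  {E : ℝ → ℝ → H →L[𝕜] H} {T : ℝ} {p h : ℝ → H}

/-- The integrand is weakly continuous, hence measurable by Pettis' theorem. -/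
theorem integrableOn_adjoint_apply (hE : IsEvolutionFamily E) {s : ℝ} (hs : 0 ≤ s) (hsT : s ≤ T)
    (hh : ContinuousOn h (Icc s T)) :
    IntegrableOn (fun τ => ContinuousLinearMap.adjoint (E τ s) (h τ)) (Ioc s T) := by
  have hw : ∀ x, ContinuousOn (fun τ => ⟪ContinuousLinearMap.adjoint (E τ s) (h τ), x⟫_𝕜)
      (Icc s T) := fun x => by
    simp only [ContinuousLinearMap.adjoint_inner_left]
    exact hh.inner ((hE.continuousOn_left hs x).mono fun _ ht => ht.1)
  obtain ⟨M, -, hM⟩ := exists_norm_le_of_weakOn hw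
  have : IntegrableOn (fun τ => ContinuousLinearMap.adjoint (E τ s) (h τ)) (Icc s T) := by
    refine (integrable_const M).mono' (aestronglyMeasurable_of_weakOn hsT hw) ?_
    filter_upwards [ae_restrict_mem measurableSet_Icc] with τ hτ using hM τ hτ
  exact this.mono_set Ioc_subset_Icc_self

theorem inner_integral_adjoint (hE : IsEvolutionFamily E) {s : ℝ} (hs : 0 ≤ s) (hsT : s ≤ T)
    (hh : ContinuousOn h (Icc s T)) (x : H) :
    ⟪∫ τ in s..T, ContinuousLinearMap.adjoint (E τ s) (h τ), x⟫_𝕜 =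
      ∫ τ in s..T, ⟪h τ, E τ s x⟫_𝕜 := by
  rw [← inner_conj_symm, intervalIntegral.integral_of_le hsT, intervalIntegral.integral_of_le hsT,
    ← integral_inner (integrableOn_adjoint_apply hE hs hsT hh), ← integral_conj]
  simp only [inner_conj_symm, ContinuousLinearMap.adjoint_inner_left]

/-- For a continuous source the weak form of the adjoint equation is equivalent to the one with a
Bochner integral. -/
theorem isWeakAdjoint_iff (hE : IsEvolutionFamily E) (hh : ContinuousOn h (Icc 0 T)) :
    IsWeakAdjoint E 0 T p h ↔ ∀ t ∈ Icc (0 : ℝ) T, p t = ContinuousLinearMap.adjoint (E T t) (p T) +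
      ∫ τ in t..T, ContinuousLinearMap.adjoint (E τ t) (h τ) := by
  constructor
  · intro hp t ht
    refine ext_inner_right 𝕜 fun x => ?_
    rw [hp t T ht.1 ht.2 le_rfl, inner_add_left, ContinuousLinearMap.adjoint_inner_left,
      inner_integral_adjoint hE ht.1 ht.2 (hh.mono (Icc_subset_Icc_left ht.1))]
  · intro hp
    refine IsWeakAdjoint.of_terminal hE le_rfl (hh.integrableOn_Icc.mono_set Ioc_subset_Icc_self)
      fun t ht x => ?_
    rw [hp t ht, inner_add_left, ContinuousLinearMap.adjoint_inner_left,
      inner_integral_adjoint hE ht.1 ht.2 (hh.mono (Icc_subset_Icc_left ht.1))]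

/-- A weakly continuous `p` gives a weakly continuous, hence square integrable, `B* p`. -/
theorem memLp_adjoint_apply {U : Type*} [NormedAddCommGroup U] [InnerProductSpace 𝕜 U]
    [CompleteSpace U] {B : ℝ → U →L[𝕜] H} (hB : ∀ v, Continuous fun t => B t v) (hT : 0 ≤ T)
    (hp : ∀ x, ContinuousOn (fun t => ⟪p t, x⟫_𝕜) (Icc 0 T)) :
    MemLp (fun t => ContinuousLinearMap.adjoint (B t) (p t)) 2 (volume.restrict (Ioc 0 T)) := by
  obtain ⟨M, hM0, hM⟩ := exists_norm_le_of_weakOn hp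
  have hpm : ∀ v, ContinuousOn (fun t => ⟪ContinuousLinearMap.adjoint (B t) (p t), v⟫_𝕜)
      (Icc 0 T) := by
    intro v t₀ ht₀
    simp only [ContinuousLinearMap.adjoint_inner_left]
    -- `⟪p(t), B(t) v⟫ = ⟪p(t), B(t₀) v⟫ + ⟪p(t), B(t) v - B(t₀) v⟫` with `p` bounded
    have h1 : Tendsto (fun t => ⟪p t, B t v - B t₀ v⟫_𝕜) (𝓝[Icc 0 T] t₀) (𝓝 0) := by
      have h2 : Tendsto (fun t => M * ‖B t v - B t₀ v‖) (𝓝[Icc 0 T] t₀) (𝓝 0) := by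
        have : Continuous fun t => M * ‖B t v - B t₀ v‖ :=
          continuous_const.mul ((hB v).sub continuous_const).norm
        simpa using (this.tendsto t₀).mono_left nhdsWithin_le_nhds
      refine squeeze_zero_norm' ?_ h2
      filter_upwards [self_mem_nhdsWithin] with t ht
      exact (norm_inner_le_norm _ _).trans (by gcongr; exact hM t ht)
    have h3 := (hp (B t₀ v) t₀ ht₀).tendsto.add h1
    rw [add_zero] at h3
    refine h3.congr fun t => ?_
    rw [← inner_add_right]
    congr 1
    abel
  obtain ⟨N, hN0, hN⟩ := exists_norm_le_of_weakOn hpm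
  refine MemLp.of_bound ((aestronglyMeasurable_of_weakOn hT hpm).mono_measure
    (Measure.restrict_mono Ioc_subset_Icc_self le_rfl)) N ?_
  filter_upwards [ae_restrict_mem measurableSet_Ioc] with t ht
  exact hN t (Ioc_subset_Icc_self ht)

end Adjoint

/-! ### The data of the control problem -/

namespace PeriodicLQ

variable {𝕜 : Type*} [RCLike 𝕜]
  {H : Type*} [NormedAddCommGroup H] [InnerProductSpace 𝕜 H] [NormedSpace ℝ H] [CompleteSpace H]
  {U : Type*} [NormedAddCommGroup U] [InnerProductSpace 𝕜 U] [CompleteSpace U]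
  (S : PeriodicLQ 𝕜 H U) {T : ℝ} {y p : ℝ → H}

theorem isEvolutionFamily : IsEvolutionFamily S.E := S.generates.toIsEvolutionFamily

/-- By coercivity (Lax-Milgram); hence `(S.Q t).inverse` is a genuine inverse. -/
theorem isUnit_Q (t : ℝ) : IsUnit (S.Q t) := by
  obtain ⟨ε, hε, h⟩ := S.Q_coercive
  refine ContinuousLinearMap.isUnit_of_forall_le_norm_inner_map _ (c := ⟨ε, hε.le⟩) hε fun x => ?_
  refine le_trans ?_ ((h t x).trans (RCLike.re_le_norm _))
  rw [mul_comm]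
  rfl

theorem Q_apply_inverse (t : ℝ) (v : U) : S.Q t ((S.Q t).inverse v) = v := by
  rw [← ContinuousLinearMap.ringInverse_eq_inverse, ← mul_apply_eq_comp,
    Ring.mul_inverse_cancel _ (S.isUnit_Q t)]
  rfl

theorem inverse_Q_apply (t : ℝ) (v : U) : (S.Q t).inverse (S.Q t v) = v := by
  rw [← ContinuousLinearMap.ringInverse_eq_inverse, ← mul_apply_eq_comp,
    Ring.inverse_mul_cancel _ (S.isUnit_Q t)]
  rfl

theorem exists_inverse_Q_norm_le : ∃ c, 0 < c ∧ ∀ t v, ‖(S.Q t).inverse v‖ ≤ c * ‖v‖ := by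
  obtain ⟨ε, hε, h⟩ := S.Q_coercive
  refine ⟨ε⁻¹, inv_pos.2 hε, fun t v => ?_⟩
  set w := (S.Q t).inverse v with hw
  have h1 := (h t w).trans ((RCLike.re_le_norm _).trans (norm_inner_le_norm _ _))
  rw [hw, S.Q_apply_inverse, ← hw] at h1
  rw [inv_mul_eq_div, le_div_iff₀ hε]
  rcases (norm_nonneg w).eq_or_lt with h0 | h0
  · rw [← h0]; simp
  · nlinarith

/-- The inverses are strongly continuous, since `Q(t)⁻¹ v - Q(t₀)⁻¹ v = Q(t)⁻¹ (v - Q(t) Q(t₀)⁻¹ v)`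
and the `Q(t)⁻¹` are uniformly bounded. -/
theorem continuous_inverse_Q (v : U) : Continuous fun t => (S.Q t).inverse v := by
  obtain ⟨c, hc0, hc⟩ := S.exists_inverse_Q_norm_le
  rw [continuous_iff_continuousAt]
  intro t₀
  rw [ContinuousAt, tendsto_iff_norm_sub_tendsto_zero]
  have h1 : Tendsto (fun t => c * ‖v - S.Q t ((S.Q t₀).inverse v)‖) (𝓝 t₀) (𝓝 0) := by
    have : Continuous fun t => c * ‖v - S.Q t ((S.Q t₀).inverse v)‖ :=
      continuous_const.mul (continuous_const.sub (S.Q_cont _)).norm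
    simpa [S.Q_apply_inverse] using this.tendsto t₀
  refine squeeze_zero (fun _ => norm_nonneg _) (fun t => ?_) h1
  have h2 := hc t (v - S.Q t ((S.Q t₀).inverse v))
  rwa [map_sub, S.inverse_Q_apply] at h2

/-- The source term `C* C (y - y_d)` of the adjoint equation. -/
def source (y : ℝ → H) (t : ℝ) : H :=
  ContinuousLinearMap.adjoint (S.C t) (S.C t (y t - S.yd t))

theorem adjoint_C (t : ℝ) : ContinuousLinearMap.adjoint (S.C t) = S.C t :=
  (S.C_pos t).isSelfAdjoint.adjoint_eq

theorem continuousOn_source {s : Set ℝ} (hy : ContinuousOn y s) :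
    ContinuousOn (S.source y) s := by
  unfold source
  simp only [adjoint_C]
  exact continuousOn_strong_apply S.C_cont
    (continuousOn_strong_apply S.C_cont (hy.sub S.yd_cont.continuousOn))

theorem integrableOn_source (hy : ContinuousOn y (Icc 0 T)) :
    IntegrableOn (S.source y) (Ioc 0 T) :=
  (S.continuousOn_source hy).integrableOn_Icc.mono_set Ioc_subset_Icc_self

theorem isAdjointState_iff (hy : ContinuousOn y (Icc 0 T)) :
    S.IsAdjointState T y p ↔ IsWeakAdjoint S.E 0 T p (S.source y) :=
  (isWeakAdjoint_iff S.isEvolutionFamily (S.continuousOn_source hy)).symm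

theorem memLp_adjointControl (hT : 0 ≤ T)
    (hp : ∀ x, ContinuousOn (fun t => ⟪p t, x⟫_𝕜) (Icc 0 T)) :
    MemLp (S.adjointControl p) 2 (volume.restrict (Ioc 0 T)) :=
  (memLp_strong_apply S.continuous_inverse_Q (memLp_adjoint_apply S.B_cont hT hp)).neg

theorem adjoint_B_apply (t : ℝ) :
    ContinuousLinearMap.adjoint (S.B t) (p t) = -S.Q t (S.adjointControl p t) := by
  rw [adjointControl, map_neg, neg_neg, Q_apply_inverse]

end PeriodicLQ

/-! ### Existence of extremals -/

namespace PeriodicLQ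

variable {𝕜 : Type*} [RCLike 𝕜]
  {H : Type*} [NormedAddCommGroup H] [InnerProductSpace 𝕜 H] [NormedSpace ℝ H] [CompleteSpace H]
  {U : Type*} [NormedAddCommGroup U] [InnerProductSpace 𝕜 U] [CompleteSpace U]
  (S : PeriodicLQ 𝕜 H U) {T : ℝ} {y p : ℝ → H}

/-- `(y, p)` is an extremal on `[0, T]`: `y` is the trajectory of the control `-Q⁻¹ B* p` and `p`
is an adjoint state of `y`, in the weak form of the adjoint equation. -/
structure IsExtremal (T : ℝ) (y p : ℝ → H) : Prop where
  cont : ContinuousOn y (Icc 0 T)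
  mild : IsMild S.E 0 T y fun t => S.B t (S.adjointControl p t)
  adjoint : IsWeakAdjoint S.E 0 T p (S.source y)

theorem continuous_comp_apply {G₁ G₂ G₃ : Type*} [NormedAddCommGroup G₁] [NormedSpace 𝕜 G₁]
    [NormedAddCommGroup G₂] [NormedSpace 𝕜 G₂] [CompleteSpace G₂]
    [NormedAddCommGroup G₃] [NormedSpace 𝕜 G₃] {P : ℝ → G₂ →L[𝕜] G₃} {K : ℝ → G₁ →L[𝕜] G₂}
    (hP : ∀ x, Continuous fun t => P t x) (hK : ∀ x, Continuous fun t => K t x) (x : G₁) :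
    Continuous fun t => (P t).comp (K t) x :=
  (continuous_apply_of_strong hP).comp (continuous_id.prodMk (hK x))

/-- Coercivity of `Q` on `L²(0, T; U)`. -/
theorem re_inner_coercive {Φ : Lp U 2 (volume.restrict (Ioc 0 T)) →L[𝕜]
      Lp U 2 (volume.restrict (Ioc 0 T))}
    (hΦ : ∀ v, Φ v =ᵐ[volume.restrict (Ioc 0 T)] fun t => S.Q t (v t)) {ε : ℝ}
    (h : ∀ t v, ε * ‖v‖ ^ 2 ≤ RCLike.re ⟪S.Q t v, v⟫_𝕜) (v : Lp U 2 (volume.restrict (Ioc 0 T))) :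
    ε * ‖v‖ ^ 2 ≤ RCLike.re ⟪Φ v, v⟫_𝕜 := by
  rw [← inner_self_eq_norm_sq (𝕜 := 𝕜), L2.inner_def, L2.inner_def, ← integral_re
    (L2.integrable_inner _ _), ← integral_re (L2.integrable_inner _ _), ← integral_const_mul]
  refine integral_mono_ae ((L2.integrable_inner v v).re.const_mul ε)
    (L2.integrable_inner (Φ v) v).re ?_
  filter_upwards [hΦ v] with t ht
  simp only [ht, inner_self_eq_norm_sq]
  exact h t _

/-- Existence of an extremal with the boundary conditions `y(0) = κ y(T) + a`, `p(T) = κ p(0)`.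
The trajectories with `y(0) = κ y(T) + a` are parametrized by the free part `w = u - K₁ y` of the
control; detectability makes the quadratic cost coercive in `w`, and the normal equation of the
minimization problem yields the adjoint state. -/
theorem exists_extremal (hT : 0 < T) {κ : 𝕜} (hκ : starRingEnd 𝕜 κ = κ) (a : H)
    {K₁ : ℝ → H →L[𝕜] U} (hK₁ : ∀ x, Continuous fun t => K₁ t x)
    {K₂ : ℝ → H →L[𝕜] H} (hK₂ : ∀ x, Continuous fun t => K₂ t x) {V₁ V₂ : ℝ → ℝ → H →L[𝕜] H}
    (hV₁ : IsPerturbedEvolution S.E (fun t => (S.B t).comp (K₁ t)) V₁)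
    (hV₂ : IsPerturbedEvolution S.E (fun t => (K₂ t).comp (S.C t)) V₂)
    (hu₁ : IsUnit (1 - κ • V₁ T 0)) (hu₂ : IsUnit (1 - κ • V₂ T 0)) :
    ∃ y p, S.IsExtremal T y p ∧ y 0 = κ • y T + a ∧ p T = κ • p 0 := by
  have hE := S.isEvolutionFamily
  have hF₁ := continuous_comp_apply S.B_cont hK₁
  have hF₂ := continuous_comp_apply hK₂ S.C_cont
  set μ := volume.restrict (Ioc 0 T) with hμ
  have hLi : ∀ g : Lp H 2 μ, IntegrableOn g (Ioc 0 T) :=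
    fun g => (Lp.memLp g).integrable one_le_two
  obtain ⟨b, hb⟩ := exists_clm_strong S.B_cont T
  obtain ⟨C, hC⟩ := exists_clm_strong S.C_cont T
  obtain ⟨k₁, hk₁⟩ := exists_clm_strong hK₁ T
  obtain ⟨k₂, hk₂⟩ := exists_clm_strong hK₂ T
  obtain ⟨Q, hQ⟩ := exists_clm_strong S.Q_cont T
  obtain ⟨Φ₁, hΦ₁⟩ := exists_clm_bvp hV₁.1 hT.le κ
  obtain ⟨Φ₂, hΦ₂⟩ := exists_clm_bvp hV₂.1 hT.le κ
  obtain ⟨L, hL⟩ := exists_clm_initial hV₁.1 T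
  -- for `a = 0`: the state, the output and the control as functions of the free part `w`
  let Y := Φ₁.comp b
  let D := C.comp Y
  let N := ContinuousLinearMap.id 𝕜 (Lp U 2 μ) + k₁.comp Y
  -- the closed-loop trajectory as a trajectory of the detecting system
  have hY : ∀ w, Y w = Φ₂ (b (N w) - k₂ (D w)) := by
    intro w
    apply Lp.ext
    have m1 := isMild_bvpSolution (κ := κ) (a := 0) hV₁.1 (hLi (b w))
    have c1 := m1.continuousOn hV₁.1 le_rfl (hLi (b w))
    set z := bvpSolution V₁ T κ 0 (b w) with hz
    have hFz : IntegrableOn (fun r => (S.B r).comp (K₁ r) (z r)) (Ioc 0 T) :=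
      (continuousOn_strong_apply hF₁ c1).integrableOn_Icc.mono_set Ioc_subset_Icc_self
    have m2 := hV₁.isMild_of_isMild hE hF₁ le_rfl (hLi (b w)) m1
    have m3 := hV₂.isMild_perturbed hE hF₂ le_rfl (hFz.add (hLi (b w))) m2
    have e1 := m3.eq_bvpSolution (κ := κ) (a := 0) hT.le hu₂ (bvpSolution_boundary hV₁.1 hu₁)
    have hYz : Y w =ᵐ[μ] z := hΦ₁ (b w)
    have e2 : (fun r => ((fun r => (S.B r).comp (K₁ r) (z r)) + b w) r -
        (K₂ r).comp (S.C r) (z r)) =ᵐ[μ] (b (N w) - k₂ (D w) : Lp H 2 μ) := by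
      filter_upwards [Lp.coeFn_sub (b (N w)) (k₂ (D w)), hb (N w), hk₂ (D w), hC (Y w), hYz,
        Lp.coeFn_add w (k₁ (Y w)), hk₁ (Y w), hb w] with r h1 h2 h3 h4 h5 h6 h7 h8
      rw [h1, Pi.sub_apply, h2, h3]
      have h6' : (N w : ℝ → U) r = w r + K₁ r (z r) := by
        rw [← h5, ← h7]; exact h6
      have h4' : (D w : ℝ → H) r = S.C r (z r) := by rw [← h5]; exact h4
      rw [h6', h4', Pi.add_apply, h8, map_add]
      simp only [ContinuousLinearMap.comp_apply]
      abel
    filter_upwards [hYz, hΦ₂ (b (N w) - k₂ (D w)), ae_restrict_mem measurableSet_Ioc]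
      with t h1 h2 ht
    rw [h1, h2, e1 t (Ioc_subset_Icc_self ht)]
    exact bvpSolution_congr e2 t (Ioc_subset_Icc_self ht)
  obtain ⟨ε, hε, hco⟩ := S.Q_coercive
  -- `w` is recovered from the control and the output, whence coercivity
  have hP : ∀ w, w = (ContinuousLinearMap.id 𝕜 (Lp U 2 μ) - k₁.comp (Φ₂.comp b)) (N w) +
      (k₁.comp (Φ₂.comp k₂)) (D w) := by
    intro w
    have h1 := congrArg k₁ (hY w)
    simp only [map_sub] at h1
    have h2 : N w = w + k₁ (Y w) := rfl
    have h3 : k₁ (Y w) = N w - w := by rw [h2]; abel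
    rw [h3] at h1
    simp only [sub_apply, ContinuousLinearMap.comp_apply, ContinuousLinearMap.id_apply]
    rw [sub_eq_iff_eq_add] at h1
    exact (eq_sub_of_add_eq' h1.symm).trans (by abel)
  -- the part of the trajectory that does not depend on `w`
  have hz0 : IntegrableOn (fun _ => (0 : H)) (Ioc 0 T) := integrable_zero _ _ _
  have mo := isMild_bvpSolution (κ := κ) (a := a) hV₁.1 hz0
  have co := mo.continuousOn hV₁.1 le_rfl hz0
  set o := (memLp_of_continuousOn co).toLp with ho
  set d := (memLp_of_continuousOn (T := T) S.yd_cont.continuousOn).toLp with hd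
  obtain ⟨w, hw⟩ := exists_normal_equation hP hε (S.re_inner_coercive hQ hco)
    (C (o - d)) (k₁ o)
  have my := isMild_bvpSolution (κ := κ) (a := a) hV₁.1 (hLi (b w))
  have by0 := bvpSolution_boundary (κ := κ) (a := a) (g := b w) hV₁.1 hu₁
  have cy := my.continuousOn hV₁.1 le_rfl (hLi (b w))
  set y := bvpSolution V₁ T κ a (b w) with hy
  have hyL : (Y w + o : Lp H 2 μ) =ᵐ[μ] y := by
    filter_upwards [Lp.coeFn_add (Y w) o, hΦ₁ (b w),
      MemLp.coeFn_toLp (memLp_of_continuousOn co)] with t h1 h2 h3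
    rw [h1, Pi.add_apply, h3]
    change Φ₁ (b w) t + _ = _
    rw [h2]
    simp only [hy, bvpSolution, add_zero, map_zero, intervalIntegral.integral_zero, smul_zero,
      zero_add, map_add]
    abel
  set u : Lp U 2 μ := w + k₁ (Y w + o) with hu
  have hNu : N w + k₁ o = u := by
    rw [hu, map_add, ← add_assoc]; rfl
  have hDy : D w + C (o - d) = C (Y w + o - d) := by
    rw [add_sub_assoc, map_add]; rfl
  simp only [hNu, hDy] at hw
  -- the open-loop equation
  have hFy : IntegrableOn (fun r => (S.B r).comp (K₁ r) (y r)) (Ioc 0 T) :=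
    (continuousOn_strong_apply hF₁ cy).integrableOn_Icc.mono_set Ioc_subset_Icc_self
  have mE : IsMild S.E 0 T y (fun t => S.B t (u t)) := by
    refine (hV₁.isMild_of_isMild hE hF₁ le_rfl (hLi (b w)) my).congr_right ?_
    filter_upwards [hb w, Lp.coeFn_add w (k₁ (Y w + o)), hk₁ (Y w + o), hyL] with t h1 h2 h3 h4
    rw [h1, hu, h2, Pi.add_apply, h3, h4, map_add, add_comm]
    rfl
  -- `p₀` is the candidate for `p(0)`; the first variation of the cost in the direction of the free
  -- closed-loop trajectory of `ζ` determines its pairing with `ζ - κ V₁(T,0) ζ`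
  set J := Ring.inverse (1 - κ • V₁ T 0) with hJ
  set q := ContinuousLinearMap.adjoint (C.comp L) (C (Y w + o - d)) +
    ContinuousLinearMap.adjoint (k₁.comp L) (Q u) with hq
  have hqL : ∀ ζ, ⟪q, ζ⟫_𝕜 = ⟪C (Y w + o - d), C (L ζ)⟫_𝕜 + ⟪Q u, k₁ (L ζ)⟫_𝕜 := by
    intro ζ
    rw [hq, inner_add_left, ContinuousLinearMap.adjoint_inner_left,
      ContinuousLinearMap.adjoint_inner_left]
    rfl
  set p₀ := ContinuousLinearMap.adjoint J q with hp₀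
  have hp₀q : ∀ ζ, ⟪p₀, ζ - κ • V₁ T 0 ζ⟫_𝕜 = ⟪q, ζ⟫_𝕜 := by
    intro ζ
    rw [hp₀, ContinuousLinearMap.adjoint_inner_left]
    congr 1
    change (J * (1 - κ • V₁ T 0)) ζ = ζ
    rw [hJ, Ring.inverse_mul_cancel _ hu₁]
    rfl
  have ch := S.continuousOn_source cy
  have ih := S.integrableOn_source cy
  let p : ℝ → H := fun t => ContinuousLinearMap.adjoint (S.E T t) (κ • p₀) +
    ∫ τ in t..T, ContinuousLinearMap.adjoint (S.E τ t) (S.source y τ)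
  have hpT : p T = κ • p₀ := by
    simp [p, hE.refl T hT.le, ContinuousLinearMap.adjoint_id]
  have hpw : IsWeakAdjoint S.E 0 T p (S.source y) := by
    rw [isWeakAdjoint_iff hE ch]
    intro t _
    rw [hpT]
  clear_value p
  have hpc := fun x => hpw.continuousOn_inner hE le_rfl ih x
  set β := (memLp_adjoint_apply S.B_cont hT.le hpc).toLp with hβ
  have hβf := MemLp.coeFn_toLp (memLp_adjoint_apply S.B_cont hT.le hpc)
  -- the first variation of the cost along an arbitrary trajectory `z`, not necessarily with
  -- `z(0) = κ z(T)`: `ζ` measures the defect of the boundary condition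
  have key : ∀ (v : Lp U 2 μ) (z : ℝ → H), IsMild S.E 0 T z (fun t => S.B t (v t)) →
      ⟪p₀ - p 0, z 0⟫_𝕜 = ⟪β + Q u, v⟫_𝕜 := by
    intro v z mz
    have iv : IntegrableOn (fun t => S.B t (v t)) (Ioc 0 T) :=
      integrableOn_strong_apply S.B_cont ((Lp.memLp v).integrable one_le_two)
    have cz := mz.continuousOn hE le_rfl iv
    have hzL := MemLp.coeFn_toLp (memLp_of_continuousOn cz)
    set zL := (memLp_of_continuousOn cz).toLp with hzLdef
    have mz₁ := hV₁.isMild_perturbed hE hF₁ le_rfl iv mz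
    set w' : Lp U 2 μ := v - k₁ zL with hw'
    clear_value w'
    have mz₂ : IsMild V₁ 0 T z (b w') := by
      refine mz₁.congr_right ?_
      filter_upwards [hb w', Lp.coeFn_sub v (k₁ zL), hk₁ zL, hzL] with t h1 h2 h3 h4
      rw [h1, hw', h2, Pi.sub_apply, h3, h4, map_sub]
      rfl
    set ζ := z 0 - bvpSolution V₁ T κ 0 (b w') 0 with hζ
    have hzt : ∀ t ∈ Icc 0 T, z t = bvpSolution V₁ T κ 0 (b w') t + V₁ t 0 ζ := by
      intro t ht
      rw [mz₂ 0 t le_rfl ht.1 ht.2, isMild_bvpSolution hV₁.1 (hLi (b w')) 0 t le_rfl ht.1 ht.2,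
        hζ, map_sub]
      abel
    have hzsum : zL = Y w' + L ζ := by
      apply Lp.ext
      filter_upwards [hzL, Lp.coeFn_add (Y w') (L ζ), hΦ₁ (b w'), hL ζ,
        ae_restrict_mem measurableSet_Ioc] with t h1 h2 h3 h4 ht
      rw [h1, h2, Pi.add_apply, h4, hzt t (Ioc_subset_Icc_self ht), ← h3]
      rfl
    have hv : v = N w' + k₁ (L ζ) := by
      have : N w' = w' + k₁ (Y w') := rfl
      rw [this, add_assoc, ← map_add, ← hzsum, hw']
      abel
    have hb' : ζ - κ • V₁ T 0 ζ = z 0 - κ • z T := by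
      have h1 := bvpSolution_boundary (κ := κ) (a := 0) (g := b w') hV₁.1 hu₁
      rw [hzt T ⟨hT.le, le_rfl⟩, smul_add]
      rw [add_zero] at h1
      rw [← h1, hζ]
      abel
    have h1 : ⟪C (Y w + o - d), C zL⟫_𝕜 + ⟪Q u, v⟫_𝕜 = ⟪p₀, z 0 - κ • z T⟫_𝕜 := by
      rw [← hb', hp₀q, hqL, hzsum, hv, map_add, inner_add_right, inner_add_right]
      have := hw w'
      have h2 : C (Y w') = D w' := rfl
      rw [h2]
      linear_combination this
    obtain ⟨-, -, h2⟩ := mz.duality hE le_rfl hT.le iv ih hpw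
    have h3 : ∫ τ in (0 : ℝ)..T, ⟪S.source y τ, z τ⟫_𝕜 = ⟪C (Y w + o - d), C zL⟫_𝕜 := by
      rw [intervalIntegral.integral_of_le hT.le, L2.inner_def]
      refine integral_congr_ae ?_
      filter_upwards [hC (Y w + o - d), hC zL, Lp.coeFn_sub (Y w + o) d, hyL, hzL,
        MemLp.coeFn_toLp (memLp_of_continuousOn (T := T) S.yd_cont.continuousOn)]
        with t g1 g2 g3 g4 g5 g6
      rw [g1, g2, g3, Pi.sub_apply, g4, g5, g6, source, ContinuousLinearMap.adjoint_inner_left]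
    have h4 : ∫ τ in (0 : ℝ)..T, ⟪p τ, S.B τ (v τ)⟫_𝕜 = ⟪β, v⟫_𝕜 := by
      rw [intervalIntegral.integral_of_le hT.le, L2.inner_def]
      refine integral_congr_ae ?_
      filter_upwards [hβf] with t g1
      rw [g1, ContinuousLinearMap.adjoint_inner_left]
    rw [h3, h4, hpT, inner_smul_left, hκ] at h2
    rw [inner_sub_right, inner_smul_right] at h1
    rw [inner_sub_left, inner_add_left]
    linear_combination h2 - h1
  -- trajectories that start at `0` have arbitrary controls
  have hψ : β + Q u = 0 := by
    have iv : IntegrableOn (fun t => S.B t ((β + Q u : Lp U 2 μ) t)) (Ioc 0 T) :=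
      integrableOn_strong_apply S.B_cont ((Lp.memLp _).integrable one_le_two)
    have := key (β + Q u) (fun t => ∫ r in (0 : ℝ)..t, S.E t r (S.B r ((β + Q u : Lp U 2 μ) r)))
      (IsMild.of_initial hE le_rfl iv fun t _ => by simp)
    simp only [intervalIntegral.integral_same, inner_zero_right] at this
    exact inner_self_eq_zero.1 this.symm
  -- uncontrolled trajectories have arbitrary initial states
  have hp0 : p 0 = p₀ := by
    refine (sub_eq_zero.1 (ext_inner_right 𝕜 fun x => ?_)).symm
    have h1 : IsMild S.E 0 T (fun t => S.E t 0 x) fun t => S.B t ((0 : Lp U 2 μ) t) := by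
      have : IsMild S.E 0 T (fun t => S.E t 0 x) fun _ => 0 := by
        intro s t hs hst _
        simp only [map_zero, intervalIntegral.integral_zero, add_zero]
        rw [← hE.comp 0 s t le_rfl hs hst]
        rfl
      refine this.congr_right ?_
      filter_upwards [Lp.coeFn_zero U 2 μ] with t ht
      rw [ht, Pi.zero_apply, map_zero]
    have h2 := key 0 _ h1
    rw [inner_zero_right, hE.refl 0 le_rfl] at h2
    rw [inner_zero_left]
    exact h2
  refine ⟨y, p, ⟨cy, ?_, hpw⟩, by0, by rw [hpT, hp0]⟩
  refine mE.congr_right ?_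
  have h0 : ((β + Q u : Lp U 2 μ) : ℝ → U) =ᵐ[μ] 0 := by rw [hψ]; exact Lp.coeFn_zero U 2 μ
  filter_upwards [h0, Lp.coeFn_add β (Q u), hβf, hQ u] with t h1 h2 h3 h4
  rw [h2, Pi.add_apply, h3, h4, S.adjoint_B_apply, Pi.zero_apply, neg_add_eq_zero] at h1
  have := congrArg (S.Q t).inverse h1
  rw [S.inverse_Q_apply, S.inverse_Q_apply] at this
  rw [this]

end PeriodicLQ

/-! ### Optimality and uniqueness of extremals -/

theorem integrable_inner_of_memLp {𝕜 G α : Type*} [RCLike 𝕜] [MeasurableSpace α] {μ : Measure α}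
    [NormedAddCommGroup G] [InnerProductSpace 𝕜 G] {f g : α → G} (hf : MemLp f 2 μ)
    (hg : MemLp g 2 μ) : Integrable (fun t => ⟪f t, g t⟫_𝕜) μ := by
  refine (L2.integrable_inner (𝕜 := 𝕜) hf.toLp hg.toLp).congr ?_
  filter_upwards [hf.coeFn_toLp, hg.coeFn_toLp] with t h1 h2
  rw [h1, h2]

theorem restrict_Icc_eq_restrict_Ioc (a b : ℝ) :
    volume.restrict (Icc a b) = volume.restrict (Ioc a b) :=
  (Measure.restrict_congr_set Ioc_ae_eq_Icc).symm

theorem IsWeakAdjoint.sub {𝕜 : Type*} [RCLike 𝕜]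
    {H : Type*} [NormedAddCommGroup H] [InnerProductSpace 𝕜 H] [NormedSpace ℝ H] [CompleteSpace H]
    {E : ℝ → ℝ → H →L[𝕜] H} (hE : IsEvolutionFamily E) {a b : ℝ} (ha : 0 ≤ a)
    {p q h k : ℝ → H} (hh : IntegrableOn h (Ioc a b)) (hk : IntegrableOn k (Ioc a b))
    (hp : IsWeakAdjoint E a b p h) (hq : IsWeakAdjoint E a b q k) :
    IsWeakAdjoint E a b (fun t => p t - q t) (fun t => h t - k t) := by
  intro s t hs hst ht x
  have hsub : Ioc s t ⊆ Ioc a b := Ioc_subset_Ioc hs ht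
  simp only [inner_sub_left]
  rw [intervalIntegral.integral_sub, hp s t hs hst ht, hq s t hs hst ht]
  · ring
  · exact (intervalIntegrable_iff_integrableOn_Ioc_of_le hst).2
      (hE.integrableOn_inner (ha.trans hs) (hh.mono_set hsub) x)
  · exact (intervalIntegrable_iff_integrableOn_Ioc_of_le hst).2
      (hE.integrableOn_inner (ha.trans hs) (hk.mono_set hsub) x)

namespace PeriodicLQ

variable {𝕜 : Type*} [RCLike 𝕜]
  {H : Type*} [NormedAddCommGroup H] [InnerProductSpace 𝕜 H] [NormedSpace ℝ H] [CompleteSpace H]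
  {U : Type*} [NormedAddCommGroup U] [InnerProductSpace 𝕜 U] [CompleteSpace U]
  {S : PeriodicLQ 𝕜 H U} {T : ℝ} {y p z q : ℝ → H} {u v : ℝ → U}

theorem IsTrajectory.memLp (h : S.IsTrajectory T y u) :
    MemLp u 2 (volume.restrict (Ioc 0 T)) := by
  rw [← restrict_Icc_eq_restrict_Ioc]; exact h.2.1

theorem integrableOn_B_apply (h : MemLp u 2 (volume.restrict (Ioc 0 T))) :
    IntegrableOn (fun t => S.B t (u t)) (Ioc 0 T) :=
  integrableOn_strong_apply S.B_cont (h.integrable one_le_two)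

theorem IsTrajectory.isMild (h : S.IsTrajectory T y u) :
    IsMild S.E 0 T y fun t => S.B t (u t) :=
  IsMild.of_initial S.isEvolutionFamily le_rfl (integrableOn_B_apply h.memLp) h.2.2

namespace IsExtremal

theorem continuousOn_inner (h : S.IsExtremal T y p) (x : H) :
    ContinuousOn (fun t => ⟪p t, x⟫_𝕜) (Icc 0 T) :=
  h.adjoint.continuousOn_inner S.isEvolutionFamily le_rfl (S.integrableOn_source h.cont) x

theorem memLp (h : S.IsExtremal T y p) (hT : 0 ≤ T) :
    MemLp (S.adjointControl p) 2 (volume.restrict (Ioc 0 T)) :=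
  S.memLp_adjointControl hT h.continuousOn_inner

theorem isTrajectory (h : S.IsExtremal T y p) (hT : 0 ≤ T) :
    S.IsTrajectory T y (S.adjointControl p) :=
  ⟨h.cont, by rw [restrict_Icc_eq_restrict_Ioc]; exact h.memLp hT,
    fun t ht => h.mild 0 t le_rfl ht.1 ht.2⟩

end IsExtremal

/-- The cost is quadratic and, by duality, its first variation at an extremal reduces to boundary
terms, which cancel for admissible competitors. -/
theorem IsExtremal.cost_eq (h : S.IsExtremal T y p) (hT : 0 ≤ T) (hz : S.IsTrajectory T z v)
    (hb : ⟪p T, z T - y T⟫_𝕜 = ⟪p 0, z 0 - y 0⟫_𝕜) :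
    IntegrableOn (fun t => ‖S.C t (z t - y t)‖ ^ 2 + RCLike.re
      ⟪S.Q t (v t - S.adjointControl p t), v t - S.adjointControl p t⟫_𝕜) (Ioc 0 T) ∧
    S.cost T z v = S.cost T y (S.adjointControl p) +
      (1 / 2) * ∫ t in (0 : ℝ)..T, (‖S.C t (z t - y t)‖ ^ 2 + RCLike.re
        ⟪S.Q t (v t - S.adjointControl p t), v t - S.adjointControl p t⟫_𝕜) := by
  have hE := S.isEvolutionFamily
  set u := S.adjointControl p with hu
  have mu : MemLp u 2 (volume.restrict (Ioc 0 T)) := h.memLp hT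
  have mv := hz.memLp
  have ih := S.integrableOn_source h.cont
  have md : IsMild S.E 0 T (fun t => z t - y t) fun t => S.B t (v t - u t) :=
    (hz.isMild.sub hE le_rfl (integrableOn_B_apply mv) (integrableOn_B_apply mu) h.mild).congr_right
      (Eventually.of_forall fun t => by rw [map_sub])
  obtain ⟨i1, i2, hdual⟩ := md.duality hE le_rfl hT
    (integrableOn_B_apply (u := fun t => v t - u t) (mv.sub mu)) ih h.adjoint
  have hcC : ∀ w : ℝ → H, ContinuousOn w (Icc 0 T) →
      IntegrableOn (fun t => ‖S.C t (w t)‖ ^ 2) (Ioc 0 T) := fun w hw =>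
    (((continuousOn_strong_apply S.C_cont hw).norm.pow 2).integrableOn_Icc).mono_set
      Ioc_subset_Icc_self
  have hcQ : ∀ w : ℝ → U, MemLp w 2 (volume.restrict (Ioc 0 T)) →
      IntegrableOn (fun t => RCLike.re ⟪S.Q t (w t), w t⟫_𝕜) (Ioc 0 T) := fun w hw =>
    (integrable_inner_of_memLp (𝕜 := 𝕜) (memLp_strong_apply S.Q_cont hw) hw).re
  have j1 : IntegrableOn (fun t => ‖S.C t (y t - S.yd t)‖ ^ 2 + RCLike.re ⟪S.Q t (u t), u t⟫_𝕜)
      (Ioc 0 T) := (hcC _ (h.cont.sub S.yd_cont.continuousOn)).add (hcQ _ mu)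
  have j2 : IntegrableOn (fun t => ‖S.C t (z t - y t)‖ ^ 2 +
      RCLike.re ⟪S.Q t (v t - u t), v t - u t⟫_𝕜) (Ioc 0 T) :=
    (hcC _ (hz.1.sub h.cont)).add (hcQ _ (mv.sub mu))
  have j3 : IntegrableOn (fun t => RCLike.re ⟪S.source y t, z t - y t⟫_𝕜 -
      RCLike.re ⟪p t, S.B t (v t - u t)⟫_𝕜) (Ioc 0 T) := i1.re.sub i2.re
  refine ⟨j2, ?_⟩
  have hzero : ∫ t in (0 : ℝ)..T, (RCLike.re ⟪S.source y t, z t - y t⟫_𝕜 -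
      RCLike.re ⟪p t, S.B t (v t - u t)⟫_𝕜) = 0 := by
    rw [intervalIntegral.integral_of_le hT, intervalIntegral.integral_of_le hT, hb,
      add_right_inj] at hdual
    rw [intervalIntegral.integral_of_le hT, integral_sub i1.re i2.re, integral_re i1,
      integral_re i2, hdual, sub_self]
  have hpt : ∀ t, ‖S.C t (z t - S.yd t)‖ ^ 2 + RCLike.re ⟪S.Q t (v t), v t⟫_𝕜 =
      (‖S.C t (y t - S.yd t)‖ ^ 2 + RCLike.re ⟪S.Q t (u t), u t⟫_𝕜) +
      (‖S.C t (z t - y t)‖ ^ 2 + RCLike.re ⟪S.Q t (v t - u t), v t - u t⟫_𝕜) +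
      2 * (RCLike.re ⟪S.source y t, z t - y t⟫_𝕜 - RCLike.re ⟪p t, S.B t (v t - u t)⟫_𝕜) := by
    intro t
    have e1 : S.C t (z t - S.yd t) = S.C t (y t - S.yd t) + S.C t (z t - y t) := by
      rw [← map_add]; congr 1; abel
    have e2 : ⟪p t, S.B t (v t - u t)⟫_𝕜 = -⟪S.Q t (u t), v t - u t⟫_𝕜 := by
      rw [← ContinuousLinearMap.adjoint_inner_left, S.adjoint_B_apply, inner_neg_left]
    have e3 : ⟪S.Q t (v t - u t), u t⟫_𝕜 = ⟪v t - u t, S.Q t (u t)⟫_𝕜 :=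
      (S.Q_pos t).isSymmetric _ _
    have e4 : RCLike.re ⟪v t - u t, S.Q t (u t)⟫_𝕜 = RCLike.re ⟪S.Q t (u t), v t - u t⟫_𝕜 :=
      inner_re_symm _ _
    have e5 : RCLike.re ⟪S.Q t (v t), v t⟫_𝕜 = RCLike.re ⟪S.Q t (u t), u t⟫_𝕜 +
        RCLike.re ⟪S.Q t (v t - u t), v t - u t⟫_𝕜 +
        2 * RCLike.re ⟪S.Q t (u t), v t - u t⟫_𝕜 := by
      have : v t = u t + (v t - u t) := by abel
      conv_lhs => rw [this]
      rw [map_add, inner_add_left, inner_add_right, inner_add_right, map_add, map_add, map_add, e3,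
        e4]
      ring
    rw [e1, norm_add_sq (𝕜 := 𝕜), e2, e5, source, ContinuousLinearMap.adjoint_inner_left, map_neg]
    ring
  rw [cost, cost]
  simp only [hpt]
  rw [intervalIntegral.integral_add, intervalIntegral.integral_add,
    intervalIntegral.integral_const_mul, hzero]
  · ring
  · exact intervalIntegrable_sub j1 le_rfl hT le_rfl
  · exact intervalIntegrable_sub j2 le_rfl hT le_rfl
  · exact intervalIntegrable_sub (j1.add j2) le_rfl hT le_rfl
  · exact intervalIntegrable_sub (j3.const_mul 2) le_rfl hT le_rfl

theorem re_Q_nonneg (t : ℝ) (x : U) : 0 ≤ RCLike.re ⟪S.Q t x, x⟫_𝕜 :=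
  (S.Q_pos t).re_inner_nonneg_left x

theorem IsExtremal.cost_le (h : S.IsExtremal T y p) (hT : 0 ≤ T) (hz : S.IsTrajectory T z v)
    (hb : ⟪p T, z T - y T⟫_𝕜 = ⟪p 0, z 0 - y 0⟫_𝕜) :
    S.cost T y (S.adjointControl p) ≤ S.cost T z v := by
  rw [(h.cost_eq hT hz hb).2]
  have : 0 ≤ ∫ t in (0 : ℝ)..T, (‖S.C t (z t - y t)‖ ^ 2 + RCLike.re
        ⟪S.Q t (v t - S.adjointControl p t), v t - S.adjointControl p t⟫_𝕜) :=
    intervalIntegral.integral_nonneg hT fun t _ => add_nonneg (sq_nonneg _) (re_Q_nonneg _ _)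
  linarith

/-- A competitor that is not more expensive than the extremal coincides with it: the controls agree
by coercivity of `Q`, and the states agree by detectability. -/
theorem IsExtremal.eq_of_cost_le (h : S.IsExtremal T y p) (hT : 0 ≤ T)
    (hz : S.IsTrajectory T z v) {κ : 𝕜} (hκ : starRingEnd 𝕜 κ = κ) (hp : p T = κ • p 0)
    (hzy : z 0 - y 0 = κ • (z T - y T))
    {K : ℝ → H →L[𝕜] H} (hK : ∀ x, Continuous fun t => K t x) {V : ℝ → ℝ → H →L[𝕜] H}
    (hV : IsPerturbedEvolution S.E (fun t => (K t).comp (S.C t)) V)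
    (hu : IsUnit (1 - κ • V T 0)) (hle : S.cost T z v ≤ S.cost T y (S.adjointControl p)) :
    EqOn z y (Icc 0 T) ∧ v =ᵐ[volume.restrict (Icc 0 T)] S.adjointControl p := by
  have hE := S.isEvolutionFamily
  obtain ⟨j, he⟩ := h.cost_eq hT hz (by rw [hp, hzy, inner_smul_left, inner_smul_right, hκ])
  obtain ⟨ε, hε, hco⟩ := S.Q_coercive
  have h0 : ∫ t in Ioc 0 T, (‖S.C t (z t - y t)‖ ^ 2 + RCLike.re
      ⟪S.Q t (v t - S.adjointControl p t), v t - S.adjointControl p t⟫_𝕜) = 0 := by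
    rw [intervalIntegral.integral_of_le hT] at he
    refine le_antisymm (by linarith) ?_
    exact integral_nonneg fun t => add_nonneg (sq_nonneg _) (re_Q_nonneg _ _)
  have h1 := (setIntegral_eq_zero_iff_of_nonneg_ae
    (Eventually.of_forall fun t => add_nonneg (sq_nonneg _) (re_Q_nonneg _ _)) j).1 h0
  have hC : ∀ᵐ t ∂(volume.restrict (Ioc 0 T)), S.C t (z t - y t) = 0 := by
    filter_upwards [h1] with t ht
    have := re_Q_nonneg (S := S) t (v t - S.adjointControl p t)
    have h2 : ‖S.C t (z t - y t)‖ ^ 2 = 0 :=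
      le_antisymm (by simp only [Pi.zero_apply] at ht; linarith) (sq_nonneg _)
    exact norm_eq_zero.1 (pow_eq_zero_iff two_ne_zero |>.1 h2)
  have hv : v =ᵐ[volume.restrict (Ioc 0 T)] S.adjointControl p := by
    filter_upwards [h1] with t ht
    have h2 := hco t (v t - S.adjointControl p t)
    have h3 := sq_nonneg ‖S.C t (z t - y t)‖
    simp only [Pi.zero_apply] at ht
    have h4 : ‖v t - S.adjointControl p t‖ ^ 2 = 0 :=
      le_antisymm (by nlinarith) (sq_nonneg _)
    exact sub_eq_zero.1 (norm_eq_zero.1 (pow_eq_zero_iff two_ne_zero |>.1 h4))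
  refine ⟨?_, by rw [restrict_Icc_eq_restrict_Ioc]; exact hv⟩
  have mu := h.memLp hT
  have iz : IntegrableOn (fun _ => (0 : H)) (Ioc 0 T) := integrable_zero _ _ _
  have md : IsMild S.E 0 T (fun t => z t - y t) fun _ => 0 := by
    refine (hz.isMild.sub hE le_rfl (integrableOn_B_apply hz.memLp) (integrableOn_B_apply mu)
      h.mild).congr_right ?_
    filter_upwards [hv] with t ht
    rw [ht, sub_self]
  have md' : IsMild V 0 T (fun t => z t - y t) fun _ => 0 := by
    refine (hV.isMild_perturbed hE (continuous_comp_apply hK S.C_cont) le_rfl iz md).congr_right ?_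
    filter_upwards [hC] with t ht
    rw [ContinuousLinearMap.comp_apply, ht, map_zero, sub_zero]
  have hs := md'.eq_bvpSolution (κ := κ) (a := 0) hT hu (by rw [add_zero]; exact hzy)
  intro t ht
  refine sub_eq_zero.1 ((hs t ht).trans ?_)
  simp [bvpSolution]

/-- The adjoint state of an extremal is unique: by stabilizability, the adjoint system observed
through `B*` has no unobservable solutions. -/
theorem IsExtremal.adjoint_unique (h : S.IsExtremal T y p) (hT : 0 ≤ T)
    (hq : IsWeakAdjoint S.E 0 T q (S.source y))
    (hpq : S.adjointControl p =ᵐ[volume.restrict (Ioc 0 T)] S.adjointControl q)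
    {κ : 𝕜} (hκ : starRingEnd 𝕜 κ = κ) (hp : p T = κ • p 0) (hq' : q T = κ • q 0)
    {K : ℝ → H →L[𝕜] U} (hK : ∀ x, Continuous fun t => K t x) {V : ℝ → ℝ → H →L[𝕜] H}
    (hV : IsPerturbedEvolution S.E (fun t => (S.B t).comp (K t)) V)
    (hu : IsUnit (1 - κ • V T 0)) : EqOn p q (Icc 0 T) := by
  have hE := S.isEvolutionFamily
  have ih := S.integrableOn_source h.cont
  have hF := continuous_comp_apply S.B_cont hK
  have iz : IntegrableOn (fun _ => (0 : H)) (Ioc 0 T) := integrable_zero _ _ _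
  have hd : IsWeakAdjoint S.E 0 T (fun t => p t - q t) fun _ => 0 := by
    have := IsWeakAdjoint.sub hE le_rfl ih ih h.adjoint hq
    simpa only [sub_self] using this
  have hdT : p T - q T = κ • (p 0 - q 0) := by rw [hp, hq', smul_sub]
  have hd0 : p 0 - q 0 = 0 := by
    have key : ∀ x, ⟪p 0 - q 0, (1 - κ • V T 0) x⟫_𝕜 = 0 := by
      intro x
      have mx := hV.isMild_homogeneous (b := T) le_rfl x
      have cx := mx.continuousOn hV.1 le_rfl iz
      have mE : IsMild S.E 0 T (fun t => V t 0 x) fun t => (S.B t).comp (K t) (V t 0 x) := by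
        simpa only [add_zero] using hV.isMild_of_isMild hE hF le_rfl iz mx
      obtain ⟨-, -, h2⟩ := mE.duality hE le_rfl hT
        ((continuousOn_strong_apply hF cx).integrableOn_Icc.mono_set Ioc_subset_Icc_self) iz hd
      have h3 : ∫ τ in (0 : ℝ)..T, ⟪p τ - q τ, (S.B τ).comp (K τ) (V τ 0 x)⟫_𝕜 = 0 := by
        rw [intervalIntegral.integral_of_le hT]
        refine integral_eq_zero_of_ae ?_
        filter_upwards [hpq] with t ht
        have h4 : ContinuousLinearMap.adjoint (S.B t) (p t - q t) = 0 := by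
          rw [map_sub, S.adjoint_B_apply, S.adjoint_B_apply, ht, sub_self]
        rw [ContinuousLinearMap.comp_apply, ← ContinuousLinearMap.adjoint_inner_left, h4,
          inner_zero_left, Pi.zero_apply]
      rw [h3] at h2
      simp only [inner_zero_left, intervalIntegral.integral_zero, add_zero] at h2
      rw [hdT, inner_smul_left, hκ, hV.1.refl 0 le_rfl] at h2
      rw [sub_apply, smul_apply, inner_sub_right, inner_smul_right, h2]
      exact sub_self _
    obtain ⟨x, hx⟩ := (ContinuousLinearMap.isUnit_iff_bijective.1 hu).2 (p 0 - q 0)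
    have := key x
    rw [hx] at this
    exact inner_self_eq_zero.1 this
  rw [hd0, smul_zero] at hdT
  intro t ht
  refine sub_eq_zero.1 (ext_inner_right 𝕜 fun x => ?_)
  rw [hd t T ht.1 ht.2 le_rfl x]
  simp [hdT]

end PeriodicLQ

/-! ### Real-variable estimates -/

/-- The Cauchy-Schwarz inequality with weight `k`. -/
theorem sq_integral_mul_le {α : Type*} [MeasurableSpace α] {μ : Measure α} {k γ : α → ℝ}
    (hk : ∀ᵐ r ∂μ, 0 ≤ k r) (h0 : Integrable k μ) (h1 : Integrable (fun r => k r * γ r) μ)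
    (h2 : Integrable (fun r => k r * γ r ^ 2) μ) :
    (∫ r, k r * γ r ∂μ) ^ 2 ≤ (∫ r, k r ∂μ) * ∫ r, k r * γ r ^ 2 ∂μ := by
  have h : ∀ m : ℝ, 0 ≤ (∫ r, k r ∂μ) * (m * m) + (-2 * ∫ r, k r * γ r ∂μ) * m +
      ∫ r, k r * γ r ^ 2 ∂μ := by
    intro m
    have e : ∫ r, k r * (γ r - m) ^ 2 ∂μ = (∫ r, k r ∂μ) * (m * m) +
        (-2 * ∫ r, k r * γ r ∂μ) * m + ∫ r, k r * γ r ^ 2 ∂μ := by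
      have : ∀ r, k r * (γ r - m) ^ 2 = (k r * (m * m) + (k r * γ r) * (-2 * m)) +
          k r * γ r ^ 2 := fun r => by ring
      simp only [this]
      have h01 : Integrable (fun r => k r * (m * m) + k r * γ r * (-2 * m)) μ :=
        (h0.mul_const _).add (h1.mul_const _)
      rw [integral_add h01 h2, integral_add (h0.mul_const _) (h1.mul_const _),
        integral_mul_const, integral_mul_const]
      ring
    rw [← e]
    refine integral_nonneg_of_ae ?_
    filter_upwards [hk] with r hr
    exact mul_nonneg hr (sq_nonneg _)
  have := discrim_le_zero h
  rw [discrim] at this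
  nlinarith

/-- The two-sided exponential kernel. -/
def expKernel (ρ τ r : ℝ) : ℝ := Real.exp (-ρ * |τ - r|)

theorem expKernel_pos (ρ τ r : ℝ) : 0 < expKernel ρ τ r := Real.exp_pos _

theorem expKernel_comm (ρ τ r : ℝ) : expKernel ρ τ r = expKernel ρ r τ := by
  rw [expKernel, expKernel, abs_sub_comm]

theorem expKernel_le_one {ρ : ℝ} (hρ : 0 ≤ ρ) (τ r : ℝ) : expKernel ρ τ r ≤ 1 :=
  Real.exp_le_one_iff.2 (by have := mul_nonneg hρ (abs_nonneg (τ - r)); linarith)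

theorem continuous_expKernel (ρ : ℝ) : Continuous fun q : ℝ × ℝ => expKernel ρ q.1 q.2 := by
  unfold expKernel
  fun_prop

theorem continuous_expKernel_right (ρ τ : ℝ) : Continuous (expKernel ρ τ) := by
  unfold expKernel
  fun_prop

theorem integral_expKernel_le {ρ s t τ : ℝ} (hρ : 0 < ρ) (hτ : τ ∈ Icc s t) :
    ∫ r in s..t, expKernel ρ τ r ≤ 2 / ρ := by
  have hi : ∀ a b, IntervalIntegrable (expKernel ρ τ) volume a b := fun a b =>
    (continuous_expKernel_right ρ τ).intervalIntegrable a b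
  rw [← intervalIntegral.integral_add_adjacent_intervals (hi s τ) (hi τ t)]
  have h1 : ∫ r in s..τ, expKernel ρ τ r = (1 - Real.exp (-ρ * (τ - s))) / ρ := by
    have : ∀ r ∈ uIcc s τ, HasDerivAt (fun r => Real.exp (-ρ * (τ - r)) / ρ)
        (expKernel ρ τ r) r := by
      intro r hr
      rw [uIcc_of_le hτ.1] at hr
      have h2 : HasDerivAt (fun r => -ρ * (τ - r)) ρ r := by
        simpa using ((hasDerivAt_id r).const_sub τ).const_mul (-ρ)
      have h3 := h2.exp.div_const ρ
      rw [mul_div_assoc, div_self hρ.ne', mul_one] at h3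
      rwa [expKernel, abs_of_nonneg (by linarith [hr.2])]
    rw [intervalIntegral.integral_eq_sub_of_hasDerivAt this (hi s τ)]
    simp only [sub_self, mul_zero, Real.exp_zero]
    ring
  have h2 : ∫ r in τ..t, expKernel ρ τ r = (1 - Real.exp (-ρ * (t - τ))) / ρ := by
    have : ∀ r ∈ uIcc τ t, HasDerivAt (fun r => -(Real.exp (-ρ * (r - τ)) / ρ))
        (expKernel ρ τ r) r := by
      intro r hr
      rw [uIcc_of_le hτ.2] at hr
      have h2 : HasDerivAt (fun r => -ρ * (r - τ)) (-ρ) r := by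
        simpa using ((hasDerivAt_id r).sub_const τ).const_mul (-ρ)
      have h3 := (h2.exp.div_const ρ).neg
      rw [mul_neg, neg_div, neg_neg, mul_div_assoc, div_self hρ.ne', mul_one] at h3
      rwa [expKernel, abs_of_nonpos (by linarith [hr.1]), neg_sub]
    rw [intervalIntegral.integral_eq_sub_of_hasDerivAt this (hi τ t)]
    simp only [sub_self, mul_zero, Real.exp_zero]
    ring
  rw [h1, h2, ← add_div]
  gcongr
  linarith [Real.exp_pos (-ρ * (τ - s)), Real.exp_pos (-ρ * (t - τ))]

/-- Young's inequality for the exponential kernel, in the form needed for functions bounded by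
decaying boundary contributions and a convolution. -/
theorem exists_young_bound (M N : ℝ) {ρ : ℝ} (hρ : 0 < ρ) :
    ∃ c, 0 < c ∧ ∀ (s t : ℝ) (f γ : ℝ → ℝ) (α β : ℝ), s ≤ t →
      AEStronglyMeasurable γ (volume.restrict (Ioc s t)) →
      IntegrableOn (fun r => γ r ^ 2) (Ioc s t) → (∀ τ ∈ Icc s t, 0 ≤ f τ) →
      (∀ τ ∈ Icc s t, f τ ≤ M * (expKernel ρ τ s * α + expKernel ρ τ t * β) +
        N * ∫ r in s..t, expKernel ρ τ r * γ r) →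
      (∀ τ ∈ Icc s t, f τ ^ 2 ≤ c * (α ^ 2 + β ^ 2 + ∫ r in s..t, γ r ^ 2)) ∧
        ∫ τ in s..t, f τ ^ 2 ≤ c * (α ^ 2 + β ^ 2 + ∫ r in s..t, γ r ^ 2) := by
  set c₁ := 3 * M ^ 2 + 3 * N ^ 2 * (2 / ρ) with hc₁
  have hc₁0 : 0 ≤ c₁ := by positivity
  refine ⟨(c₁ + 1) * (1 + 2 / ρ), by positivity, fun s t f γ α β hst hγ hγ2 hf0 hf => ?_⟩
  have hk0 : ∀ τ, IntegrableOn (expKernel ρ τ) (Ioc s t) := fun τ =>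
    ((continuous_expKernel_right ρ τ).continuousOn.integrableOn_Icc).mono_set Ioc_subset_Icc_self
  have hγ1 : IntegrableOn γ (Ioc s t) :=
    ((memLp_two_iff_integrable_sq hγ).2 hγ2).integrable one_le_two
  have hk1 : ∀ τ, IntegrableOn (fun r => expKernel ρ τ r * γ r) (Ioc s t) := fun τ =>
    hγ1.norm.mono' ((continuous_expKernel_right ρ τ).aestronglyMeasurable.mul hγ) <|
      Eventually.of_forall fun r => by
        rw [norm_mul, Real.norm_of_nonneg (expKernel_pos ρ τ r).le]
        exact mul_le_of_le_one_left (norm_nonneg _) (expKernel_le_one hρ.le τ r)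
  have hk2 : ∀ τ, IntegrableOn (fun r => expKernel ρ τ r * γ r ^ 2) (Ioc s t) := fun τ =>
    hγ2.mono' ((continuous_expKernel_right ρ τ).aestronglyMeasurable.mul hγ2.1) <|
      Eventually.of_forall fun r => by
        rw [norm_mul, Real.norm_of_nonneg (expKernel_pos ρ τ r).le,
          Real.norm_of_nonneg (sq_nonneg _)]
        exact mul_le_of_le_one_left (sq_nonneg _) (expKernel_le_one hρ.le τ r)
  set Γ := ∫ r in s..t, γ r ^ 2 with hΓ
  have hΓ0 : 0 ≤ Γ := intervalIntegral.integral_nonneg hst fun _ _ => sq_nonneg _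
  -- pointwise bound by a function whose integral is easy to estimate
  set g : ℝ → ℝ := fun τ => c₁ * (expKernel ρ τ s * α ^ 2 + expKernel ρ τ t * β ^ 2 +
    ∫ r in s..t, expKernel ρ τ r * γ r ^ 2) with hg
  have hfg : ∀ τ ∈ Icc s t, f τ ^ 2 ≤ g τ := by
    intro τ hτ
    have h1 := sq_integral_mul_le (μ := volume.restrict (Ioc s t))
      (Eventually.of_forall fun r => (expKernel_pos ρ τ r).le) (hk0 τ) (hk1 τ) (hk2 τ)
    rw [← intervalIntegral.integral_of_le hst, ← intervalIntegral.integral_of_le hst,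
      ← intervalIntegral.integral_of_le hst] at h1
    have hX0 : 0 ≤ ∫ r in s..t, expKernel ρ τ r * γ r ^ 2 :=
      intervalIntegral.integral_nonneg hst fun r _ => mul_nonneg (expKernel_pos ρ τ r).le
        (sq_nonneg _)
    have h2 : (∫ r in s..t, expKernel ρ τ r * γ r) ^ 2 ≤
        2 / ρ * ∫ r in s..t, expKernel ρ τ r * γ r ^ 2 :=
      h1.trans (mul_le_mul_of_nonneg_right (integral_expKernel_le hρ hτ) hX0)
    have sqle : ∀ e a : ℝ, 0 ≤ e → e ≤ 1 → (e * a) ^ 2 ≤ e * a ^ 2 := fun e a h0 h1 => by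
      nlinarith [mul_nonneg (mul_nonneg h0 (sub_nonneg.2 h1)) (sq_nonneg a)]
    have h3 := sqle _ α (expKernel_pos ρ τ s).le (expKernel_le_one hρ.le τ s)
    have h4 := sqle _ β (expKernel_pos ρ τ t).le (expKernel_le_one hρ.le τ t)
    set X := ∫ r in s..t, expKernel ρ τ r * γ r
    set Z := ∫ r in s..t, expKernel ρ τ r * γ r ^ 2
    set A := expKernel ρ τ s * α
    set B := expKernel ρ τ t * β
    have h5 : f τ ^ 2 ≤ (M * A + M * B + N * X) ^ 2 :=
      pow_le_pow_left₀ (hf0 τ hτ) (by have := hf τ hτ; linarith) 2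
    have h6 : (M * A + M * B + N * X) ^ 2 ≤ 3 * ((M * A) ^ 2 + (M * B) ^ 2 + (N * X) ^ 2) := by
      nlinarith [sq_nonneg (M * A - M * B), sq_nonneg (M * A - N * X), sq_nonneg (M * B - N * X)]
    have h7 : 3 * ((M * A) ^ 2 + (M * B) ^ 2 + (N * X) ^ 2) ≤
        3 * M ^ 2 * (expKernel ρ τ s * α ^ 2 + expKernel ρ τ t * β ^ 2) +
          3 * N ^ 2 * (2 / ρ) * Z := by
      have e1 : M ^ 2 * (A ^ 2 + B ^ 2) ≤
          M ^ 2 * (expKernel ρ τ s * α ^ 2 + expKernel ρ τ t * β ^ 2) := by gcongr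
      have e2 : N ^ 2 * X ^ 2 ≤ N ^ 2 * (2 / ρ * Z) := by gcongr
      nlinarith
    have hA0 : 0 ≤ expKernel ρ τ s * α ^ 2 + expKernel ρ τ t * β ^ 2 :=
      add_nonneg (mul_nonneg (expKernel_pos _ _ _).le (sq_nonneg _))
        (mul_nonneg (expKernel_pos _ _ _).le (sq_nonneg _))
    have h8 : 3 * M ^ 2 * (expKernel ρ τ s * α ^ 2 + expKernel ρ τ t * β ^ 2) ≤
        c₁ * (expKernel ρ τ s * α ^ 2 + expKernel ρ τ t * β ^ 2) := by
      gcongr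
      rw [hc₁]
      have : 0 ≤ 3 * N ^ 2 * (2 / ρ) := by positivity
      linarith
    have h9 : 3 * N ^ 2 * (2 / ρ) * Z ≤ c₁ * Z := by
      gcongr
      rw [hc₁]
      have : 0 ≤ 3 * M ^ 2 := by positivity
      linarith
    have : g τ = c₁ * (expKernel ρ τ s * α ^ 2 + expKernel ρ τ t * β ^ 2) + c₁ * Z := by
      simp only [hg]; ring
    linarith
  have hI : Integrable (Function.uncurry fun τ r => expKernel ρ τ r * γ r ^ 2)
      ((volume.restrict (Ioc s t)).prod (volume.restrict (Ioc s t))) := by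
    have hdom : Integrable (fun q : ℝ × ℝ => (1 : ℝ) * γ q.2 ^ 2)
        ((volume.restrict (Ioc s t)).prod (volume.restrict (Ioc s t))) :=
      (integrable_const (1 : ℝ)).mul_prod hγ2
    refine hdom.mono' ((continuous_expKernel ρ).aestronglyMeasurable.mul hγ2.1.comp_snd)
      (Eventually.of_forall fun q => ?_)
    simp only [Function.uncurry]
    rw [norm_mul, Real.norm_of_nonneg (expKernel_pos _ _ _).le, Real.norm_of_nonneg (sq_nonneg _)]
    gcongr
    exact expKernel_le_one hρ.le _ _
  have hJ : IntegrableOn (fun τ => ∫ r in s..t, expKernel ρ τ r * γ r ^ 2) (Ioc s t) := by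
    simp only [intervalIntegral.integral_of_le hst]
    exact hI.integral_prod_left
  have hs' : IntegrableOn (fun τ => expKernel ρ τ s * α ^ 2) (Ioc s t) := by
    simp only [expKernel_comm ρ _ s]
    exact (hk0 s).mul_const _
  have ht' : IntegrableOn (fun τ => expKernel ρ τ t * β ^ 2) (Ioc s t) := by
    simp only [expKernel_comm ρ _ t]
    exact (hk0 t).mul_const _
  have hgi : IntegrableOn g (Ioc s t) := ((hs'.add ht').add hJ).const_mul _
  have hρ2 : 0 ≤ 2 / ρ := by positivity
  constructor
  · intro τ hτ
    have hZ : ∫ r in s..t, expKernel ρ τ r * γ r ^ 2 ≤ Γ := by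
      refine intervalIntegral.integral_mono_on hst
        (intervalIntegrable_sub (hk2 τ) le_rfl hst le_rfl)
        (intervalIntegrable_sub hγ2 le_rfl hst le_rfl) fun r _ => ?_
      exact mul_le_of_le_one_left (sq_nonneg _) (expKernel_le_one hρ.le τ r)
    have h1 : expKernel ρ τ s * α ^ 2 ≤ α ^ 2 :=
      mul_le_of_le_one_left (sq_nonneg _) (expKernel_le_one hρ.le _ _)
    have h2 : expKernel ρ τ t * β ^ 2 ≤ β ^ 2 :=
      mul_le_of_le_one_left (sq_nonneg _) (expKernel_le_one hρ.le _ _)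
    calc f τ ^ 2 ≤ g τ := hfg τ hτ
      _ ≤ c₁ * (α ^ 2 + β ^ 2 + Γ) := by simp only [hg]; gcongr
      _ ≤ (c₁ + 1) * (1 + 2 / ρ) * (α ^ 2 + β ^ 2 + Γ) := by
          gcongr
          nlinarith
  · have h1 : ∫ τ in s..t, f τ ^ 2 ≤ ∫ τ in s..t, g τ := by
      rw [intervalIntegral.integral_of_le hst, intervalIntegral.integral_of_le hst]
      refine integral_mono_of_nonneg (Eventually.of_forall fun _ => sq_nonneg _) hgi ?_
      filter_upwards [ae_restrict_mem measurableSet_Ioc] with τ hτ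
      exact hfg τ (Ioc_subset_Icc_self hτ)
    have hst' : s ∈ Icc s t := ⟨le_rfl, hst⟩
    have htt' : t ∈ Icc s t := ⟨hst, le_rfl⟩
    have h2 : ∫ τ in s..t, expKernel ρ τ s * α ^ 2 ≤ 2 / ρ * α ^ 2 := by
      simp only [expKernel_comm ρ _ s]
      rw [intervalIntegral.integral_mul_const]
      exact mul_le_mul_of_nonneg_right (integral_expKernel_le hρ hst') (sq_nonneg _)
    have h3 : ∫ τ in s..t, expKernel ρ τ t * β ^ 2 ≤ 2 / ρ * β ^ 2 := by
      simp only [expKernel_comm ρ _ t]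
      rw [intervalIntegral.integral_mul_const]
      exact mul_le_mul_of_nonneg_right (integral_expKernel_le hρ htt') (sq_nonneg _)
    have h4 : ∫ τ in s..t, ∫ r in s..t, expKernel ρ τ r * γ r ^ 2 ≤ 2 / ρ * Γ := by
      simp only [intervalIntegral.integral_of_le hst]
      rw [integral_integral_swap hI, hΓ, intervalIntegral.integral_of_le hst,
        ← integral_const_mul]
      refine integral_mono_ae hI.integral_prod_right (hγ2.const_mul _) ?_
      filter_upwards [ae_restrict_mem measurableSet_Ioc] with r hr
      simp only [expKernel_comm ρ _ r]
      rw [integral_mul_const, ← intervalIntegral.integral_of_le hst]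
      exact mul_le_mul_of_nonneg_right (integral_expKernel_le hρ (Ioc_subset_Icc_self hr))
        (sq_nonneg _)
    have hst_i : IntegrableOn (fun τ => expKernel ρ τ s * α ^ 2 + expKernel ρ τ t * β ^ 2)
        (Ioc s t) := hs'.add ht'
    have h5 : ∫ τ in s..t, g τ ≤ c₁ * (2 / ρ * (α ^ 2 + β ^ 2 + Γ)) := by
      simp only [hg]
      rw [intervalIntegral.integral_const_mul, intervalIntegral.integral_add
        (intervalIntegrable_sub hst_i le_rfl hst le_rfl)
        (intervalIntegrable_sub hJ le_rfl hst le_rfl), intervalIntegral.integral_add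
        (intervalIntegrable_sub hs' le_rfl hst le_rfl)
        (intervalIntegrable_sub ht' le_rfl hst le_rfl)]
      gcongr
      linarith
    have h6 : c₁ * (2 / ρ * (α ^ 2 + β ^ 2 + Γ)) ≤
        (c₁ + 1) * (1 + 2 / ρ) * (α ^ 2 + β ^ 2 + Γ) := by
      rw [← mul_assoc]
      gcongr
      · linarith
      · linarith
    linarith

/-- If on every subinterval both the integral and the supremum of `w ≥ 0` are controlled by the
values of `w` at the endpoints, then `w` decays exponentially away from the endpoints. With
`I(n) = ∫ w` over `[n, T - n]`, averaging the first bound over `[n, n + 1]` gives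
`I(n + 1) ≤ K (I(n) - I(n + 1))`, whence `I` decays geometrically. -/
theorem exists_exp_decay {K : ℝ} (hK : 0 < K) :
    ∃ c ν, 0 < c ∧ 0 < ν ∧ ∀ (T : ℝ) (w : ℝ → ℝ), 0 ≤ T → IntegrableOn w (Ioc 0 T) →
      (∀ t ∈ Icc 0 T, 0 ≤ w t) →
      (∀ s t, 0 ≤ s → s ≤ t → t ≤ T → ∫ r in s..t, w r ≤ K * (w s + w t)) →
      (∀ s r t, 0 ≤ s → s ≤ r → r ≤ t → t ≤ T → w r ≤ K * (w s + w t)) →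
      ∀ t ∈ Icc 0 T, w t ≤
        c * (w 0 + w T) * (Real.exp (-ν * t) + Real.exp (-ν * (T - t))) := by
  set q := K / (1 + K) with hq
  have hq0 : 0 < q := by positivity
  have hq1 : q < 1 := by rw [hq, div_lt_one (by positivity)]; linarith
  set ν := -Real.log q with hν
  have hν0 : 0 < ν := by rw [hν]; linarith [Real.log_neg hq0 hq1]
  have hqn : ∀ n : ℕ, q ^ n = Real.exp (-ν * n) := fun n => by
    rw [hν, neg_neg, mul_comm, Real.exp_nat_mul, Real.exp_log hq0]
  refine ⟨(K + K ^ 2) * Real.exp (2 * ν), ν, by positivity, hν0, fun T w hT hw hw0 hint hsup => ?_⟩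
  set I : ℕ → ℝ := fun n => ∫ r in (n : ℝ)..(T - n), w r with hI
  have hii : ∀ s t, 0 ≤ s → s ≤ t → t ≤ T → IntervalIntegrable w volume s t :=
    fun s t hs hst ht => intervalIntegrable_sub hw hs hst ht
  have hnn : ∀ s t, 0 ≤ s → s ≤ t → t ≤ T → 0 ≤ ∫ r in s..t, w r := fun s t hs hst ht =>
    intervalIntegral.integral_nonneg hst fun r hr => hw0 r ⟨hs.trans hr.1, hr.2.trans ht⟩
  set W := w 0 + w T with hW
  have hW0 : 0 ≤ W := add_nonneg (hw0 0 ⟨le_rfl, hT⟩) (hw0 T ⟨hT, le_rfl⟩)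
  -- a constant `x` bounded by the values of `w` at `τ` and `T - τ`, averaged over `[n, n + 1]`
  have avg : ∀ (n : ℕ) (x : ℝ), ((n : ℝ) + 1) + (n + 1) ≤ T →
      (∀ τ ∈ Icc (n : ℝ) (n + 1), x ≤ K * (w τ + w (T - τ))) →
      x ≤ K * (I n - I (n + 1)) := by
    intro n x hn hx
    have hn0 : (0 : ℝ) ≤ n := n.cast_nonneg
    have i1 := hii n (n + 1) hn0 (by linarith) (by linarith)
    have i2 := hii (n + 1) (T - (n + 1)) (by linarith) (by linarith) (by linarith)
    have i3 := hii (T - (n + 1)) (T - n) (by linarith) (by linarith) (by linarith)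
    have i3' : IntervalIntegrable (fun τ => w (T - τ)) volume n (n + 1) := by
      have := (i3.comp_sub_left T).symm
      simpa only [sub_sub_cancel] using this
    have e1 : I n - I (n + 1) = ∫ τ in (n : ℝ)..(n + 1), (w τ + w (T - τ)) := by
      rw [intervalIntegral.integral_add i1 i3', intervalIntegral.integral_comp_sub_left, hI]
      simp only [Nat.cast_add, Nat.cast_one]
      rw [← intervalIntegral.integral_add_adjacent_intervals (i1.trans i2) i3,
        ← intervalIntegral.integral_add_adjacent_intervals i1 i2]
      ring
    have e2 : ∫ _ in (n : ℝ)..(n + 1), x = x := by simp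
    rw [e1, ← intervalIntegral.integral_const_mul, ← e2]
    refine intervalIntegral.integral_mono_on (by linarith) (by simp) ((i1.add i3').const_mul K) hx
  have hstep : ∀ n : ℕ, ((n : ℝ) + 1) + (n + 1) ≤ T → I (n + 1) ≤ q * I n := by
    intro n hn
    have hn0 : (0 : ℝ) ≤ n := n.cast_nonneg
    have := avg n (I (n + 1)) hn fun τ hτ => by
      refine le_trans ?_ (hint τ (T - τ) (hn0.trans hτ.1) (by linarith [hτ.2]) (by linarith [hτ.1]))
      simp only [hI, Nat.cast_add, Nat.cast_one]
      refine intervalIntegral.integral_mono_interval hτ.2 (by linarith) (by linarith [hτ.2]) ?_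
        (hii τ (T - τ) (hn0.trans hτ.1) (by linarith [hτ.2]) (by linarith [hτ.1]))
      filter_upwards [ae_restrict_mem measurableSet_Ioc] with r hr
      exact hw0 r ⟨by linarith [hr.1, hτ.1], by linarith [hr.2, hτ.1]⟩
    rw [hq, div_mul_eq_mul_div, le_div_iff₀ (by positivity)]
    linarith
  have hIn : ∀ n : ℕ, (n : ℝ) + n ≤ T → I n ≤ q ^ n * (K * W) := by
    intro n
    induction n with
    | zero =>
      intro _
      simpa [hI] using hint 0 T le_rfl hT le_rfl
    | succ n ih =>
      intro hn
      push_cast at hn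
      have h1 := hstep n hn
      have h2 := ih (by linarith)
      calc I (n + 1) ≤ q * I n := h1
        _ ≤ q * (q ^ n * (K * W)) := by gcongr
        _ = q ^ (n + 1) * (K * W) := by ring
  intro t ht
  set m := min t (T - t) with hm
  have hmt : m ≤ t := min_le_left _ _
  have hmT : m ≤ T - t := min_le_right _ _
  have hexp : Real.exp (-ν * m) ≤ Real.exp (-ν * t) + Real.exp (-ν * (T - t)) := by
    rcases min_choice t (T - t) with h | h
    · rw [hm, h]; linarith [Real.exp_pos (-ν * (T - t))]
    · rw [hm, h]; linarith [Real.exp_pos (-ν * t)]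
  suffices w t ≤ (K + K ^ 2) * Real.exp (2 * ν) * W * Real.exp (-ν * m) from
    this.trans (by gcongr)
  have hcomb : Real.exp (2 * ν) * Real.exp (-ν * m) = Real.exp (-ν * (m - 2)) := by
    rw [← Real.exp_add]; congr 1; ring
  have hre : (K + K ^ 2) * Real.exp (2 * ν) * W * Real.exp (-ν * m) =
      (K + K ^ 2) * W * Real.exp (-ν * (m - 2)) := by rw [← hcomb]; ring
  rw [hre]
  rcases lt_or_ge m 1 with h | h
  · have h1 := hsup 0 t T le_rfl ht.1 ht.2 le_rfl
    have h2 : 1 ≤ Real.exp (-ν * (m - 2)) := Real.one_le_exp (by nlinarith)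
    calc w t ≤ K * W := h1
      _ ≤ (K + K ^ 2) * W * 1 := by nlinarith [mul_nonneg (sq_nonneg K) hW0]
      _ ≤ _ := by gcongr
  · obtain ⟨n, hn⟩ : ∃ n : ℕ, ⌊m⌋₊ = n + 1 :=
      Nat.exists_eq_succ_of_ne_zero (Nat.floor_pos.2 h).ne'
    have h1 : ((n : ℝ) + 1) ≤ m := by
      have := Nat.floor_le (zero_le_one.trans h)
      rw [hn] at this
      exact_mod_cast this
    have h2 : m < (n : ℝ) + 2 := by
      have := Nat.lt_floor_add_one m
      rw [hn] at this
      push_cast at this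
      linarith
    have hn0 : (0 : ℝ) ≤ n := n.cast_nonneg
    have hnT : ((n : ℝ) + 1) + (n + 1) ≤ T := by linarith
    have h3 := avg n (w t) hnT fun τ hτ =>
      hsup τ t (T - τ) (hn0.trans hτ.1) (by linarith [hτ.2]) (by linarith [hτ.2])
        (by linarith [hτ.1])
    have h4 : 0 ≤ I (n + 1) := by
      simp only [hI, Nat.cast_add, Nat.cast_one]
      exact hnn _ _ (by linarith) (by linarith) (by linarith)
    have h5 := hIn n (by linarith)
    have h6 : q ^ n ≤ Real.exp (-ν * (m - 2)) := by
      rw [hqn]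
      exact Real.exp_le_exp.2 (by nlinarith)
    calc w t ≤ K * (I n - I (n + 1)) := h3
      _ ≤ K * (q ^ n * (K * W)) := by gcongr; linarith
      _ = K ^ 2 * W * q ^ n := by ring
      _ ≤ K ^ 2 * W * Real.exp (-ν * (m - 2)) := by gcongr
      _ ≤ _ := by gcongr; linarith

theorem le_mul_of_sq_le {k a x : ℝ} (hk : 0 ≤ k) (ha : 0 ≤ a)
    (h : x ^ 2 ≤ k * (a ^ 2 + a * x)) : x ≤ (k + 1) * a := by
  by_contra! hlt
  have hx0 : 0 < x := lt_of_le_of_lt (by positivity) hlt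
  have h1 : (k + 1) * a * x < x * x := mul_lt_mul_of_pos_right hlt hx0
  have h2 : a * ((k + 1) * a) ≤ a * x := mul_le_mul_of_nonneg_left hlt.le ha
  nlinarith [sq_nonneg a]

theorem add_le_of_sq_add_sq_le {c d a W x y e₁ e₂ : ℝ} (hc : 0 ≤ c) (hd : 0 ≤ d) (ha : 0 ≤ a)
    (h₁ : 0 ≤ e₁) (h₂ : 0 ≤ e₂) (hxy : x ^ 2 + y ^ 2 ≤ c * W * (e₁ ^ 2 + e₂ ^ 2))
    (hW : W ≤ d * a ^ 2) :
    x + y ≤ Real.sqrt (2 * c * d) * a * (e₁ + e₂) := by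
  have key : (x + y) ^ 2 ≤ 2 * c * d * (a * (e₁ + e₂)) ^ 2 := by
    have h3 : c * W * (e₁ ^ 2 + e₂ ^ 2) ≤ c * (d * a ^ 2) * (e₁ ^ 2 + e₂ ^ 2) := by gcongr
    have h4 : (x + y) ^ 2 ≤ 2 * (c * (d * a ^ 2) * (e₁ ^ 2 + e₂ ^ 2)) := by
      nlinarith [sq_nonneg (x - y)]
    have h5 : 0 ≤ 2 * (c * (d * a ^ 2)) * (e₁ * e₂) := by positivity
    nlinarith
  calc x + y ≤ Real.sqrt (2 * c * d * (a * (e₁ + e₂)) ^ 2) := Real.le_sqrt_of_sq_le key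
    _ = Real.sqrt (2 * c * d) * a * (e₁ + e₂) := by
        rw [Real.sqrt_mul' _ (sq_nonneg _), Real.sqrt_sq (by positivity), ← mul_assoc]

/-! ### A priori estimates for differences of extremals -/

theorem exists_norm_le_of_periodic {𝕜 G G' : Type*} [RCLike 𝕜] [NormedAddCommGroup G]
    [NormedSpace 𝕜 G] [CompleteSpace G] [NormedAddCommGroup G'] [NormedSpace 𝕜 G']
    {P : ℝ → G →L[𝕜] G'} {θ : ℝ} (hθ : 0 < θ) (hP : Function.Periodic P θ)
    (hc : ∀ x, Continuous fun t => P t x) : ∃ M, 0 < M ∧ ∀ t, ‖P t‖ ≤ M := by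
  obtain ⟨M, hM0, hM⟩ := exists_norm_le_of_isCompact (isCompact_Icc (a := (0 : ℝ)) (b := θ))
    fun x => (hc x).continuousOn
  refine ⟨M, hM0, fun t => ?_⟩
  obtain ⟨s, hs, he⟩ := hP.exists_mem_Ico₀ hθ t
  rw [he]
  exact hM s (Ico_subset_Icc_self hs)

namespace PeriodicLQ

variable {𝕜 : Type*} [RCLike 𝕜]
  {H : Type*} [NormedAddCommGroup H] [InnerProductSpace 𝕜 H] [NormedSpace ℝ H] [CompleteSpace H]
  {U : Type*} [NormedAddCommGroup U] [InnerProductSpace 𝕜 U] [CompleteSpace U]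
  {S : PeriodicLQ 𝕜 H U} {T : ℝ} {y p z q : ℝ → H}

variable (S) in
/-- The equations satisfied by the difference of two extremals: those of an extremal with
`y_d = 0`. -/
structure IsHomExtremal (T : ℝ) (y p : ℝ → H) : Prop where
  cont : ContinuousOn y (Icc 0 T)
  mild : IsMild S.E 0 T y fun t => S.B t (S.adjointControl p t)
  adjoint : IsWeakAdjoint S.E 0 T p fun t => S.C t (S.C t (y t))

theorem adjointControl_sub (p q : ℝ → H) (t : ℝ) :
    S.adjointControl (fun t => p t - q t) t = S.adjointControl p t - S.adjointControl q t := by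
  simp only [adjointControl, map_sub]
  abel

theorem IsExtremal.sub (hT : 0 ≤ T) (h : S.IsExtremal T y p) (h' : S.IsExtremal T z q) :
    S.IsHomExtremal T (fun t => y t - z t) (fun t => p t - q t) where
  cont := h.cont.sub h'.cont
  mild := (h.mild.sub S.isEvolutionFamily le_rfl (integrableOn_B_apply (h.memLp hT))
    (integrableOn_B_apply (h'.memLp hT)) h'.mild).congr_right
      (Eventually.of_forall fun t => by rw [adjointControl_sub, map_sub])
  adjoint := by
    have := IsWeakAdjoint.sub S.isEvolutionFamily le_rfl (S.integrableOn_source h.cont)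
      (S.integrableOn_source h'.cont) h.adjoint h'.adjoint
    simpa only [source, adjoint_C, ← map_sub, sub_sub_sub_cancel_right] using this

namespace IsHomExtremal

theorem integrableOn_CC (h : S.IsHomExtremal T y p) :
    IntegrableOn (fun t => S.C t (S.C t (y t))) (Ioc 0 T) :=
  (continuousOn_strong_apply S.C_cont
    (continuousOn_strong_apply S.C_cont h.cont)).integrableOn_Icc.mono_set Ioc_subset_Icc_self

theorem continuousOn_inner (h : S.IsHomExtremal T y p) (x : H) :
    ContinuousOn (fun t => ⟪p t, x⟫_𝕜) (Icc 0 T) :=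
  h.adjoint.continuousOn_inner S.isEvolutionFamily le_rfl h.integrableOn_CC x

theorem memLp (h : S.IsHomExtremal T y p) (hT : 0 ≤ T) :
    MemLp (S.adjointControl p) 2 (volume.restrict (Ioc 0 T)) :=
  S.memLp_adjointControl hT h.continuousOn_inner

theorem inner_B_apply (t : ℝ) (v : U) :
    ⟪p t, S.B t v⟫_𝕜 = -⟪S.Q t (S.adjointControl p t), v⟫_𝕜 := by
  rw [← ContinuousLinearMap.adjoint_inner_left, adjoint_B_apply, inner_neg_left]

/-- The output energy of a subinterval is bounded by the boundary terms of the duality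
relation. -/
theorem energy_le (h : S.IsHomExtremal T y p) {s t : ℝ} (hs : 0 ≤ s) (hst : s ≤ t) (ht : t ≤ T) :
    IntegrableOn (fun r => ‖S.C r (y r)‖ ^ 2 + RCLike.re
      ⟪S.Q r (S.adjointControl p r), S.adjointControl p r⟫_𝕜) (Ioc s t) ∧
    ∫ r in s..t, (‖S.C r (y r)‖ ^ 2 + RCLike.re
      ⟪S.Q r (S.adjointControl p r), S.adjointControl p r⟫_𝕜) ≤
        ‖p s‖ * ‖y s‖ + ‖p t‖ * ‖y t‖ := by
  have hsub : Ioc s t ⊆ Ioc 0 T := Ioc_subset_Ioc hs ht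
  have hT : 0 ≤ T := hs.trans (hst.trans ht)
  obtain ⟨i1, i2, hd⟩ := (h.mild.mono hs ht).duality S.isEvolutionFamily hs hst
    ((integrableOn_B_apply (h.memLp hT)).mono_set hsub) (h.integrableOn_CC.mono_set hsub)
    (h.adjoint.mono hs ht)
  have e1 : ∀ r, ⟪S.C r (S.C r (y r)), y r⟫_𝕜 = ((‖S.C r (y r)‖ ^ 2 : ℝ) : 𝕜) := fun r => by
    nth_rewrite 1 [← S.adjoint_C r]
    rw [ContinuousLinearMap.adjoint_inner_left, inner_self_eq_norm_sq_to_K]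
    simp
  simp only [e1, inner_B_apply] at i1 i2 hd
  have i1' : Integrable (fun r => ‖S.C r (y r)‖ ^ 2) (volume.restrict (Ioc s t)) := by
    simpa only [RCLike.ofReal_re] using i1.re
  have i2'' : IntegrableOn (fun r => RCLike.re
      ⟪S.Q r (S.adjointControl p r), S.adjointControl p r⟫_𝕜) (Ioc s t) := by
    have := i2.re.neg
    refine this.congr (Eventually.of_forall fun r => ?_)
    simp only [Pi.neg_apply, map_neg, neg_neg]
  have hre := congrArg RCLike.re hd
  rw [intervalIntegral.integral_of_le hst, intervalIntegral.integral_of_le hst, map_add, map_add,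
    ← integral_re i1, ← integral_re i2] at hre
  simp only [map_neg, RCLike.ofReal_re] at hre
  rw [integral_neg] at hre
  refine ⟨i1'.add i2'', ?_⟩
  rw [intervalIntegral.integral_of_le hst, integral_add i1' i2'']
  have b1 : RCLike.re ⟪p s, y s⟫_𝕜 ≤ ‖p s‖ * ‖y s‖ := re_inner_le_norm _ _
  have b2 : -RCLike.re ⟪p t, y t⟫_𝕜 ≤ ‖p t‖ * ‖y t‖ :=
    (neg_le_abs _).trans ((RCLike.abs_re_le_norm _).trans (norm_inner_le_norm _ _))
  linarith

variable (S) in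
/-- The size of the output and of the control of a homogeneous extremal. -/
def outputNorm (y p : ℝ → H) (t : ℝ) : ℝ := ‖S.C t (y t)‖ + ‖S.adjointControl p t‖

theorem outputNorm_nonneg (t : ℝ) : 0 ≤ outputNorm S y p t :=
  add_nonneg (norm_nonneg _) (norm_nonneg _)

theorem memLp_outputNorm (h : S.IsHomExtremal T y p) (hT : 0 ≤ T) :
    MemLp (outputNorm S y p) 2 (volume.restrict (Ioc 0 T)) :=
  (memLp_of_continuousOn (continuousOn_strong_apply S.C_cont h.cont)).norm.add (h.memLp hT).norm

theorem integrableOn_expKernel_mul (h : S.IsHomExtremal T y p) (hT : 0 ≤ T) {ρ : ℝ} (hρ : 0 ≤ ρ)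
    (τ : ℝ) : IntegrableOn (fun r => expKernel ρ τ r * outputNorm S y p r) (Ioc 0 T) := by
  have hi := (h.memLp_outputNorm hT).integrable one_le_two
  refine hi.norm.mono' ((continuous_expKernel_right ρ τ).aestronglyMeasurable.mul hi.1) <|
    Eventually.of_forall fun r => ?_
  rw [norm_mul, Real.norm_of_nonneg (expKernel_pos ρ τ r).le]
  exact mul_le_of_le_one_left (norm_nonneg _) (expKernel_le_one hρ τ r)

/-- The output norm is square integrable on subintervals with a bound by endpoint values only. -/
theorem exists_integral_outputNorm_sq_le (S : PeriodicLQ 𝕜 H U) : ∃ c, 0 < c ∧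
    ∀ (T : ℝ) (y p : ℝ → H), S.IsHomExtremal T y p → ∀ s t, 0 ≤ s → s ≤ t → t ≤ T →
      ∫ r in s..t, outputNorm S y p r ^ 2 ≤ c * (‖p s‖ * ‖y s‖ + ‖p t‖ * ‖y t‖) := by
  obtain ⟨ε, hε, hco⟩ := S.Q_coercive
  refine ⟨2 * (1 + ε⁻¹), by positivity, fun T y p h s t hs hst ht => ?_⟩
  obtain ⟨hi, hle⟩ := h.energy_le hs hst ht
  refine le_trans ?_ (mul_le_mul_of_nonneg_left hle (by positivity))
  rw [← intervalIntegral.integral_const_mul, intervalIntegral.integral_of_le hst,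
    intervalIntegral.integral_of_le hst]
  refine integral_mono_of_nonneg (Eventually.of_forall fun _ => sq_nonneg _) (hi.const_mul _)
    (Eventually.of_forall fun r => ?_)
  have h1 : ‖S.adjointControl p r‖ ^ 2 ≤ ε⁻¹ *
      RCLike.re ⟪S.Q r (S.adjointControl p r), S.adjointControl p r⟫_𝕜 := by
    rw [le_inv_mul_iff₀ hε]
    exact hco r _
  have h2 : 0 ≤ RCLike.re ⟪S.Q r (S.adjointControl p r), S.adjointControl p r⟫_𝕜 :=
    re_Q_nonneg r _
  have h3 : 0 ≤ ε⁻¹ * ‖S.C r (y r)‖ ^ 2 := by positivity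
  simp only [outputNorm]
  nlinarith [sq_nonneg (‖S.C r (y r)‖ - ‖S.adjointControl p r‖)]

/-- By detectability the state is controlled by its initial value and the output: it is a trajectory
of the stable system `A + K C` with source `B u - K C y`. (The terms multiplied by `0` are those of
the common form required by `exists_young_bound`.) -/
theorem norm_state_le (h : S.IsHomExtremal T y p)
    {K : ℝ → H →L[𝕜] H} (hK : ∀ x, Continuous fun t => K t x) {V : ℝ → ℝ → H →L[𝕜] H}
    (hV : IsPerturbedEvolution S.E (fun t => (K t).comp (S.C t)) V) {k b M ρ : ℝ}
    (hk : ∀ t, ‖K t‖ ≤ k) (hb : ∀ t, ‖S.B t‖ ≤ b) (hM : 0 ≤ M) (hρ : 0 ≤ ρ)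
    (hVle : ∀ s t, 0 ≤ s → s ≤ t → ‖V t s‖ ≤ M * Real.exp (-ρ * (t - s)))
    {s t τ : ℝ} (hs : 0 ≤ s) (ht : t ≤ T) (hτ : τ ∈ Icc s t) :
    ‖y τ‖ ≤ M * (expKernel ρ τ s * ‖y s‖ + expKernel ρ τ t * 0) +
      M * (b + k) * ∫ r in s..t, expKernel ρ τ r * outputNorm S y p r := by
  have hst : s ≤ t := hτ.1.trans hτ.2
  have hT : 0 ≤ T := hs.trans (hst.trans ht)
  have hF := continuous_comp_apply hK S.C_cont
  have hk0 : 0 ≤ k := (norm_nonneg _).trans (hk 0)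
  have hb0 : 0 ≤ b := (norm_nonneg _).trans (hb 0)
  have hVτ : ∀ r, 0 ≤ r → r ≤ τ → ‖V τ r‖ ≤ M * expKernel ρ τ r := fun r h0 h1 => by
    rw [expKernel, abs_of_nonneg (by linarith)]
    exact hVle r τ h0 h1
  have hm := hV.isMild_perturbed S.isEvolutionFamily hF le_rfl
    (integrableOn_B_apply (h.memLp hT)) h.mild s τ hs hτ.1 (hτ.2.trans ht)
  have hi : IntervalIntegrable (fun r => M * (b + k) * (expKernel ρ τ r * outputNorm S y p r))
      volume s t :=
    (intervalIntegrable_sub (h.integrableOn_expKernel_mul hT hρ τ) hs hst ht).const_mul _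
  rw [hm, mul_zero, add_zero, ← intervalIntegral.integral_const_mul]
  refine (norm_add_le _ _).trans (add_le_add ?_ ?_)
  · rw [← mul_assoc]
    exact (V τ s).le_of_opNorm_le (hVτ s hs hτ.1) _
  · refine (intervalIntegral.norm_integral_le_of_norm_le hτ.1 (Eventually.of_forall fun r hr => ?_)
      (hi.mono_set (by
        rw [uIcc_of_le hτ.1, uIcc_of_le hst]; exact Icc_subset_Icc_right hτ.2))).trans
      (intervalIntegral.integral_mono_interval le_rfl hτ.1 hτ.2
        (Eventually.of_forall fun r => ?_) hi)
    · calc _ ≤ M * expKernel ρ τ r *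
            ‖S.B r (S.adjointControl p r) - (K r).comp (S.C r) (y r)‖ :=
            (V τ r).le_of_opNorm_le (hVτ r (hs.trans hr.1.le) hr.2) _
        _ ≤ M * expKernel ρ τ r * ((b + k) * outputNorm S y p r) := by
            have := expKernel_pos ρ τ r
            gcongr
            have h1 := (S.B r).le_of_opNorm_le (hb r) (S.adjointControl p r)
            have h2 := (K r).le_of_opNorm_le (hk r) (S.C r (y r))
            refine (norm_sub_le _ _).trans ?_
            rw [ContinuousLinearMap.comp_apply, outputNorm]
            nlinarith [mul_nonneg hb0 (norm_nonneg (S.C r (y r))),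
              mul_nonneg hk0 (norm_nonneg (S.adjointControl p r))]
        _ = _ := by ring
    · have := (expKernel_pos ρ τ r).le
      have := outputNorm_nonneg (S := S) (y := y) (p := p) r
      simp only [Pi.zero_apply]
      positivity

/-- By stabilizability the adjoint state is controlled by its terminal value and the output: it is
tested with the free trajectories of the stable system `A + B K`, which are trajectories with
control `K z`, and `B* p = -Q u`. -/
theorem norm_adjoint_le (h : S.IsHomExtremal T y p)
    {K : ℝ → H →L[𝕜] U} (hK : ∀ x, Continuous fun t => K t x) {V : ℝ → ℝ → H →L[𝕜] H}
    (hV : IsPerturbedEvolution S.E (fun t => (S.B t).comp (K t)) V) {k q d M ρ : ℝ}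
    (hk : ∀ t, ‖K t‖ ≤ k) (hq : ∀ t, ‖S.Q t‖ ≤ q) (hd : ∀ t, ‖S.C t‖ ≤ d) (hM : 0 ≤ M)
    (hρ : 0 ≤ ρ) (hVle : ∀ s t, 0 ≤ s → s ≤ t → ‖V t s‖ ≤ M * Real.exp (-ρ * (t - s)))
    {s t τ : ℝ} (hs : 0 ≤ s) (ht : t ≤ T) (hτ : τ ∈ Icc s t) :
    ‖p τ‖ ≤ M * (expKernel ρ τ s * 0 + expKernel ρ τ t * ‖p t‖) +
      M * (d + q * k) * ∫ r in s..t, expKernel ρ τ r * outputNorm S y p r := by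
  have hst : s ≤ t := hτ.1.trans hτ.2
  have hT : 0 ≤ T := hs.trans (hst.trans ht)
  have hτ0 : 0 ≤ τ := hs.trans hτ.1
  have hF := continuous_comp_apply S.B_cont hK
  have hk0 : 0 ≤ k := (norm_nonneg _).trans (hk 0)
  have hq0 : 0 ≤ q := (norm_nonneg _).trans (hq 0)
  have hd0 : 0 ≤ d := (norm_nonneg _).trans (hd 0)
  have hVτ : ∀ r, τ ≤ r → ‖V r τ‖ ≤ M * expKernel ρ τ r := fun r h1 => by
    rw [expKernel, abs_of_nonpos (by linarith), neg_sub]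
    exact hVle τ r hτ0 h1
  have iz : IntegrableOn (fun _ => (0 : H)) (Ioc τ t) := integrable_zero _ _ _
  have hi : IntervalIntegrable (fun r => M * (d + q * k) * (expKernel ρ τ r * outputNorm S y p r))
      volume s t :=
    (intervalIntegrable_sub (h.integrableOn_expKernel_mul hT hρ τ) hs hst ht).const_mul _
  have hi' := hi.mono_set (c := τ) (d := t)
    (by rw [uIcc_of_le hτ.2, uIcc_of_le hst]; exact Icc_subset_Icc_left hτ.1)
  have key : ∀ x, ‖⟪p τ, x⟫_𝕜‖ ≤ (M * (expKernel ρ τ t * ‖p t‖) +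
      ∫ r in τ..t, M * (d + q * k) * (expKernel ρ τ r * outputNorm S y p r)) * ‖x‖ := by
    intro x
    have hz := (hV.isMild_of_isMild S.isEvolutionFamily hF hτ0 iz
      (hV.isMild_homogeneous (b := t) hτ0 x)).congr_right
      (f₂ := fun r => S.B r (K r (V r τ x))) (Eventually.of_forall fun r => by simp)
    have hzc : ContinuousOn (fun r => V r τ x) (Icc τ t) :=
      (hV.1.continuousOn_left hτ0 x).mono fun r hr => hr.1
    have hsub : Ioc τ t ⊆ Ioc 0 T := Ioc_subset_Ioc hτ0 ht
    obtain ⟨j1, j2, hdual⟩ := hz.duality S.isEvolutionFamily hτ0 hτ.2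
      (((continuousOn_strong_apply S.B_cont
        (continuousOn_strong_apply hK hzc)).integrableOn_Icc).mono_set Ioc_subset_Icc_self)
      (h.integrableOn_CC.mono_set hsub) (h.adjoint.mono hτ0 ht)
    rw [hV.1.refl τ hτ0, ContinuousLinearMap.id_apply, ← sub_eq_iff_eq_add, add_sub_assoc,
      ← intervalIntegral.integral_sub (intervalIntegrable_sub j1 le_rfl hτ.2 le_rfl)
        (intervalIntegrable_sub j2 le_rfl hτ.2 le_rfl)] at hdual
    rw [← hdual, add_mul, ← intervalIntegral.integral_mul_const]
    refine (norm_add_le _ _).trans (add_le_add ?_ ?_)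
    · calc _ ≤ ‖p t‖ * (M * expKernel ρ τ t * ‖x‖) := (norm_inner_le_norm _ _).trans (by
            gcongr; exact (V t τ).le_of_opNorm_le (hVτ t hτ.2) _)
        _ = _ := by ring
    · refine intervalIntegral.norm_integral_le_of_norm_le hτ.2
        (Eventually.of_forall fun r hr => ?_) (hi'.mul_const _)
      have hVr := (V r τ).le_of_opNorm_le (hVτ r hr.1.le) x
      have he := expKernel_pos ρ τ r
      have h1 : ‖⟪S.C r (S.C r (y r)), V r τ x⟫_𝕜‖ ≤
          d * ‖S.C r (y r)‖ * (M * expKernel ρ τ r * ‖x‖) :=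
        (norm_inner_le_norm _ _).trans (by
          gcongr; exact (S.C r).le_of_opNorm_le (hd r) _)
      have h2 : ‖⟪p r, S.B r (K r (V r τ x))⟫_𝕜‖ ≤
          q * ‖S.adjointControl p r‖ * (k * (M * expKernel ρ τ r * ‖x‖)) := by
        rw [inner_B_apply, norm_neg]
        refine (norm_inner_le_norm _ _).trans ?_
        gcongr
        · exact (S.Q r).le_of_opNorm_le (hq r) _
        · exact ((K r).le_of_opNorm_le (hk r) _).trans (by gcongr)
      refine (norm_sub_le _ _).trans ((add_le_add h1 h2).trans ?_)
      have h3 : 0 ≤ M * expKernel ρ τ r * ‖x‖ := by positivity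
      have h4 : d * ‖S.C r (y r)‖ + q * k * ‖S.adjointControl p r‖ ≤
          (d + q * k) * outputNorm S y p r := by
        rw [outputNorm]
        nlinarith [mul_nonneg hd0 (norm_nonneg (S.adjointControl p r)),
          mul_nonneg (mul_nonneg hq0 hk0) (norm_nonneg (S.C r (y r)))]
      calc _ = (d * ‖S.C r (y r)‖ + q * k * ‖S.adjointControl p r‖) *
            (M * expKernel ρ τ r * ‖x‖) := by ring
        _ ≤ (d + q * k) * outputNorm S y p r * (M * expKernel ρ τ r * ‖x‖) := by gcongr
        _ = _ := by ring
  have hnn : ∀ r, 0 ≤ M * (d + q * k) * (expKernel ρ τ r * outputNorm S y p r) := fun r => by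
    have := (expKernel_pos ρ τ r).le
    have := outputNorm_nonneg (S := S) (y := y) (p := p) r
    positivity
  have h1 : ‖p τ‖ ≤ M * (expKernel ρ τ t * ‖p t‖) +
      ∫ r in τ..t, M * (d + q * k) * (expKernel ρ τ r * outputNorm S y p r) := by
    rw [← innerSL_apply_norm (𝕜 := 𝕜) (p τ)]
    refine ContinuousLinearMap.opNorm_le_bound _ (add_nonneg ?_ ?_) fun x => by simpa using key x
    · have := (expKernel_pos ρ τ t).le
      positivity
    · exact intervalIntegral.integral_nonneg hτ.2 fun r _ => hnn r
  rw [mul_zero, zero_add, ← intervalIntegral.integral_const_mul]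
  refine h1.trans (add_le_add le_rfl ?_)
  exact intervalIntegral.integral_mono_interval hτ.1 hτ.2 le_rfl (Eventually.of_forall hnn) hi

end IsHomExtremal

end PeriodicLQ

/-! ### Exponential decay away from the endpoints -/

namespace PeriodicLQ

variable {𝕜 : Type*} [RCLike 𝕜]
  {H : Type*} [NormedAddCommGroup H] [InnerProductSpace 𝕜 H] [NormedSpace ℝ H] [CompleteSpace H]
  {U : Type*} [NormedAddCommGroup U] [InnerProductSpace 𝕜 U] [CompleteSpace U]
  {S : PeriodicLQ 𝕜 H U} {T : ℝ} {y p : ℝ → H}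

theorem exists_norm_adjointControl_le (S : PeriodicLQ 𝕜 H U) :
    ∃ c, 0 < c ∧ ∀ (p : ℝ → H) t, ‖S.adjointControl p t‖ ≤ c * ‖p t‖ := by
  obtain ⟨b, hb0, hb⟩ := exists_norm_le_of_periodic S.θ_pos S.B_periodic S.B_cont
  obtain ⟨c, hc0, hc⟩ := S.exists_inverse_Q_norm_le
  refine ⟨c * b, by positivity, fun p t => ?_⟩
  rw [adjointControl, norm_neg]
  calc _ ≤ c * ‖ContinuousLinearMap.adjoint (S.B t) (p t)‖ := hc t _
    _ ≤ c * (b * ‖p t‖) := by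
        gcongr
        exact ContinuousLinearMap.le_of_opNorm_le _
          ((ContinuousLinearMap.adjoint.norm_map (S.B t)).trans_le (hb t)) _
    _ = _ := by ring

theorem IsHomExtremal.integrableOn_sq_norm_adjoint (h : S.IsHomExtremal T y p) (hT : 0 ≤ T) :
    IntegrableOn (fun t => ‖p t‖ ^ 2) (Ioc 0 T) := by
  obtain ⟨P, -, hP⟩ := exists_norm_le_of_weakOn h.continuousOn_inner
  have : IntegrableOn (fun t => ‖p t‖ ^ 2) (Icc 0 T) := by
    refine (integrable_const (P ^ 2)).mono'
      ((aestronglyMeasurable_of_weakOn hT h.continuousOn_inner).norm.pow 2) ?_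
    filter_upwards [ae_restrict_mem measurableSet_Icc] with τ hτ
    rw [norm_pow, norm_norm]
    exact pow_le_pow_left₀ (norm_nonneg _) (hP τ hτ) 2
  exact this.mono_set Ioc_subset_Icc_self

/-- A priori estimates on subintervals: `‖y‖² + ‖p‖²` is controlled, pointwise and in the mean, by
`‖y(s)‖²`, `‖p(t)‖²` and the boundary terms of the duality relation. -/
theorem exists_apriori_bound (hstab : S.IsStabilizable) (hdet : S.IsDetectable) :
    ∃ c, 0 < c ∧ ∀ (T : ℝ) (y p : ℝ → H), S.IsHomExtremal T y p →
      ∀ s t, 0 ≤ s → s ≤ t → t ≤ T →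
        (∀ τ ∈ Icc s t, ‖y τ‖ ^ 2 + ‖p τ‖ ^ 2 ≤
          c * (‖y s‖ ^ 2 + ‖p t‖ ^ 2 + (‖p s‖ * ‖y s‖ + ‖p t‖ * ‖y t‖))) ∧
        ∫ τ in s..t, (‖y τ‖ ^ 2 + ‖p τ‖ ^ 2) ≤
          c * (‖y s‖ ^ 2 + ‖p t‖ ^ 2 + (‖p s‖ * ‖y s‖ + ‖p t‖ * ‖y t‖)) := by
  obtain ⟨K₁, hK₁p, hK₁, V₁, hV₁, M₁, ρ₁, hM₁, hρ₁, hle₁⟩ := hstab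
  obtain ⟨K₂, hK₂p, hK₂, V₂, hV₂, M₂, ρ₂, hM₂, hρ₂, hle₂⟩ := hdet
  obtain ⟨k₁, -, hk₁⟩ := exists_norm_le_of_periodic S.θ_pos hK₁p hK₁
  obtain ⟨k₂, -, hk₂⟩ := exists_norm_le_of_periodic S.θ_pos hK₂p hK₂
  obtain ⟨b, -, hb⟩ := exists_norm_le_of_periodic S.θ_pos S.B_periodic S.B_cont
  obtain ⟨d, -, hd⟩ := exists_norm_le_of_periodic S.θ_pos S.C_periodic S.C_cont
  obtain ⟨q, -, hq⟩ := exists_norm_le_of_periodic S.θ_pos S.Q_periodic S.Q_cont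
  obtain ⟨c₀, hc₀, h₀⟩ := IsHomExtremal.exists_integral_outputNorm_sq_le S
  obtain ⟨c₂, hc₂, h₂⟩ := exists_young_bound M₂ (M₂ * (b + k₂)) hρ₂
  obtain ⟨c₁, hc₁, h₁⟩ := exists_young_bound M₁ (M₁ * (d + q * k₁)) hρ₁
  refine ⟨(c₁ + c₂) * (1 + c₀), by positivity, fun T y p h s t hs hst ht => ?_⟩
  have hT : 0 ≤ T := hs.trans (hst.trans ht)
  have hsub : Ioc s t ⊆ Ioc 0 T := Ioc_subset_Ioc hs ht
  have hγ := (h.memLp_outputNorm hT).mono_measure (Measure.restrict_mono hsub le_rfl)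
  have hγ2 : IntegrableOn (fun r => IsHomExtremal.outputNorm S y p r ^ 2) (Ioc s t) :=
    (memLp_two_iff_integrable_sq hγ.1).1 hγ
  obtain ⟨y1, y2⟩ := h₂ s t (fun τ => ‖y τ‖) _ ‖y s‖ 0 hst hγ.1 hγ2 (fun τ _ => norm_nonneg _)
    fun τ hτ => h.norm_state_le hK₂ hV₂ hk₂ hb hM₂.le hρ₂.le hle₂ hs ht hτ
  obtain ⟨p1, p2⟩ := h₁ s t (fun τ => ‖p τ‖) _ 0 ‖p t‖ hst hγ.1 hγ2 (fun τ _ => norm_nonneg _)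
    fun τ hτ => h.norm_adjoint_le hK₁ hV₁ hk₁ hq hd hM₁.le hρ₁.le hle₁ hs ht hτ
  have hΓ := h₀ T y p h s t hs hst ht
  set Γ := ∫ r in s..t, IsHomExtremal.outputNorm S y p r ^ 2 with hΓdef
  set D := ‖p s‖ * ‖y s‖ + ‖p t‖ * ‖y t‖ with hD
  have hD0 : 0 ≤ D := by positivity
  have hΓ0 : 0 ≤ Γ := intervalIntegral.integral_nonneg hst fun _ _ => sq_nonneg _
  have hfin : c₂ * (‖y s‖ ^ 2 + 0 ^ 2 + Γ) + c₁ * (0 ^ 2 + ‖p t‖ ^ 2 + Γ) ≤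
      (c₁ + c₂) * (1 + c₀) * (‖y s‖ ^ 2 + ‖p t‖ ^ 2 + D) := by
    have e1 : c₂ * (‖y s‖ ^ 2 + 0 ^ 2 + Γ) + c₁ * (0 ^ 2 + ‖p t‖ ^ 2 + Γ) ≤
        (c₁ + c₂) * (‖y s‖ ^ 2 + ‖p t‖ ^ 2 + Γ) := by
      nlinarith [mul_nonneg hc₁.le (sq_nonneg ‖y s‖), mul_nonneg hc₂.le (sq_nonneg ‖p t‖)]
    have e2 : ‖y s‖ ^ 2 + ‖p t‖ ^ 2 + Γ ≤ (1 + c₀) * (‖y s‖ ^ 2 + ‖p t‖ ^ 2 + D) := by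
      nlinarith [mul_nonneg hc₀.le (sq_nonneg ‖y s‖), mul_nonneg hc₀.le (sq_nonneg ‖p t‖)]
    calc _ ≤ _ := e1
      _ ≤ (c₁ + c₂) * ((1 + c₀) * (‖y s‖ ^ 2 + ‖p t‖ ^ 2 + D)) := by gcongr
      _ = _ := by ring
  have hyi : IntervalIntegrable (fun τ => ‖y τ‖ ^ 2) volume s t :=
    ((h.cont.mono (Icc_subset_Icc hs ht)).norm.pow 2).intervalIntegrable_of_Icc hst
  have hpi : IntervalIntegrable (fun τ => ‖p τ‖ ^ 2) volume s t :=
    intervalIntegrable_sub (h.integrableOn_sq_norm_adjoint hT) hs hst ht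
  constructor
  · intro τ hτ
    linarith [y1 τ hτ, p1 τ hτ]
  · rw [intervalIntegral.integral_add hyi hpi]
    linarith

/-- The difference of two extremals is bounded by the distance of their initial states and of
their final adjoint states, with exponential decay away from the endpoints. -/
theorem exists_turnpike_bound (hstab : S.IsStabilizable) (hdet : S.IsDetectable) :
    ∃ c ν, 0 < c ∧ 0 < ν ∧ ∀ (T : ℝ) (y p : ℝ → H), 0 ≤ T → S.IsHomExtremal T y p →
      ∀ t ∈ Icc 0 T, ‖y t‖ + ‖S.adjointControl p t‖ + ‖p t‖ ≤
        c * (‖y 0‖ + ‖p T‖) * (Real.exp (-ν * t) + Real.exp (-ν * (T - t))) := by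
  obtain ⟨k, hk, hb⟩ := exists_apriori_bound hstab hdet
  obtain ⟨m, hm, hu⟩ := exists_norm_adjointControl_le S
  obtain ⟨c, ν, hc, hν, hdec⟩ := exists_exp_decay (K := 2 * k) (by positivity)
  set k' := 4 * k with hk'
  refine ⟨(1 + m) * Real.sqrt (2 * c * (1 + (k' + 1) ^ 2)) + 1, ν / 2, by positivity,
    by positivity, fun T y p hT h t ht => ?_⟩
  have hcomm : ∀ s t, ‖y s‖ ^ 2 + ‖p t‖ ^ 2 + (‖p s‖ * ‖y s‖ + ‖p t‖ * ‖y t‖) ≤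
      2 * ((‖y s‖ ^ 2 + ‖p s‖ ^ 2) + (‖y t‖ ^ 2 + ‖p t‖ ^ 2)) := fun s t => by
    nlinarith [sq_nonneg (‖p s‖ - ‖y s‖), sq_nonneg (‖p t‖ - ‖y t‖), sq_nonneg ‖y s‖,
      sq_nonneg ‖y t‖, sq_nonneg ‖p s‖, sq_nonneg ‖p t‖]
  have hwi : IntegrableOn (fun τ => ‖y τ‖ ^ 2 + ‖p τ‖ ^ 2) (Ioc 0 T) :=
    ((h.cont.norm.pow 2).integrableOn_Icc.mono_set Ioc_subset_Icc_self).add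
      (h.integrableOn_sq_norm_adjoint hT)
  have hw := hdec T (fun τ => ‖y τ‖ ^ 2 + ‖p τ‖ ^ 2) hT hwi (fun _ _ => by positivity)
    (fun s t hs hst ht => ((hb T y p h s t hs hst ht).2.trans
      (mul_le_mul_of_nonneg_left (hcomm s t) hk.le)).trans_eq (by ring))
    (fun s r t hs hsr hrt ht => (((hb T y p h s t hs (hsr.trans hrt) ht).1 r ⟨hsr, hrt⟩).trans
      (mul_le_mul_of_nonneg_left (hcomm s t) hk.le)).trans_eq (by ring)) t ht
  set a := ‖y 0‖ + ‖p T‖ with ha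
  have ha0 : 0 ≤ a := by positivity
  -- the boundary values that are not prescribed are estimated by those that are
  set X := ‖p 0‖ + ‖y T‖ with hX
  have hX0 : 0 ≤ X := by positivity
  have hXa : X ≤ (k' + 1) * a := by
    have h1 := (hb T y p h 0 T le_rfl hT le_rfl).1 0 ⟨le_rfl, hT⟩
    have h2 := (hb T y p h 0 T le_rfl hT le_rfl).1 T ⟨hT, le_rfl⟩
    have h3 : ‖y 0‖ ^ 2 + ‖p T‖ ^ 2 + (‖p 0‖ * ‖y 0‖ + ‖p T‖ * ‖y T‖) ≤ a ^ 2 + a * X := by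
      rw [ha, hX]
      nlinarith [mul_nonneg (norm_nonneg (y 0)) (norm_nonneg (p T)),
        mul_nonneg (norm_nonneg (y 0)) (norm_nonneg (y T)),
        mul_nonneg (norm_nonneg (p 0)) (norm_nonneg (p T))]
    have h4 : X ^ 2 ≤ k' * (a ^ 2 + a * X) := by
      have h5 : X ^ 2 ≤ 2 * (‖p 0‖ ^ 2 + ‖y T‖ ^ 2) := by
        rw [hX]; nlinarith [sq_nonneg (‖p 0‖ - ‖y T‖)]
      have h6 := mul_le_mul_of_nonneg_left h3 hk.le
      rw [hk']
      nlinarith [sq_nonneg ‖y 0‖, sq_nonneg ‖p T‖]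
    exact le_mul_of_sq_le (by positivity) ha0 h4
  have hW : (‖y 0‖ ^ 2 + ‖p 0‖ ^ 2) + (‖y T‖ ^ 2 + ‖p T‖ ^ 2) ≤ (1 + (k' + 1) ^ 2) * a ^ 2 := by
    have h1 : X ^ 2 ≤ ((k' + 1) * a) ^ 2 := pow_le_pow_left₀ hX0 hXa 2
    have h2 : ‖y 0‖ ^ 2 + ‖p T‖ ^ 2 ≤ a ^ 2 := by
      rw [ha]; nlinarith [mul_nonneg (norm_nonneg (y 0)) (norm_nonneg (p T))]
    have h3 : ‖p 0‖ ^ 2 + ‖y T‖ ^ 2 ≤ X ^ 2 := by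
      rw [hX]; nlinarith [mul_nonneg (norm_nonneg (p 0)) (norm_nonneg (y T))]
    nlinarith
  set e₁ := Real.exp (-(ν / 2) * t) with he₁
  set e₂ := Real.exp (-(ν / 2) * (T - t)) with he₂
  have he₁0 : 0 < e₁ := Real.exp_pos _
  have he₂0 : 0 < e₂ := Real.exp_pos _
  have hs₁ : Real.exp (-ν * t) = e₁ ^ 2 := by
    rw [he₁, ← Real.exp_nat_mul]; congr 1; push_cast; ring
  have hs₂ : Real.exp (-ν * (T - t)) = e₂ ^ 2 := by
    rw [he₂, ← Real.exp_nat_mul]; congr 1; push_cast; ring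
  rw [hs₁, hs₂] at hw
  have hyp := add_le_of_sq_add_sq_le hc.le (by positivity) ha0 he₁0.le he₂0.le hw hW
  set L := Real.sqrt (2 * c * (1 + (k' + 1) ^ 2)) with hL
  clear hb hdec
  clear_value L e₁ e₂ X a k'
  have hfin : (1 + m) * (‖y t‖ + ‖p t‖) ≤ (1 + m) * (L * a * (e₁ + e₂)) := by gcongr
  have := hu p t
  have h0 : 0 ≤ 1 * a * (e₁ + e₂) := by positivity
  nlinarith [mul_nonneg hm.le (norm_nonneg (y t))]

end PeriodicLQ

/-! ### Periodic extension of extremals -/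

section Periodic

variable {𝕜 : Type*} [RCLike 𝕜]
  {H : Type*} [NormedAddCommGroup H] [InnerProductSpace 𝕜 H] [NormedSpace ℝ H] [CompleteSpace H]
  {E : ℝ → ℝ → H →L[𝕜] H} {a b c θ : ℝ} {y f p h : ℝ → H}

theorem IsMild.append (hE : IsEvolutionFamily E) (ha : 0 ≤ a) (hab : a ≤ b)
    (hf : IntegrableOn f (Ioc a c)) (h₁ : IsMild E a b y f) (h₂ : IsMild E b c y f) :
    IsMild E a c y f := by
  refine IsMild.of_initial hE ha hf fun t ht => ?_
  rcases le_total t b with htb | hbt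
  · exact h₁ a t le_rfl ht.1 htb
  · have hfb : IntegrableOn f (Ioc a b) := hf.mono_set (Ioc_subset_Ioc_right (hbt.trans ht.2))
    have hft : IntegrableOn f (Ioc a t) := hf.mono_set (Ioc_subset_Ioc_right ht.2)
    have hi := hE.integrableOn_apply ha hft
    rw [h₂ b t le_rfl hbt ht.2, h₁ a b le_rfl hab le_rfl, map_add,
      hE.apply_integral ha hab hbt hfb, ← hE.comp a b t ha hab hbt, add_assoc,
      intervalIntegral.integral_add_adjacent_intervals (intervalIntegrable_sub hi le_rfl hab hbt)
        (intervalIntegrable_sub hi hab hbt le_rfl)]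
    rfl

theorem IsWeakAdjoint.append (hE : IsEvolutionFamily E) (ha : 0 ≤ a) (hbc : b ≤ c)
    (hh : IntegrableOn h (Ioc a c)) (h₁ : IsWeakAdjoint E a b p h)
    (h₂ : IsWeakAdjoint E b c p h) : IsWeakAdjoint E a c p h := by
  refine IsWeakAdjoint.of_terminal hE ha hh fun s hs x => ?_
  rcases le_total b s with hbs | hsb
  · exact h₂ s c hbs hs.2 le_rfl x
  · have hs0 : 0 ≤ s := ha.trans hs.1
    have hi := hE.integrableOn_inner hs0 (hh.mono_set (Ioc_subset_Ioc_left hs.1)) x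
    have e : ∫ τ in b..c, ⟪h τ, E τ b (E b s x)⟫_𝕜 = ∫ τ in b..c, ⟪h τ, E τ s x⟫_𝕜 := by
      refine intervalIntegral.integral_congr fun τ hτ => ?_
      rw [uIcc_of_le hbc] at hτ
      rw [← hE.comp s b τ hs0 hsb hτ.1]
      rfl
    rw [h₁ s b hs.1 hsb le_rfl x, h₂ b c le_rfl hbc le_rfl, e,
      ← intervalIntegral.integral_add_adjacent_intervals (intervalIntegrable_sub hi le_rfl hsb hbc)
        (intervalIntegrable_sub hi hsb hbc le_rfl), ← hE.comp s b c hs0 hsb hbc,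
      ContinuousLinearMap.comp_apply]
    ring

theorem IsMild.shift (hEp : IsPeriodicEvolution θ E) (ha : 0 ≤ a) (hy : Function.Periodic y θ)
    (hf : Function.Periodic f θ) (h : IsMild E a b y f) : IsMild E (a + θ) (b + θ) y f := by
  intro s t hs hst ht
  obtain ⟨s, rfl⟩ : ∃ s', s = s' + θ := ⟨s - θ, by ring⟩
  obtain ⟨t, rfl⟩ : ∃ t', t = t' + θ := ⟨t - θ, by ring⟩
  have hst' : s ≤ t := by linarith
  have has : a ≤ s := by linarith
  rw [hy, hy, hEp s t (ha.trans has) hst', h s t has hst' (by linarith),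
    ← intervalIntegral.integral_comp_add_right]
  congr 1
  refine intervalIntegral.integral_congr fun r hr => ?_
  rw [uIcc_of_le hst'] at hr
  rw [hf, hEp r t (ha.trans (has.trans hr.1)) hr.2]

theorem IsWeakAdjoint.shift (hEp : IsPeriodicEvolution θ E) (ha : 0 ≤ a)
    (hp : Function.Periodic p θ) (hh : Function.Periodic h θ) (H : IsWeakAdjoint E a b p h) :
    IsWeakAdjoint E (a + θ) (b + θ) p h := by
  intro s t hs hst ht x
  obtain ⟨s, rfl⟩ : ∃ s', s = s' + θ := ⟨s - θ, by ring⟩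
  obtain ⟨t, rfl⟩ : ∃ t', t = t' + θ := ⟨t - θ, by ring⟩
  have hst' : s ≤ t := by linarith
  have has : a ≤ s := by linarith
  rw [hp, hp, hEp s t (ha.trans has) hst', H s t has hst' (by linarith),
    ← intervalIntegral.integral_comp_add_right]
  congr 1
  refine intervalIntegral.integral_congr fun r hr => ?_
  rw [uIcc_of_le hst'] at hr
  rw [hh, hEp s r (ha.trans has) hr.1]

/-- Continuity on two periods is used to have a neighbourhood of the point `θ`. -/
theorem continuous_of_periodic {X : Type*} [TopologicalSpace X] {g : ℝ → X} (hθ : 0 < θ)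
    (hg : Function.Periodic g θ) (hc : ContinuousOn g (Icc 0 (θ + θ))) : Continuous g := by
  rw [continuous_iff_continuousAt]
  intro t
  have hm := toIocMod_mem_Ioc hθ 0 t
  set n := toIocDiv hθ 0 t with hn
  have e : t - n • θ = toIocMod hθ 0 t := self_sub_toIocDiv_zsmul hθ 0 t
  rw [← e, zero_add] at hm
  have h1 : ContinuousAt g (t - n • θ) :=
    hc.continuousAt (Icc_mem_nhds hm.1 (by linarith [hm.2]))
  have h2 : ContinuousAt (fun r => g (r - n • θ)) t :=
    ContinuousAt.comp (f := fun r => r - n • θ) h1 (by fun_prop)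
  exact h2.congr (Eventually.of_forall fun r => hg.sub_zsmul_eq n)

theorem exists_periodic_eqOn {X : Type*} (g : ℝ → X) (hθ : 0 < θ) (h : g 0 = g θ) :
    ∃ g' : ℝ → X, Function.Periodic g' θ ∧ EqOn g g' (Icc 0 θ) := by
  refine ⟨fun t => g (toIcoMod hθ 0 t), fun t => by simp [toIcoMod_add_right], fun t ht => ?_⟩
  rcases ht.2.eq_or_lt with rfl | hlt
  · have : toIcoMod hθ 0 t = 0 := by
      have := toIcoMod_add_right hθ 0 0
      rw [zero_add] at this
      rw [this, toIcoMod_apply_left]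
    simp only [this, h]
  · simp only [(toIcoMod_eq_self hθ).2 (show t ∈ Ico 0 (0 + θ) from ⟨ht.1, by linarith⟩)]

/-- A periodic solution on one period is a solution on `n` periods. -/
theorem IsMild.nat_mul (hE : IsEvolutionFamily E) (hEp : IsPeriodicEvolution θ E) (hθ : 0 < θ)
    (hy : Function.Periodic y θ) (hf : Function.Periodic f θ) (hfi : IntegrableOn f (Ioc 0 θ))
    (h : IsMild E 0 θ y f) (n : ℕ) : IsMild E 0 (n * θ) y f := by
  induction n with
  | zero => exact h.mono le_rfl (by simpa using hθ.le)
  | succ n ih =>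
    have hi : IntegrableOn f (Ioc 0 (((n + 1 : ℕ) : ℝ) * θ)) := by
      have := hf.intervalIntegrable₀ hθ.ne'
        ((intervalIntegrable_iff_integrableOn_Ioc_of_le hθ.le).2 hfi) 0 (((n + 1 : ℕ) : ℝ) * θ)
      exact (intervalIntegrable_iff_integrableOn_Ioc_of_le (by positivity)).1 this
    refine IsMild.append hE le_rfl hθ.le hi h ?_
    have := ih.shift hEp le_rfl hy hf
    rw [zero_add] at this
    convert this using 1
    push_cast
    ring

theorem IsWeakAdjoint.nat_mul (hE : IsEvolutionFamily E) (hEp : IsPeriodicEvolution θ E)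
    (hθ : 0 < θ) (hp : Function.Periodic p θ) (hh : Function.Periodic h θ)
    (hhi : IntegrableOn h (Ioc 0 θ)) (H : IsWeakAdjoint E 0 θ p h) (n : ℕ) :
    IsWeakAdjoint E 0 (n * θ) p h := by
  induction n with
  | zero => exact H.mono le_rfl (by simpa using hθ.le)
  | succ n ih =>
    have hi : IntegrableOn h (Ioc 0 (((n + 1 : ℕ) : ℝ) * θ)) := by
      have := hh.intervalIntegrable₀ hθ.ne'
        ((intervalIntegrable_iff_integrableOn_Ioc_of_le hθ.le).2 hhi) 0 (((n + 1 : ℕ) : ℝ) * θ)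
      exact (intervalIntegrable_iff_integrableOn_Ioc_of_le (by positivity)).1 this
    have e : ((n + 1 : ℕ) : ℝ) * θ = n * θ + θ := by push_cast; ring
    rw [e] at hi ⊢
    have := ih.shift hEp le_rfl hp hh
    rw [zero_add] at this
    exact IsWeakAdjoint.append hE le_rfl (by have : 0 ≤ n * θ := by positivity
                                             linarith) hi H this

end Periodic

namespace PeriodicLQ

variable {𝕜 : Type*} [RCLike 𝕜]
  {H : Type*} [NormedAddCommGroup H] [InnerProductSpace 𝕜 H] [NormedSpace ℝ H] [CompleteSpace H]
  {U : Type*} [NormedAddCommGroup U] [InnerProductSpace 𝕜 U] [CompleteSpace U]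
  {S : PeriodicLQ 𝕜 H U} {T : ℝ} {y p z q : ℝ → H}

theorem adjointControl_congr {t : ℝ} (h : p t = q t) :
    S.adjointControl p t = S.adjointControl q t := by
  rw [adjointControl, adjointControl, h]

theorem periodic_adjointControl (hp : Function.Periodic p S.θ) :
    Function.Periodic (S.adjointControl p) S.θ := fun t => by
  rw [adjointControl, adjointControl, hp, S.B_periodic, S.Q_periodic]

theorem periodic_source (hy : Function.Periodic y S.θ) : Function.Periodic (S.source y) S.θ :=
  fun t => by rw [source, source, hy, S.C_periodic, S.yd_periodic]

namespace IsExtremal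

theorem congr (h : S.IsExtremal T y p) (hy : EqOn y z (Icc 0 T)) (hp : EqOn p q (Icc 0 T)) :
    S.IsExtremal T z q where
  cont := h.cont.congr fun t ht => (hy ht).symm
  mild := by
    intro s t hs hst ht
    rw [← hy ⟨hs, hst.trans ht⟩, ← hy ⟨hs.trans hst, ht⟩, h.mild s t hs hst ht]
    congr 1
    refine intervalIntegral.integral_congr fun r hr => ?_
    rw [uIcc_of_le hst] at hr
    simp only [adjointControl_congr (hp ⟨hs.trans hr.1, hr.2.trans ht⟩)]
  adjoint := by
    intro s t hs hst ht x
    rw [← hp ⟨hs, hst.trans ht⟩, ← hp ⟨hs.trans hst, ht⟩, h.adjoint s t hs hst ht]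
    congr 1
    refine intervalIntegral.integral_congr fun r hr => ?_
    rw [uIcc_of_le hst] at hr
    simp only [source, hy ⟨hs.trans hr.1, hr.2.trans ht⟩]

theorem mono (h : S.IsExtremal T y p) {T' : ℝ} (hT : T' ≤ T) : S.IsExtremal T' y p where
  cont := h.cont.mono (Icc_subset_Icc_right hT)
  mild := h.mild.mono le_rfl hT
  adjoint := h.adjoint.mono le_rfl hT

/-- A periodic extremal on one period is an extremal on every interval. -/
theorem of_periodic (h : S.IsExtremal S.θ y p) (hy : Function.Periodic y S.θ)
    (hp : Function.Periodic p S.θ) (T : ℝ) : S.IsExtremal T y p := by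
  obtain ⟨n, hn⟩ := exists_nat_ge (T / S.θ)
  rw [div_le_iff₀ S.θ_pos] at hn
  have hE := S.isEvolutionFamily
  have hEp := S.generates.periodic S.θ_pos S.A_periodic
  have hfp : Function.Periodic (fun t => S.B t (S.adjointControl p t)) S.θ := fun t => by
    simp only [periodic_adjointControl hp t, S.B_periodic t]
  have hfi := integrableOn_B_apply (S := S) (h.memLp S.θ_pos.le)
  have hm := h.mild.nat_mul hE hEp S.θ_pos hy hfp hfi n
  have hfn : IntegrableOn (fun t => S.B t (S.adjointControl p t)) (Ioc 0 (n * S.θ)) := by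
    have := S.θ_pos.le
    exact (intervalIntegrable_iff_integrableOn_Ioc_of_le (by positivity)).1
      (hfp.intervalIntegrable₀ S.θ_pos.ne'
        ((intervalIntegrable_iff_integrableOn_Ioc_of_le S.θ_pos.le).2 hfi) _ _)
  refine mono (S := S) (T := n * S.θ) ⟨hm.continuousOn hE le_rfl hfn, hm,
    h.adjoint.nat_mul hE hEp S.θ_pos hp (periodic_source hy) (S.integrableOn_source h.cont) n⟩ hn

/-- If the adjoint evolution is strongly continuous then the adjoint state is norm continuous. -/
theorem continuousOn_adjoint (h : S.IsExtremal T y p) (hc : S.HasContinuousAdjoint) :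
    ContinuousOn p (Icc 0 T) := by
  obtain ⟨G, hGE, hG⟩ : ∃ G : ℝ × ℝ → H →L[𝕜] H,
      (∀ t τ, 0 ≤ t → t ≤ τ → G (τ, t) = ContinuousLinearMap.adjoint (S.E τ t)) ∧
        ∀ x, Continuous fun q => G q x := by
    refine ⟨fun q => ContinuousLinearMap.adjoint (extendEvolution S.E q),
      fun t τ h0 h1 => by simp only [extendEvolution_eq h0 h1], fun x => ?_⟩
    exact (hc x).comp_continuous (f := fun q : ℝ × ℝ => (max q.1 (max q.2 0), max q.2 0))
      (by fun_prop) fun q => ⟨le_max_right _ _, le_max_right _ _⟩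
  obtain ⟨M, hM0, hM⟩ := exists_norm_le_of_isCompact
    ((isCompact_Icc (a := (0 : ℝ)) (b := T)).prod (isCompact_Icc (a := (0 : ℝ)) (b := T)))
    fun x => (hG x).continuousOn
  have hs := S.integrableOn_source h.cont
  have key := continuousOn_integral_right (a := 0) (b := T)
    (g := fun t τ => G (τ, t) (S.source y τ)) (β := fun τ => M * ‖S.source y τ‖)
    (fun t _ => (continuous_apply_of_strong hG).comp_aestronglyMeasurable
      (((continuous_id.prodMk (continuous_const (y := t))).aestronglyMeasurable).prodMk hs.1))
    (hs.norm.const_mul M)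
    (fun t ht r hr => (G (r, t)).le_of_opNorm_le (hM (r, t) ⟨Ioc_subset_Icc_self hr, ht⟩) _)
    (fun r _ => ((hG (S.source y r)).comp
      ((continuous_const (y := r)).prodMk continuous_id)).continuousOn)
  have key' : ContinuousOn (fun t => G (T, t) (p T)) (Icc 0 T) :=
    ((hG (p T)).comp ((continuous_const (y := T)).prodMk continuous_id)).continuousOn
  have hp := (S.isAdjointState_iff h.cont).2 h.adjoint
  refine (key'.add key).congr fun t ht => ?_
  rw [hp t ht, Pi.add_apply, hGE t T ht.1 ht.2]
  congr 1
  refine intervalIntegral.integral_congr fun r hr => ?_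
  rw [uIcc_of_le ht.2] at hr
  simp only [hGE t r ht.1 hr.1, source]

end IsExtremal

end PeriodicLQ

/-! ### The solutions of the two problems -/

namespace PeriodicLQ

variable {𝕜 : Type*} [RCLike 𝕜]
  {H : Type*} [NormedAddCommGroup H] [InnerProductSpace 𝕜 H] [NormedSpace ℝ H] [CompleteSpace H]
  {U : Type*} [NormedAddCommGroup U] [InnerProductSpace 𝕜 U] [CompleteSpace U]
  {S : PeriodicLQ 𝕜 H U} {T : ℝ} {y p z q : ℝ → H} {u v : ℝ → U} {y₀ : H}

theorem IsAdjointState.congr (h : S.IsAdjointState T z q) (hy : EqOn z y (Icc 0 T)) :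
    S.IsAdjointState T y q := by
  intro t ht
  rw [h t ht]
  congr 1
  refine intervalIntegral.integral_congr fun τ hτ => ?_
  rw [uIcc_of_le ht.2] at hτ
  simp only [hy ⟨ht.1.trans hτ.1, hτ.2⟩]

/-- Uniqueness of the adjoint state. The boundary condition on the adjoint states is
`p(T) = κ p(0)`, where `κ = 0` or `κ = 1`. -/
theorem IsExtremal.adjoint_eqOn (h : S.IsExtremal T y p) (hT : 0 ≤ T)
    (hz : EqOn z y (Icc 0 T)) (hv : v =ᵐ[volume.restrict (Icc 0 T)] S.adjointControl p)
    (hq : S.IsAdjointState T z q)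
    (hvq : ∀ᵐ t ∂(volume.restrict (Icc 0 T)), v t = S.adjointControl q t)
    {κ : 𝕜} (hκ : starRingEnd 𝕜 κ = κ) (hp : p T = κ • p 0) (hq' : q T = κ • q 0)
    {K : ℝ → H →L[𝕜] U} (hK : ∀ x, Continuous fun t => K t x) {V : ℝ → ℝ → H →L[𝕜] H}
    (hV : IsPerturbedEvolution S.E (fun t => (S.B t).comp (K t)) V)
    (hu : IsUnit (1 - κ • V T 0)) : EqOn q p (Icc 0 T) := by
  refine (h.adjoint_unique hT ((S.isAdjointState_iff h.cont).1 (hq.congr hz)) ?_ hκ hp hq'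
    hK hV hu).symm
  rw [← restrict_Icc_eq_restrict_Ioc]
  filter_upwards [hv, hvq] with t h1 h2
  rw [← h1, h2]

theorem IsExtremal.isAdjointState (h : S.IsExtremal T y p) : S.IsAdjointState T y p :=
  (S.isAdjointState_iff h.cont).2 h.adjoint

theorem IsExtremal.isSolutionLQ (h : S.IsExtremal T y p) (hT : 0 ≤ T) (hy : y 0 = y₀)
    (hp : p T = 0) : S.IsSolutionLQ T y₀ y (S.adjointControl p) p :=
  ⟨⟨⟨h.isTrajectory hT, hy⟩, fun z v hz hz0 => h.cost_le hT hz (by simp [hp, hz0, hy])⟩,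
    h.isAdjointState, hp, Eventually.of_forall fun _ => rfl⟩

theorem IsExtremal.isSolutionPer (h : S.IsExtremal S.θ y p) (hy : y 0 = y S.θ)
    (hp : p 0 = p S.θ) : S.IsSolutionPer y (S.adjointControl p) p :=
  ⟨⟨⟨h.isTrajectory S.θ_pos.le, hy⟩, fun z v hz hz0 =>
    h.cost_le S.θ_pos.le hz (by rw [hp, hz0, hy])⟩,
    h.isAdjointState, hp, Eventually.of_forall fun _ => rfl⟩

theorem isUnit_one_sub_zero_smul (W : H →L[𝕜] H) : IsUnit (1 - (0 : 𝕜) • W) := by simp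

/-- An extremal with `y(0) = y₀` and `p(T) = 0` is the only optimal solution. -/
theorem IsExtremal.eq_of_isOptimalLQ (h : S.IsExtremal T y p) (hT : 0 ≤ T) (hy : y 0 = y₀)
    (hp : p T = 0) (hdet : S.IsDetectable) (ho : S.IsOptimalLQ T y₀ z v) :
    EqOn z y (Icc 0 T) ∧ v =ᵐ[volume.restrict (Icc 0 T)] S.adjointControl p := by
  obtain ⟨K, -, hK, V, hV, -⟩ := hdet
  exact h.eq_of_cost_le hT ho.1.1 (κ := 0) (by simp) (by simp [hp]) (by simp [hy, ho.1.2])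
    hK hV (isUnit_one_sub_zero_smul _) (ho.2 _ _ (h.isTrajectory hT) hy)

theorem IsExtremal.adjoint_eqOn_of_isSolutionLQ (h : S.IsExtremal T y p) (hT : 0 ≤ T)
    (hy : y 0 = y₀) (hp : p T = 0) (hstab : S.IsStabilizable) (hdet : S.IsDetectable)
    (ho : S.IsSolutionLQ T y₀ z v q) : EqOn q p (Icc 0 T) := by
  obtain ⟨h1, h2⟩ := h.eq_of_isOptimalLQ hT hy hp hdet ho.1
  obtain ⟨K, -, hK, V, hV, -⟩ := hstab
  exact h.adjoint_eqOn hT h1 h2 ho.2.1 ho.2.2.2 (κ := 0) (by simp) (by simp [hp])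
    (by simp [ho.2.2.1]) hK hV (isUnit_one_sub_zero_smul _)

/-- The monodromy operator of a stable periodic perturbation, in the form needed for `κ = 1`. -/
theorem isUnit_one_sub_of_isExpStable {F : ℝ → H →L[𝕜] H} {V : ℝ → ℝ → H →L[𝕜] H}
    (hF : ∀ x, Continuous fun t => F t x) (hFp : Function.Periodic F S.θ)
    (hV : IsPerturbedEvolution S.E F V) (hs : IsExpStable V) :
    IsUnit (1 - (1 : 𝕜) • V S.θ 0) := by
  rw [one_smul]
  exact hs.isUnit_one_sub hV.1 S.θ_pos (hV.periodic S.isEvolutionFamily hF S.θ_pos.le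
    (S.generates.periodic S.θ_pos S.A_periodic) hFp)

theorem periodic_B_comp {K : ℝ → H →L[𝕜] U} (hK : Function.Periodic K S.θ) :
    Function.Periodic (fun t => (S.B t).comp (K t)) S.θ := fun t => by
  simp only [hK t, S.B_periodic t]

theorem periodic_comp_C {K : ℝ → H →L[𝕜] H} (hK : Function.Periodic K S.θ) :
    Function.Periodic (fun t => (K t).comp (S.C t)) S.θ := fun t => by
  simp only [hK t, S.C_periodic t]

/-- A periodic extremal is the only optimal solution of the periodic problem. -/
theorem IsExtremal.eq_of_isOptimalPer (h : S.IsExtremal S.θ y p) (hy : y 0 = y S.θ)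
    (hp : p 0 = p S.θ) (hdet : S.IsDetectable) (ho : S.IsOptimalPer z v) :
    EqOn z y (Icc 0 S.θ) ∧ v =ᵐ[volume.restrict (Icc 0 S.θ)] S.adjointControl p := by
  obtain ⟨K, hKp, hK, V, hV, hs⟩ := hdet
  exact h.eq_of_cost_le S.θ_pos.le ho.1.1 (κ := 1) (by simp) (by simp [hp])
    (by rw [hy, ho.1.2, one_smul]) hK hV
    (isUnit_one_sub_of_isExpStable (continuous_comp_apply hK S.C_cont) (periodic_comp_C hKp) hV hs)
    (ho.2 _ _ (h.isTrajectory S.θ_pos.le) hy)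

theorem IsExtremal.adjoint_eqOn_of_isSolutionPer (h : S.IsExtremal S.θ y p) (hy : y 0 = y S.θ)
    (hp : p 0 = p S.θ) (hstab : S.IsStabilizable) (hdet : S.IsDetectable)
    (ho : S.IsSolutionPer z v q) : EqOn q p (Icc 0 S.θ) := by
  obtain ⟨h1, h2⟩ := h.eq_of_isOptimalPer hy hp hdet ho.1
  obtain ⟨K, hKp, hK, V, hV, hs⟩ := hstab
  exact h.adjoint_eqOn S.θ_pos.le h1 h2 ho.2.1 ho.2.2.2 (κ := 1) (by simp) (by simp [hp])
    (by simp [ho.2.2.1]) hK hV (isUnit_one_sub_of_isExpStable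
      (continuous_comp_apply S.B_cont hK) (periodic_B_comp hKp) hV hs)

theorem exists_extremal_LQ (hstab : S.IsStabilizable) (hdet : S.IsDetectable) (hT : 0 < T)
    (y₀ : H) : ∃ y p, S.IsExtremal T y p ∧ y 0 = y₀ ∧ p T = 0 := by
  obtain ⟨K₁, -, hK₁, V₁, hV₁, -⟩ := hstab
  obtain ⟨K₂, -, hK₂, V₂, hV₂, -⟩ := hdet
  obtain ⟨y, p, h, hy, hp⟩ := S.exists_extremal hT (κ := 0) (by simp) y₀ hK₁ hK₂ hV₁ hV₂
    (isUnit_one_sub_zero_smul _) (isUnit_one_sub_zero_smul _)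
  exact ⟨y, p, h, by simpa using hy, by simpa using hp⟩

theorem exists_extremal_periodic (hstab : S.IsStabilizable) (hdet : S.IsDetectable) :
    ∃ y p, Function.Periodic y S.θ ∧ Function.Periodic p S.θ ∧ ∀ T, S.IsExtremal T y p := by
  obtain ⟨K₁, hK₁p, hK₁, V₁, hV₁, hs₁⟩ := hstab
  obtain ⟨K₂, hK₂p, hK₂, V₂, hV₂, hs₂⟩ := hdet
  obtain ⟨y, p, h, hy, hp⟩ := S.exists_extremal S.θ_pos (κ := 1) (by simp) 0 hK₁ hK₂ hV₁ hV₂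
    (isUnit_one_sub_of_isExpStable (continuous_comp_apply S.B_cont hK₁) (periodic_B_comp hK₁p)
      hV₁ hs₁)
    (isUnit_one_sub_of_isExpStable (continuous_comp_apply hK₂ S.C_cont) (periodic_comp_C hK₂p)
      hV₂ hs₂)
  rw [one_smul] at hp
  rw [one_smul, add_zero] at hy
  obtain ⟨y', hy'p, hy'⟩ := exists_periodic_eqOn y S.θ_pos hy
  obtain ⟨p', hp'p, hp'⟩ := exists_periodic_eqOn p S.θ_pos hp.symm
  exact ⟨y', p', hy'p, hp'p, (h.congr hy' hp').of_periodic hy'p hp'p⟩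

end PeriodicLQ

end PeriodicTurnpike

end

theorem theorem2p1 {𝕜 : Type*} [RCLike 𝕜]
    {H : Type*} [NormedAddCommGroup H] [InnerProductSpace 𝕜 H] [NormedSpace ℝ H] [CompleteSpace H]
    {U : Type*} [NormedAddCommGroup U] [InnerProductSpace 𝕜 U] [CompleteSpace U]
    (S : PeriodicTurnpike.PeriodicLQ 𝕜 H U) (y₀ : H)
    (hstab : S.IsStabilizable) (hdet : S.IsDetectable) :
    ∃ (yθ : ℝ → H) (uθ : ℝ → U) (pθ : ℝ → H),
      -- the periodic problem has a solution, extended by periodicity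
      S.IsSolutionPer yθ uθ pθ ∧
      Function.Periodic yθ S.θ ∧ Function.Periodic uθ S.θ ∧ Function.Periodic pθ S.θ ∧
      (∀ t, uθ t = S.adjointControl pθ t) ∧
      (S.HasContinuousAdjoint → Continuous pθ) ∧
      -- it is unique
      (∀ y u, S.IsOptimalPer y u →
        EqOn y yθ (Icc 0 S.θ) ∧ u =ᵐ[volume.restrict (Icc 0 S.θ)] uθ) ∧
      (∀ y u p, S.IsSolutionPer y u p → EqOn p pθ (Icc 0 S.θ)) ∧
      -- exponential turnpike property
      ∃ c ν T₀ : ℝ, 0 < c ∧ 0 < ν ∧ 0 < T₀ ∧ ∀ T, T₀ ≤ T →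
        ∃ (yT : ℝ → H) (uT : ℝ → U) (pT : ℝ → H),
          -- the solution of the problem on `[0, T]`, which is unique
          S.IsSolutionLQ T y₀ yT uT pT ∧
          (∀ t ∈ Icc 0 T, uT t = S.adjointControl pT t) ∧
          (S.HasContinuousAdjoint → ContinuousOn pT (Icc 0 T)) ∧
          (∀ y u, S.IsOptimalLQ T y₀ y u →
            EqOn y yT (Icc 0 T) ∧ u =ᵐ[volume.restrict (Icc 0 T)] uT) ∧
          (∀ y u p, S.IsSolutionLQ T y₀ y u p → EqOn p pT (Icc 0 T)) ∧
          ∀ t ∈ Icc 0 T,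
            ‖yT t - yθ t‖ + ‖uT t - uθ t‖ + ‖pT t - pθ t‖ ≤
              c * (Real.exp (-ν * t) + Real.exp (-ν * (T - t))) := by
  obtain ⟨yθ, pθ, hyp, hpp, hext⟩ :=
    PeriodicTurnpike.PeriodicLQ.exists_extremal_periodic hstab hdet
  have hy : yθ 0 = yθ S.θ := by simpa using (hyp 0).symm
  have hp : pθ 0 = pθ S.θ := by simpa using (hpp 0).symm
  obtain ⟨c, ν, hc, hν, hbound⟩ :=
    PeriodicTurnpike.PeriodicLQ.exists_turnpike_bound hstab hdet
  obtain ⟨P, hP0, hP⟩ :=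
    PeriodicTurnpike.exists_norm_le_of_weakOn (hext S.θ).continuousOn_inner
  have hPT : ∀ t, ‖pθ t‖ ≤ P := fun t => by
    obtain ⟨s, hs, he⟩ := hpp.exists_mem_Ico₀ S.θ_pos t
    rw [he]
    exact hP s (Ico_subset_Icc_self hs)
  refine ⟨yθ, S.adjointControl pθ, pθ, (hext _).isSolutionPer hy hp, hyp,
    PeriodicTurnpike.PeriodicLQ.periodic_adjointControl hpp, hpp, fun _ => rfl,
    fun hcont => PeriodicTurnpike.continuous_of_periodic S.θ_pos hpp
      ((hext _).continuousOn_adjoint hcont),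
    fun y u ho => (hext _).eq_of_isOptimalPer hy hp hdet ho,
    fun y u p ho => (hext _).adjoint_eqOn_of_isSolutionPer hy hp hstab hdet ho,
    c * (‖y₀ - yθ 0‖ + P), ν, 1, by positivity, hν, one_pos, fun T hT => ?_⟩
  have hT0 : 0 < T := one_pos.trans_le hT
  obtain ⟨yT, pT, h, h0, hT'⟩ :=
    PeriodicTurnpike.PeriodicLQ.exists_extremal_LQ hstab hdet hT0 y₀
  refine ⟨yT, S.adjointControl pT, pT, h.isSolutionLQ hT0.le h0 hT', fun _ _ => rfl,
    h.continuousOn_adjoint, fun y u ho => h.eq_of_isOptimalLQ hT0.le h0 hT' hdet ho,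
    fun y u p ho => h.adjoint_eqOn_of_isSolutionLQ hT0.le h0 hT' hstab hdet ho, fun t ht => ?_⟩
  have hb := hbound T _ _ hT0.le (h.sub hT0.le (hext T)) t ht
  rw [PeriodicTurnpike.PeriodicLQ.adjointControl_sub] at hb
  refine hb.trans ?_
  rw [h0, hT', zero_sub, norm_neg]
  gcongr
  exact hPT T
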